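/- Let $K$ be a field, let $d\ge 2$, $t\ge 1$ and $n\ge 1+(d-1)t$ be integers, and let $S=K[x_1,\dots,x_n]$ with its standard grading. A monomial $x_{k_1}x_{k_2}\cdots x_{k_d}\in S$ with $1\le k_1\le\cdots\le k_d\le n$ is called $t$-spread if $k_{r+1}-k_r\ge t$ for $r=1,\dots,d-1$; let $M_{n,d,t}$ be the set of all $t$-spread monomials of degree $d$. It is ordered by the squarefree lexicographic order: $x_{k_1}\cdots x_{k_d}>_{\mathrm{slex}}x_{l_1}\cdots x_{l_d}$ if, for some $s$, $k_1=l_1,\dots,k_{s-1}=l_{s-1}$ and $k_s<l_s$. (On $M_{n,d,t}$ this is the usual lexicographic order $>_{\mathrm{lex}}$ with $x_1>\cdots>x_n$.) For a monomial $w\neq 1$ let $\min(w)$ and $\max(w)$ be the smallest and the largest index of a variable dividing $w$. Let $u=x_{i_1}\cdots x_{i_d}$ and $v=x_{j_1}\cdots x_{j_d}$, written with increasing indices, be elements of $M_{n,d,t}$ with $u\ge_{\mathrm{slex}}v$, and let $\mathcal L_t(u,v)=\{\omega\in M_{n,d,t}: u\ge_{\mathrm{slex}}\omega\ge_{\mathrm{slex}}v\}$.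 Assume that the ideal $I=(\mathcal L_t(u,v))$ is completely $t$-spread lexsegment, i.e. $I=J\cap T$, where $J$ is the ideal generated by all $\omega\in M_{n,d,t}$ with $\omega\ge_{\mathrm{slex}}v$ and $T$ is the ideal generated by all $\omega\in M_{n,d,t}$ with $\omega\le_{\mathrm{slex}}u$. Assume moreover that $\min(u)=1$ and $\min(v)>\min(u)$. Then $I$ has a linear resolution (that is, for some $e$ the graded Betti numbers satisfy $\beta_{i,j}(I)=0$ for all $i\ge 0$ and all $j\neq e+i$) if and only if one of the following conditions holds: (i) $i_2=1+t$; (ii) $i_2>1+t$ and, for the largest $\omega\in M_{n,d,t}$ with $\omega<_{\mathrm{lex}}v$, we have $$x_1\bigl(\omega/x_{\max(\omega)}\bigr)\le_{\mathrm{lex}}x_1x_{i_2-t}x_{i_3-t}\cdots x_{i_d-t},$$ where the requirement on $\omega$ is void if $v$ is the smallest element of $M_{n,d,t}$. -/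

import Mathlib

open MvPolynomial

/-! ### Graded free resolutions and linear resolutions

`S = MvPolynomial (Fin n) K`.  The variable `X k`, for `k : Fin n`, is the variable `x_{k+1}` of the
usual numbering `x_1, …, x_n`. -/

/-- For a finite family of degrees `deg : ι → ℕ`, the free module `ι → S` is regarded as the graded
module `⨁_k S(-deg k)`, whose `k`-th basis element has degree `deg k`.
This says that `f` is homogeneous of degree `j` in it. -/
def IsHomogeneousVec {n : ℕ} {K : Type*} [Field K] {ι : Type} (deg : ι → ℕ) (j : ℕ)
    (f : ι → MvPolynomial (Fin n) K) : Prop :=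
  ∀ k, ∀ m ∈ (f k).support, m.degree + deg k = j

/-- A graded free resolution `⋯ → F 1 → F 0 → I → 0` of an ideal `I` of `S`, where
`F i = ⨁_{k : ι i} S(-deg i k)` has finite rank and all maps preserve degrees. -/
structure GradedFreeResolution {n : ℕ} {K : Type*} [Field K]
    (I : Ideal (MvPolynomial (Fin n) K)) where
  ι : ℕ → Type
  finite_ι : ∀ i, Finite (ι i)
  deg : ∀ i, ι i → ℕ
  /-- the differential `F (i + 1) → F i` -/
  diff : ∀ i, (ι (i + 1) → MvPolynomial (Fin n) K) →ₗ[MvPolynomial (Fin n) K]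
    (ι i → MvPolynomial (Fin n) K)
  /-- the augmentation `F 0 → I ⊆ S` -/
  aug : (ι 0 → MvPolynomial (Fin n) K) →ₗ[MvPolynomial (Fin n) K] MvPolynomial (Fin n) K
  diff_homogeneous : ∀ i j f, IsHomogeneousVec (deg (i + 1)) j f →
    IsHomogeneousVec (deg i) j (diff i f)
  aug_homogeneous : ∀ j f, IsHomogeneousVec (deg 0) j f → (aug f).IsHomogeneous j
  range_aug : LinearMap.range aug = I
  exact_zero : Function.Exact (diff 0) aug
  exact_succ : ∀ i, Function.Exact (diff (i + 1)) (diff i)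

/-- The resolution is minimal: every differential maps `F (i + 1)` into `𝔪 F i`, where
`𝔪 = (x_1, …, x_n)`. -/
def GradedFreeResolution.IsMinimal {n : ℕ} {K : Type*} [Field K]
    {I : Ideal (MvPolynomial (Fin n) K)} (F : GradedFreeResolution I) : Prop :=
  ∀ i f k, constantCoeff (F.diff i f k) = 0

/-- The number of copies of `S(-j)` in `F i`; when `F` is minimal, this is the graded Betti number
`β_{i,j}(I)`. -/
noncomputable def GradedFreeResolution.betti {n : ℕ} {K : Type*} [Field K]
    {I : Ideal (MvPolynomial (Fin n) K)} (F : GradedFreeResolution I) (i j : ℕ) : ℕ :=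
  Nat.card {k : F.ι i // F.deg i k = j}

/-- `I` has an `e`-linear resolution: in its minimal graded free resolution (which is unique up to
isomorphism), `β_{i,j}(I) = 0` for all `i` and all `j ≠ e + i`. -/
def HasLinearResolutionOfDegree {n : ℕ} {K : Type*} [Field K]
    (I : Ideal (MvPolynomial (Fin n) K)) (e : ℕ) : Prop :=
  ∃ F : GradedFreeResolution I, F.IsMinimal ∧ ∀ i j, j ≠ e + i → F.betti i j = 0

/-- `I` has a linear resolution: it has an `e`-linear resolution for some `e`. -/
def HasLinearResolution {n : ℕ} {K : Type*} [Field K]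
    (I : Ideal (MvPolynomial (Fin n) K)) : Prop :=
  ∃ e, HasLinearResolutionOfDegree I e

/-! ### `t`-spread monomials

A monomial `x_{i_1} ⋯ x_{i_d}` is given by its sequence of variables `a : Fin d → Fin n`, so that
`i_k = a (k - 1) + 1`. -/

/-- The set `M_{n,d,t}` of `t`-spread monomials of degree `d`: `i_{k+1} - i_k ≥ t` for
`k = 1, …, d - 1`. For `t ≥ 1` the sequence is increasing and determined by the monomial. -/
def spreadMonomials (n d t : ℕ) : Set (Fin d → Fin n) :=
  {a | ∀ k, ∀ h : k + 1 < d, (a ⟨k, by omega⟩ : ℕ) + t ≤ (a ⟨k + 1, h⟩ : ℕ)}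

/-- The index `i_k` of the `k`-th variable of the monomial `x_{i_1} ⋯ x_{i_d}`, `1 ≤ k ≤ d`, in the
numbering of the variables from `1` to `n`. -/
def idx {n d : ℕ} (a : Fin d → Fin n) (k : ℕ) (hk : 1 ≤ k ∧ k ≤ d) : ℕ :=
  (a ⟨k - 1, by omega⟩ : ℕ) + 1

/-- The exponent vector of the monomial `x_{i_1} ⋯ x_{i_d}`. -/
noncomputable def expo {n d : ℕ} (a : Fin d → Fin n) : Fin n →₀ ℕ :=
  ∑ k, Finsupp.single (a k) 1

/-- The squarefree lexicographic order `a >_slex b`: `i_1 = j_1, …, i_{s-1} = j_{s-1}` and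
`i_s < j_s` for some `s`. -/
def SlexGT {n d : ℕ} (a b : Fin d → Fin n) : Prop :=
  ∃ s, (∀ r, r < s → a r = b r) ∧ a s < b s

/-- `a ≥_slex b`. -/
def SlexGE {n d : ℕ} (a b : Fin d → Fin n) : Prop :=
  a = b ∨ SlexGT a b

/-! ### `t`-spread lexsegments -/

/-- The `t`-spread lexsegment `L_t(u,v)`. -/
def lexsegment {n d : ℕ} (t : ℕ) (u v : Fin d → Fin n) : Set (Fin d → Fin n) :=
  {w | w ∈ spreadMonomials n d t ∧ SlexGE u w ∧ SlexGE w v}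

/-- The initial `t`-spread lexsegment `L_t^i(v)`. -/
def initialLexsegment {n d : ℕ} (t : ℕ) (v : Fin d → Fin n) : Set (Fin d → Fin n) :=
  {w | w ∈ spreadMonomials n d t ∧ SlexGE w v}

/-- The final `t`-spread lexsegment `L_t^f(u)`. -/
def finalLexsegment {n d : ℕ} (t : ℕ) (u : Fin d → Fin n) : Set (Fin d → Fin n) :=
  {w | w ∈ spreadMonomials n d t ∧ SlexGE u w}

/-- The ideal of `K[x_1, …, x_n]` generated by a set of monomials. -/
noncomputable def idealOf (K : Type*) [Field K] {n d : ℕ} (L : Set (Fin d → Fin n)) :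
    Ideal (MvPolynomial (Fin n) K) :=
  Ideal.span ((fun a => monomial (expo a) (1 : K)) '' L)

/-- The ideal `I = (L_t(u,v))` is completely `t`-spread lexsegment: `I = J ∩ T` with
`J = (L_t^i(v))` and `T = (L_t^f(u))`. -/
def IsCompletelyLexsegment (K : Type*) [Field K] {n d : ℕ} (t : ℕ) (u v : Fin d → Fin n) : Prop :=
  idealOf K (lexsegment t u v) =
    idealOf K (initialLexsegment t v) ⊓ idealOf K (finalLexsegment t u)

/-- `w` is the largest monomial of `M_{n,d,t}` that is smaller than `v`. -/
def IsLargestBelow {n d : ℕ} (t : ℕ) (w v : Fin d → Fin n) : Prop :=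
  (w ∈ spreadMonomials n d t ∧ SlexGT v w) ∧
    ∀ z, z ∈ spreadMonomials n d t ∧ SlexGT v z → SlexGE w z

/-- The exponent vector of `x_1 (w / x_{max w})`, for `w = x_{i_1} ⋯ x_{i_d}` with
`i_1 ≤ ⋯ ≤ i_d`, so that `max w = i_d`. -/
noncomputable def expoReplaceMax {n d : ℕ} (hn : 1 ≤ n) (hd : 1 ≤ d) (w : Fin d → Fin n) :
    Fin n →₀ ℕ :=
  Finsupp.single ⟨0, hn⟩ 1 + (expo w - Finsupp.single (w ⟨d - 1, by omega⟩) 1)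

/-- The exponent vector of `x_1 x_{i_2 - t} ⋯ x_{i_d - t}`, for `u = x_{i_1} ⋯ x_{i_d}` (used only
when `1 + t < i_2 ≤ ⋯ ≤ i_d`). -/
noncomputable def expoShift {n d : ℕ} (hn : 1 ≤ n) (t : ℕ) (u : Fin d → Fin n) : Fin n →₀ ℕ :=
  Finsupp.single ⟨0, hn⟩ 1 +
    ∑ k ∈ Finset.univ.filter (fun k : Fin d => 1 ≤ (k : ℕ)),
      Finsupp.single (⟨(u k : ℕ) - t, lt_of_le_of_lt (Nat.sub_le _ _) (u k).isLt⟩ : Fin n) 1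

/-! ### Koszul chains -/

/-! Linearity is read off from Koszul homology. An ideal generated in degree e has an e-linear
resolution when every Koszul cycle whose coefficients have degree above e bounds a chain with
coefficients in the ideal one degree lower (`KoszulLinear`), and conversely. Both directions are
dimension shifting: `KoszulLinear.ker` passes linearity on to syzygies, so a minimal resolution can
be built step by step (`KoszulLinear.hasLinearResolution`), and `KoszulLinearBelow.range` carries
linearity from the syzygies in a given resolution back to the ideal
(`HasLinearResolutionOfDegree.koszulLinear`).

Monomials become increasing lists of indices, a larger monomial being a smaller list, and v is
replaced by the next smaller monomial w, so that the lexsegment is the interval u ≤ z < w. The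
inequality in (ii) becomes `ShiftLE`: (u_2, …, u_d) is at most (w_1 + t, …, w_{d-1} + t).

Sufficiency: for u_1 < w_1 write I = x_{u_1} B + A with A and B free of x_{u_1}. Then x_{u_1} B ∩ A
= x_{u_1} (A ∩ B), and by Mayer–Vietoris I is linear once A, B and A ∩ B are (`VarLinear.split`).
Here A is an initial segment and B a final one. If u_2 = u_1 + t, then A ⊆ B. Under `ShiftLE`, A ∩ B
is a block of variables times B plus either an initial segment contained in B or x_{w_1} times a
shorter interval that again satisfies `ShiftLE`; the latter rests on `contains_spreadBetween`.

Necessity: if `ShiftLE` fails, `exists_blocks` leads to lists P < u and Q ≥ w and to a set L made of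
blocks {p_k, q_k} with p_k ≤ q_k, such that every transversal other than P is at least u and every
one other than Q is below w. Multiplying the Koszul relations x_p e_q - x_q e_p of all two-element
blocks but the last gives a cycle in multidegree x_L. Its coefficients are divisible by a generator
of J and by one of T, so by completeness they lie in I. It bounds nothing in I: products of
variables of L that lie in I contain a list below Q and a list above P, and an induction over the
blocks, again by Mayer–Vietoris, excludes such chains (`Blocks.exists_cycle`,
`Blocks.not_koszulLinear`). -/

/-- Koszul chains on a list of variables with coefficients in `N`: a chain on `v :: vs` is a pair
`(a, b)`, standing for `a + e_v ∧ b`. -/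
def Kos {α : Type*} (N : Type*) : List α → Type _
  | [] => N
  | _ :: vs => Kos N vs × Kos N vs

namespace Kos

variable {α : Type*} {N N' N'' : Type*} [AddCommGroup N] [AddCommGroup N'] [AddCommGroup N'']

instance instAddCommGroup : ∀ vs : List α, AddCommGroup (Kos N vs)
  | [] => inferInstanceAs (AddCommGroup N)
  | _ :: vs =>
    let _ := instAddCommGroup vs
    inferInstanceAs (AddCommGroup (Kos N vs × Kos N vs))

/-- The part of a chain not involving `e_v`. -/
def fst {v : α} {vs : List α} : Kos N (v :: vs) →+ Kos N vs :=
  AddMonoidHom.fst (Kos N vs) (Kos N vs)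

/-- The coefficient of `e_v` in a chain. -/
def snd {v : α} {vs : List α} : Kos N (v :: vs) →+ Kos N vs :=
  AddMonoidHom.snd (Kos N vs) (Kos N vs)

/-- The chain `a + e_v ∧ b`. -/
def mk (v : α) {vs : List α} (a b : Kos N vs) : Kos N (v :: vs) := (a, b)

@[simp] theorem fst_mk {v : α} {vs : List α} (a b : Kos N vs) : fst (mk v a b) = a := rfl

@[simp] theorem snd_mk {v : α} {vs : List α} (a b : Kos N vs) : snd (mk v a b) = b := rfl

theorem ext {v : α} {vs : List α} {c c' : Kos N (v :: vs)} (h1 : fst c = fst c')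
    (h2 : snd c = snd c') : c = c' := Prod.ext h1 h2

/-- The map on chains induced by a map of coefficients. -/
def map (g : N →+ N') : ∀ vs : List α, Kos N vs →+ Kos N' vs
  | [] => g
  | _ :: vs => AddMonoidHom.prodMap (map g vs) (map g vs)

@[simp] theorem fst_map (g : N →+ N') {v : α} {vs : List α} (c : Kos N (v :: vs)) :
    fst (map g _ c) = map g vs (fst c) := rfl

@[simp] theorem snd_map (g : N →+ N') {v : α} {vs : List α} (c : Kos N (v :: vs)) :
    snd (map g _ c) = map g vs (snd c) := rfl

/-- The Koszul differential, where the variable `v` acts on the coefficients by `f v`. -/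
def d (f : α → N →+ N) : ∀ vs : List α, Kos N vs →+ Kos N vs
  | [] => 0
  | v :: vs => AddMonoidHom.prod ((d f vs).comp fst + (map (f v) vs).comp snd)
      (-((d f vs).comp snd))

@[simp] theorem fst_d (f : α → N →+ N) {v : α} {vs : List α} (c : Kos N (v :: vs)) :
    fst (d f _ c) = d f vs (fst c) + map (f v) vs (snd c) := rfl

@[simp] theorem snd_d (f : α → N →+ N) {v : α} {vs : List α} (c : Kos N (v :: vs)) :
    snd (d f _ c) = -d f vs (snd c) := rfl

theorem map_map (g : N →+ N') (g' : N' →+ N'') : ∀ {vs : List α} (c : Kos N vs),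
    map g' vs (map g vs c) = map (g'.comp g) vs c
  | [], _ => rfl
  | _ :: _, c => ext (map_map g g' (fst c)) (map_map g g' (snd c))

theorem map_id : ∀ {vs : List α} (c : Kos N vs), map (AddMonoidHom.id N) vs c = c
  | [], _ => rfl
  | _ :: _, c => ext (map_id (fst c)) (map_id (snd c))

theorem map_add_map (g g' : N →+ N') : ∀ {vs : List α} (c : Kos N vs),
    map (g + g') vs c = map g vs c + map g' vs c
  | [], _ => rfl
  | _ :: _, c => ext (map_add_map g g' (fst c)) (map_add_map g g' (snd c))

theorem map_zero_map : ∀ {vs : List α} (c : Kos N vs),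
    map (0 : N →+ N') vs c = 0
  | [], _ => rfl
  | _ :: _, c => ext (map_zero_map (fst c)) (map_zero_map (snd c))

theorem map_d {f : α → N →+ N} {f' : α → N' →+ N'} {g : N →+ N'} : ∀ {vs : List α}
    (_ : ∀ v ∈ vs, ∀ n, g (f v n) = f' v (g n)) (c : Kos N vs),
    map g vs (d f vs c) = d f' vs (map g vs c)
  | [], _, _ => map_zero g
  | v :: vs, h, c => by
    have h1 : ∀ v ∈ vs, ∀ n, g (f v n) = f' v (g n) := fun w hw => h w (List.mem_cons_of_mem _ hw)
    have h2 : g.comp (f v) = (f' v).comp g := by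
      ext n; exact h v List.mem_cons_self n
    refine ext ?_ ?_
    · simp only [fst_map, fst_d, map_add, snd_map, map_d h1, map_map, h2]
    · simp only [snd_map, snd_d, map_neg, map_d h1]

theorem d_d {f : α → N →+ N} (hf : ∀ v w n, f v (f w n) = f w (f v n)) :
    ∀ {vs : List α} (c : Kos N vs), d f vs (d f vs c) = 0
  | [], _ => rfl
  | v :: vs, c => by
    have ih : ∀ c : Kos N vs, d f vs (d f vs c) = 0 := fun c => d_d hf c
    refine ext ?_ ?_
    · simp only [fst_d, map_add, ih, snd_d, map_neg, map_zero, zero_add]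
      rw [map_d (f' := f) (fun w _ n => hf v w n)]
      simp
    · simp only [snd_d, map_neg, ih, map_zero, neg_zero]

/-- The chains all of whose coefficients lie in `G`. -/
def All (G : AddSubgroup N) : ∀ vs : List α, AddSubgroup (Kos N vs)
  | [] => G
  | _ :: vs => AddSubgroup.prod (All G vs) (All G vs)

@[simp] theorem mem_all_cons {G : AddSubgroup N} {v : α} {vs : List α} {c : Kos N (v :: vs)} :
    c ∈ All G (v :: vs) ↔ fst c ∈ All G vs ∧ snd c ∈ All G vs := AddSubgroup.mem_prod

theorem map_mem_all {G : AddSubgroup N} {G' : AddSubgroup N'} {g : N →+ N'} :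
    ∀ {vs : List α} {c : Kos N vs}, c ∈ All G vs → (∀ n ∈ G, g n ∈ G') → map g vs c ∈ All G' vs
  | [], _, hc, h => h _ hc
  | _ :: _, _, hc, h => mem_all_cons.2
      ⟨map_mem_all (mem_all_cons.1 hc).1 h, map_mem_all (mem_all_cons.1 hc).2 h⟩

theorem all_mono {G G' : AddSubgroup N} {vs : List α} {c : Kos N vs} (hc : c ∈ All G vs)
    (h : G ≤ G') : c ∈ All G' vs := by
  have := map_mem_all (g := AddMonoidHom.id N) (G' := G') hc h
  rwa [map_id] at this

theorem d_mem_all {G G' : AddSubgroup N} {f : α → N →+ N} (h : ∀ v, ∀ n ∈ G, f v n ∈ G') :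
    ∀ {vs : List α} {c : Kos N vs}, c ∈ All G vs → d f vs c ∈ All G' vs
  | [], _, _ => zero_mem _
  | v :: _, _, hc => mem_all_cons.2
      ⟨add_mem (d_mem_all h (mem_all_cons.1 hc).1) (map_mem_all (mem_all_cons.1 hc).2 (h v)),
        neg_mem (d_mem_all h (mem_all_cons.1 hc).2)⟩

theorem exists_add_of_mem_all {G G₁ G₂ : AddSubgroup N}
    (h : ∀ n ∈ G, ∃ a ∈ G₁, ∃ b ∈ G₂, a + b = n) : ∀ {vs : List α} {c : Kos N vs},
    c ∈ All G vs → ∃ a ∈ All G₁ vs, ∃ b ∈ All G₂ vs, a + b = c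
  | [], c, hc => h c hc
  | v :: vs, c, hc => by
    obtain ⟨a, ha, b, hb, hab⟩ := exists_add_of_mem_all h (mem_all_cons.1 hc).1
    obtain ⟨a', ha', b', hb', hab'⟩ := exists_add_of_mem_all h (mem_all_cons.1 hc).2
    exact ⟨mk v a a', mem_all_cons.2 ⟨ha, ha'⟩, mk v b b', mem_all_cons.2 ⟨hb, hb'⟩,
      ext (by simpa using hab) (by simpa using hab')⟩

theorem mem_all_inf {G G' : AddSubgroup N} : ∀ {vs : List α} {c : Kos N vs},
    c ∈ All G vs → c ∈ All G' vs → c ∈ All (G ⊓ G') vs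
  | [], _, h, h' => ⟨h, h'⟩
  | _ :: _, _, h, h' => mem_all_cons.2 ⟨mem_all_inf (mem_all_cons.1 h).1 (mem_all_cons.1 h').1,
      mem_all_inf (mem_all_cons.1 h).2 (mem_all_cons.1 h').2⟩

theorem eq_zero_of_mem_all_bot : ∀ {vs : List α} {c : Kos N vs}, c ∈ All (⊥ : AddSubgroup N) vs →
    c = 0
  | [], _, h => h
  | _ :: _, _, h => ext (eq_zero_of_mem_all_bot (mem_all_cons.1 h).1)
      (eq_zero_of_mem_all_bot (mem_all_cons.1 h).2)

theorem mem_all_ker {g : N →+ N'} : ∀ {vs : List α} {c : Kos N vs}, map g vs c = 0 →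
    c ∈ All g.ker vs
  | [], _, h => h
  | _ :: _, _, h => mem_all_cons.2 ⟨mem_all_ker (by rw [← fst_map, h, map_zero]),
      mem_all_ker (by rw [← snd_map, h, map_zero])⟩

theorem map_eq_zero_of_mem_all_ker {g : N →+ N'} : ∀ {vs : List α} {c : Kos N vs},
    c ∈ All g.ker vs → map g vs c = 0
  | [], _, h => h
  | _ :: _, _, h => ext (map_eq_zero_of_mem_all_ker (mem_all_cons.1 h).1)
      (map_eq_zero_of_mem_all_ker (mem_all_cons.1 h).2)

/-- Chains with at least `i` factors `e_v` vanish. -/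
def Small (N : Type*) [AddCommGroup N] : ∀ (_ : ℕ) (vs : List α), AddSubgroup (Kos N vs)
  | 0, [] => (⊥ : AddSubgroup N)
  | _ + 1, [] => (⊤ : AddSubgroup N)
  -- For `i = 0` truncated subtraction keeps the index at `0`, where only the zero chain is left.
  | i, _ :: vs => AddSubgroup.prod (Small N i vs) (Small N (i - 1) vs)

theorem mem_small_cons {i : ℕ} {v : α} {vs : List α} {c : Kos N (v :: vs)} :
    c ∈ Small N i (v :: vs) ↔ fst c ∈ Small N i vs ∧ snd c ∈ Small N (i - 1) vs := by
  cases i <;> exact AddSubgroup.mem_prod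

theorem eq_zero_of_mem_small_zero : ∀ {vs : List α} {c : Kos N vs}, c ∈ Small N 0 vs → c = 0
  | [], _, h => h
  | _ :: _, _, h => ext (eq_zero_of_mem_small_zero (mem_small_cons.1 h).1)
      (eq_zero_of_mem_small_zero (mem_small_cons.1 h).2)

theorem map_mem_small {g : N →+ N'} : ∀ {i : ℕ} {vs : List α} {c : Kos N vs},
    c ∈ Small N i vs → map g vs c ∈ Small N' i vs
  | 0, [], c, h => by
    have : c = 0 := h
    rw [this, map_zero]; exact zero_mem _
  | _ + 1, [], _, _ => AddSubgroup.mem_top _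
  | _, _ :: _, _, h => mem_small_cons.2 ⟨map_mem_small (mem_small_cons.1 h).1,
      map_mem_small (mem_small_cons.1 h).2⟩

theorem d_mem_small {f : α → N →+ N} : ∀ {i : ℕ} {vs : List α} {c : Kos N vs},
    c ∈ Small N (i + 1) vs → d f vs c ∈ Small N i vs
  | _, [], _, _ => zero_mem _
  | 0, _ :: _, c, h => by
    have h' := mem_small_cons.1 h
    have h2 : snd c = 0 := eq_zero_of_mem_small_zero h'.2
    refine mem_small_cons.2 ⟨?_, ?_⟩
    · rw [fst_d, h2, map_zero, add_zero]; exact d_mem_small h'.1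
    · rw [snd_d, h2, map_zero, neg_zero]; exact zero_mem _
  | i + 1, _ :: _, c, h => by
    have h' := mem_small_cons.1 h
    exact mem_small_cons.2 ⟨add_mem (d_mem_small h'.1) (map_mem_small h'.2),
      neg_mem (d_mem_small h'.2)⟩

theorem mem_small_of_length_lt : ∀ {i : ℕ} {vs : List α} (_ : vs.length < i) (c : Kos N vs),
    c ∈ Small N i vs
  | 0, _, h, _ => absurd h (Nat.not_lt_zero _)
  | _ + 1, [], _, _ => AddSubgroup.mem_top _
  | _ + 1, _ :: _, h, _ => mem_small_cons.2
      ⟨mem_small_of_length_lt (by simp at h; omega) _,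
        mem_small_of_length_lt (by simp at h; omega) _⟩

/-- Coefficients are lifted one by one, and the coefficients that `Small` forces to vanish are
lifted to zero. So a lift stays in the same range of homological degrees. -/
theorem exists_lift {G : AddSubgroup N} {G' : AddSubgroup N'} {g : N →+ N'}
    (h : ∀ n ∈ G', ∃ m ∈ G, g m = n) : ∀ {i : ℕ} {vs : List α} {c : Kos N' vs},
    c ∈ All G' vs → c ∈ Small N' i vs → ∃ c' ∈ All G vs, c' ∈ Small N i vs ∧ map g vs c' = c
  | 0, [], c, _, hs => ⟨0, zero_mem _, zero_mem _, by
      have : c = 0 := hs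
      rw [this, map_zero]⟩
  | _ + 1, [], c, hc, _ => by
    obtain ⟨m, hm, hg⟩ := h c hc
    exact ⟨m, hm, AddSubgroup.mem_top _, hg⟩
  | i, v :: vs, c, hc, hs => by
    obtain ⟨a, ha, has, hag⟩ := exists_lift h (mem_all_cons.1 hc).1 (mem_small_cons.1 hs).1
    obtain ⟨b, hb, hbs, hbg⟩ := exists_lift h (mem_all_cons.1 hc).2 (mem_small_cons.1 hs).2
    exact ⟨mk v a b, mem_all_cons.2 ⟨ha, hb⟩, mem_small_cons.2 ⟨has, hbs⟩,
      ext (by simpa using hag) (by simpa using hbg)⟩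

/-- The composition of the maps `r v` for `v` in a list. -/
def foldMap (r : α → N →+ N) : List α → N →+ N
  | [] => AddMonoidHom.id N
  | v :: vs => (foldMap r vs).comp (r v)

/-- Division with remainder contracts the Koszul complex. If a + e_v ∧ b is a cycle, the remainder
of a modulo v is a cycle on the remaining variables, hence a boundary d y by induction, and then y +
e_v ∧ D_v a bounds a + e_v ∧ b. The condition on `foldMap` removes the part that survives all
remainders, which is the homology in degree zero. -/
theorem exists_d_eq {f D r : α → N →+ N} (hfD : ∀ v n, f v (D v n) + r v n = n)
    (hDf : ∀ v n, D v (f v n) = n) (hcomm : ∀ v w n, v ≠ w → D v (f w n) = f w (D v n))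
    (hf : ∀ v w n, f v (f w n) = f w (f v n))
    {G G' : AddSubgroup N} (hD : ∀ v, ∀ n ∈ G', D v n ∈ G) (hr : ∀ v, ∀ n ∈ G', r v n ∈ G') :
    ∀ {vs : List α} (_ : vs.Nodup) {c : Kos N vs},
    c ∈ All (G' ⊓ (foldMap r vs).ker) vs → d f vs c = 0 → ∃ y ∈ All G vs, d f vs y = c
  | [], _, c, hc, _ => ⟨0, zero_mem _, by
      have : c = 0 := hc.2
      rw [this, map_zero]⟩
  | v :: vs, hvs, c, hc, hd => by
    have hrD : ∀ n, r v n = n - f v (D v n) := fun n => by rw [eq_sub_iff_add_eq', hfD]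
    have hne : ∀ w ∈ vs, v ≠ w := fun w hw e => (List.nodup_cons.1 hvs).1 (e ▸ hw)
    have h1 : d f vs (fst c) = -map (f v) vs (snd c) := by
      rw [eq_neg_iff_add_eq_zero, ← fst_d, hd, map_zero]
    have hrf : ∀ w ∈ vs, ∀ n, r v (f w n) = f w (r v n) := fun w hw n => by
      rw [hrD, hrD, hcomm _ _ _ (hne w hw), map_sub, hf v w]
    -- The boundary of a is the multiple -v b of v, so it leaves no remainder.
    have hcyc : d f vs (map (r v) vs (fst c)) = 0 := by
      rw [← map_d (f := f) hrf, h1, map_neg, map_map, neg_eq_zero]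
      have : (r v).comp (f v) = 0 := by
        ext n; simp [hrD, hDf]
      rw [this, map_zero_map]
    obtain ⟨y, hy, hyd⟩ := exists_d_eq hfD hDf hcomm hf hD hr (List.nodup_cons.1 hvs).2
      (map_mem_all (G' := G' ⊓ (foldMap r vs).ker) (mem_all_cons.1 hc).1
        fun n hn => ⟨hr v n hn.1, hn.2⟩) hcyc
    refine ⟨mk v y (map (D v) vs (fst c)), mem_all_cons.2 ⟨hy,
      map_mem_all (mem_all_cons.1 hc).1 fun n hn => hD v n hn.1⟩, ext ?_ ?_⟩
    · rw [fst_d, fst_mk, snd_mk, hyd, map_map, ← map_add_map]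
      have : r v + (f v).comp (D v) = AddMonoidHom.id N := by
        ext n; simp [hrD]
      rw [this, map_id]
    · rw [snd_d, snd_mk, ← map_d (f := f) (fun w hw n => hcomm v w n (hne w hw)), h1, map_neg,
        map_map, neg_neg]
      have : (D v).comp (f v) = AddMonoidHom.id N := by
        ext n; simp [hDf]
      rw [this, map_id]

end Kos

/-! ### Koszul cycles of graded modules -/

section

variable {n : ℕ} {K : Type*} [Field K]

/-- Multiplication by the variable `X v` on a module over the polynomial ring. -/
noncomputable def varAct (N : Type*) [AddCommGroup N] [Module (MvPolynomial (Fin n) K) N]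
    (v : Fin n) : N →+ N :=
  DistribSMul.toAddMonoidHom N (X v : MvPolynomial (Fin n) K)

theorem varAct_apply {N : Type*} [AddCommGroup N] [Module (MvPolynomial (Fin n) K) N]
    (v : Fin n) (f : N) : varAct (K := K) N v f = (X v : MvPolynomial (Fin n) K) • f := rfl

theorem varAct_comm {N : Type*} [AddCommGroup N] [Module (MvPolynomial (Fin n) K) N]
    (v w : Fin n) (f : N) :
    varAct (K := K) N v (varAct (K := K) N w f) = varAct (K := K) N w (varAct (K := K) N v f) :=
  smul_comm _ _ _

section

variable {N : Type*} [AddCommGroup N] [Module (MvPolynomial (Fin n) K) N] [Module K N]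

/-- The part of degree `c` of a submodule, where `H` is the grading of the ambient module. -/
noncomputable def gradedPiece (H : ℕ → Submodule K N) (Z : Submodule (MvPolynomial (Fin n) K) N) (c : ℕ) :
    AddSubgroup N :=
  Z.toAddSubgroup ⊓ (H c).toAddSubgroup

/-- The Koszul homology of `Z` is concentrated on the linear strand starting in degree `r`: a Koszul
cycle with coefficients of degree `c + 1 > r` is the boundary of a chain with coefficients of
degree `c`. -/
def KoszulLinear (vs : List (Fin n)) (H : ℕ → Submodule K N) (r : ℕ)
    (Z : Submodule (MvPolynomial (Fin n) K) N) : Prop :=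
  ∀ c, r ≤ c → ∀ z ∈ Kos.All (gradedPiece H Z (c + 1)) vs, Kos.d (varAct (K := K) N) vs z = 0 →
    ∃ y ∈ Kos.All (gradedPiece H Z c) vs, Kos.d (varAct (K := K) N) vs y = z

/-- Multiplication by a variable raises the degree by one. -/
def VarDegreeOne (H : ℕ → Submodule K N) : Prop :=
  ∀ (v : Fin n) c, ∀ f ∈ H c, (X v : MvPolynomial (Fin n) K) • f ∈ H (c + 1)

theorem varAct_mem_gradedPiece {H : ℕ → Submodule K N} (hH : VarDegreeOne (n := n) H)
    {Z : Submodule (MvPolynomial (Fin n) K) N} {c : ℕ} (v : Fin n) :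
    ∀ f ∈ gradedPiece H Z c, varAct (K := K) N v f ∈ gradedPiece H Z (c + 1) :=
  fun f hf => ⟨Z.smul_mem _ hf.1, hH v c f hf.2⟩

theorem gradedPiece_mono {H : ℕ → Submodule K N} {Z Z' : Submodule (MvPolynomial (Fin n) K) N}
    (h : Z ≤ Z') (c : ℕ) : gradedPiece H Z c ≤ gradedPiece H Z' c :=
  fun _ hf => ⟨h hf.1, hf.2⟩

theorem koszulLinear_bot (vs : List (Fin n)) (H : ℕ → Submodule K N) (r : ℕ) :
    KoszulLinear vs H r (⊥ : Submodule (MvPolynomial (Fin n) K) N) := by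
  intro c _ z hz _
  have : z = 0 := Kos.eq_zero_of_mem_all_bot (Kos.all_mono hz inf_le_left)
  exact ⟨0, zero_mem _, by rw [this, map_zero]⟩

/-- The sum of two graded submodules with an `r`-linear resolution whose intersection has an
`(r + 1)`-linear resolution. -/
theorem KoszulLinear.sup {vs : List (Fin n)} {H : ℕ → Submodule K N}
    (hH : VarDegreeOne (n := n) H) {r : ℕ} {A B : Submodule (MvPolynomial (Fin n) K) N}
    (hA : KoszulLinear vs H r A) (hB : KoszulLinear vs H r B)
    (hAB : KoszulLinear vs H (r + 1) (A ⊓ B))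
    (hdec : ∀ c, ∀ f ∈ gradedPiece H (A ⊔ B) c,
      ∃ a ∈ gradedPiece H A c, ∃ b ∈ gradedPiece H B c, a + b = f) :
    KoszulLinear vs H r (A ⊔ B) := by
  intro c hc z hz hdz
  obtain ⟨a, ha, b, hb, rfl⟩ := Kos.exists_add_of_mem_all (hdec (c + 1)) hz
  have hda : Kos.d (varAct (K := K) N) vs a = -Kos.d (varAct (K := K) N) vs b := by
    rw [eq_neg_iff_add_eq_zero, ← map_add, hdz]
  have h1 := Kos.d_mem_all (varAct_mem_gradedPiece hH) ha
  have h2 : Kos.d (varAct (K := K) N) vs a ∈ Kos.All (gradedPiece H B (c + 1 + 1)) vs := by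
    rw [hda]; exact neg_mem (Kos.d_mem_all (varAct_mem_gradedPiece hH) hb)
  -- Mayer–Vietoris: d a = -d b lies in both submodules. Its coefficients have degree `c + 2`, so (r
  -- + 1)-linearity of the intersection yields `e`, which turns a - e and b + e into separate
  -- cycles.
  obtain ⟨e, he, hde⟩ := hAB (c + 1) (by omega) _
    (Kos.all_mono (Kos.mem_all_inf h1 h2) fun f hf => ⟨⟨hf.1.1, hf.2.1⟩, hf.1.2⟩)
    (Kos.d_d varAct_comm _)
  obtain ⟨y, hy, hdy⟩ := hA c hc (a - e)
    (sub_mem ha (Kos.all_mono he (gradedPiece_mono inf_le_left _))) (by rw [map_sub, hde, sub_self])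
  obtain ⟨y', hy', hdy'⟩ := hB c hc (b + e)
    (add_mem hb (Kos.all_mono he (gradedPiece_mono inf_le_right _)))
    (by rw [map_add, hde, hda, add_neg_cancel])
  refine ⟨y + y', add_mem
    (Kos.all_mono hy (gradedPiece_mono le_sup_left _))
    (Kos.all_mono hy' (gradedPiece_mono le_sup_right _)), ?_⟩
  rw [map_add, hdy, hdy']; abel

end

/-! ### The polynomial ring and free modules -/

/-- Division by the variable `X v`, discarding the remainder. -/
noncomputable def divVar (K : Type*) [Field K] (v : Fin n) :
    MvPolynomial (Fin n) K →+ MvPolynomial (Fin n) K where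
  toFun f := f.divMonomial (Finsupp.single v 1)
  map_zero' := zero_divMonomial _
  map_add' _ _ := add_divMonomial _ _ _

theorem coeff_divVar (v : Fin n) (f : MvPolynomial (Fin n) K) (m : Fin n →₀ ℕ) :
    coeff m (divVar K v f) = coeff (Finsupp.single v 1 + m) f := coeff_divMonomial _ _ _

theorem divVar_X_mul (v : Fin n) (f : MvPolynomial (Fin n) K) : divVar K v (X v * f) = f :=
  X_mul_divMonomial _ _

theorem divVar_X_mul_of_ne {v w : Fin n} (h : v ≠ w) (f : MvPolynomial (Fin n) K) :
    divVar K v (X w * f) = X w * divVar K v f := by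
  ext m
  rw [coeff_divVar, coeff_X_mul', coeff_X_mul']
  have h1 : (Finsupp.single v 1 + m : Fin n →₀ ℕ) w = m w := by simp [h]
  simp only [Finsupp.mem_support_iff, h1]
  split_ifs with h2
  · rw [coeff_divVar]
    congr 1
    ext i
    by_cases hi : i = w
    · subst hi; simp [h]
    · simp [Ne.symm hi]
  · rfl

/-- The part of a polynomial that does not involve `X v`. -/
noncomputable def remVar (K : Type*) [Field K] (v : Fin n) :
    MvPolynomial (Fin n) K →+ MvPolynomial (Fin n) K :=
  AddMonoidHom.id _ - (varAct (K := K) _ v).comp (divVar K v)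

theorem remVar_apply (v : Fin n) (f : MvPolynomial (Fin n) K) :
    remVar K v f = f - X v * divVar K v f := rfl

theorem coeff_remVar (v : Fin n) (f : MvPolynomial (Fin n) K) (m : Fin n →₀ ℕ) :
    coeff m (remVar K v f) = if m v = 0 then coeff m f else 0 := by
  rw [remVar_apply, coeff_sub, coeff_X_mul']
  simp only [Finsupp.mem_support_iff]
  by_cases h : m v = 0
  · simp [h]
  · rw [if_pos h, if_neg h, coeff_divVar, add_tsub_cancel_of_le, sub_self]
    simpa using Nat.one_le_iff_ne_zero.2 h

theorem coeff_foldMap_remVar : ∀ (vs : List (Fin n)) (f : MvPolynomial (Fin n) K)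
    (m : Fin n →₀ ℕ), coeff m (Kos.foldMap (remVar K) vs f) ≠ 0 →
      coeff m f ≠ 0 ∧ ∀ v ∈ vs, m v = 0
  | [], f, m, h => ⟨h, by simp⟩
  | v :: vs, f, m, h => by
    obtain ⟨h1, h2⟩ := coeff_foldMap_remVar vs (remVar K v f) m h
    rw [coeff_remVar] at h1
    split_ifs at h1 with h3
    · exact ⟨h1, by simpa using ⟨h3, h2⟩⟩
    · exact absurd rfl h1

/-- Once all variables have been divided out only the constant term is left, and there is none in
positive degree. -/
theorem foldMap_remVar_eq_zero {vs : List (Fin n)} (hvs : ∀ v, v ∈ vs) {c : ℕ}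
    {f : MvPolynomial (Fin n) K} (hf : f.IsHomogeneous (c + 1)) :
    Kos.foldMap (remVar K) vs f = 0 := by
  ext m
  by_contra h
  rw [coeff_zero] at h
  obtain ⟨h1, h2⟩ := coeff_foldMap_remVar vs f m h
  have h3 : m = 0 := by ext v; exact h2 v (hvs v)
  have h4 := hf h1
  rw [h3] at h4
  simp at h4

theorem divVar_isHomogeneous {v : Fin n} {c : ℕ} {f : MvPolynomial (Fin n) K}
    (hf : f.IsHomogeneous (c + 1)) : (divVar K v f).IsHomogeneous c := by
  intro m hm
  rw [coeff_divVar] at hm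
  have := hf hm
  simp only [map_add, Finsupp.weight_single, Pi.one_apply, smul_eq_mul, mul_one] at this
  omega

theorem remVar_isHomogeneous {v : Fin n} {c : ℕ} {f : MvPolynomial (Fin n) K}
    (hf : f.IsHomogeneous c) : (remVar K v f).IsHomogeneous c := by
  intro m hm
  rw [coeff_remVar] at hm
  split_ifs at hm with h
  · exact hf hm
  · exact absurd rfl hm

theorem X_mul_isHomogeneous (v : Fin n) {c : ℕ} {f : MvPolynomial (Fin n) K}
    (hf : f.IsHomogeneous c) : (X v * f).IsHomogeneous (c + 1) := by
  rw [add_comm]; exact (isHomogeneous_X K v).mul hf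

theorem varDegreeOne_homogeneousSubmodule :
    VarDegreeOne (n := n) (homogeneousSubmodule (Fin n) K) :=
  fun v _ _ hf => X_mul_isHomogeneous v hf

theorem koszulLinear_top {vs : List (Fin n)} (hvs : vs.Nodup) (hvs' : ∀ v, v ∈ vs) :
    KoszulLinear vs (homogeneousSubmodule (Fin n) K) 0
      (⊤ : Submodule (MvPolynomial (Fin n) K) (MvPolynomial (Fin n) K)) := by
  intro c _ z hz hd
  refine Kos.exists_d_eq (f := varAct (K := K) (MvPolynomial (Fin n) K)) (D := divVar K)
    (r := remVar K) (G := gradedPiece (homogeneousSubmodule (Fin n) K) ⊤ c)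
    (G' := gradedPiece (homogeneousSubmodule (Fin n) K) ⊤ (c + 1))
    (fun _ _ => ?_) (fun v f => divVar_X_mul v f) (fun v w f h => divVar_X_mul_of_ne h f)
    varAct_comm (fun v f hf => ⟨Submodule.mem_top (R := MvPolynomial (Fin n) K),
      divVar_isHomogeneous hf.2⟩)
    (fun v f hf => ⟨Submodule.mem_top (R := MvPolynomial (Fin n) K),
      remVar_isHomogeneous hf.2⟩) hvs
    (Kos.all_mono hz fun f hf => ⟨hf, foldMap_remVar_eq_zero hvs' hf.2⟩) hd
  rw [remVar_apply, varAct_apply, smul_eq_mul, add_sub_cancel]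

/-- Vectors of homogeneous polynomials of degree `c`. -/
noncomputable def homogeneousVec (K : Type*) [Field K] (n : ℕ) (κ : Type) (c : ℕ) :
    Submodule K (κ → MvPolynomial (Fin n) K) :=
  Submodule.pi Set.univ fun _ => homogeneousSubmodule (Fin n) K c

theorem mem_homogeneousVec {κ : Type} {c : ℕ} {f : κ → MvPolynomial (Fin n) K} :
    f ∈ homogeneousVec K n κ c ↔ ∀ k, (f k).IsHomogeneous c := by
  simp [homogeneousVec, Submodule.mem_pi]

theorem varDegreeOne_homogeneousVec (κ : Type) : VarDegreeOne (n := n) (homogeneousVec K n κ) :=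
  fun _ _ _ hf => mem_homogeneousVec.2 fun k => X_mul_isHomogeneous _ (mem_homogeneousVec.1 hf k)

theorem foldMap_compLeft {κ : Type} (r : Fin n → MvPolynomial (Fin n) K →+ MvPolynomial (Fin n) K) :
    ∀ (vs : List (Fin n)) (f : κ → MvPolynomial (Fin n) K) (k : κ),
      Kos.foldMap (fun v => (r v).compLeft κ) vs f k = Kos.foldMap r vs (f k)
  | [], _, _ => rfl
  | _ :: vs, _, k => foldMap_compLeft r vs _ k

theorem koszulLinear_free {vs : List (Fin n)} (hvs : vs.Nodup) (hvs' : ∀ v, v ∈ vs) (κ : Type) :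
    KoszulLinear vs (homogeneousVec K n κ) 0
      (⊤ : Submodule (MvPolynomial (Fin n) K) (κ → MvPolynomial (Fin n) K)) := by
  intro c _ z hz hd
  refine Kos.exists_d_eq (f := varAct (K := K) (κ → MvPolynomial (Fin n) K))
    (D := fun v => (divVar K v).compLeft κ) (r := fun v => (remVar K v).compLeft κ)
    (G := gradedPiece (homogeneousVec K n κ) ⊤ c)
    (G' := gradedPiece (homogeneousVec K n κ) ⊤ (c + 1))
    (fun _ _ => ?_) (fun _ _ => funext fun _ => divVar_X_mul _ _)
    (fun v w f h => funext fun k => divVar_X_mul_of_ne h (f k)) varAct_comm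
    (fun v f hf => ⟨Submodule.mem_top (R := MvPolynomial (Fin n) K), mem_homogeneousVec.2
      fun k => divVar_isHomogeneous (mem_homogeneousVec.1 hf.2 k)⟩)
    (fun v f hf => ⟨Submodule.mem_top (R := MvPolynomial (Fin n) K), mem_homogeneousVec.2
      fun k => remVar_isHomogeneous (mem_homogeneousVec.1 hf.2 k)⟩) hvs
    (Kos.all_mono hz fun f hf => ⟨hf, funext fun k => ?_⟩) hd
  · exact funext fun k => add_sub_cancel _ _
  · rw [foldMap_compLeft]
    exact foldMap_remVar_eq_zero hvs' (mem_homogeneousVec.1 hf.2 k)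

/-- Multiplication of an ideal by a variable shifts the linear strand. -/
theorem KoszulLinear.X_mul {vs : List (Fin n)} {r : ℕ} {A B : Ideal (MvPolynomial (Fin n) K)}
    (hB : KoszulLinear vs (homogeneousSubmodule (Fin n) K) r B) (x : Fin n)
    (hA : ∀ f, f ∈ A ↔ ∃ g ∈ B, X x * g = f) :
    KoszulLinear vs (homogeneousSubmodule (Fin n) K) (r + 1) A := by
  intro c hc z hz hd
  obtain ⟨c, rfl⟩ : ∃ c', c = c' + 1 := ⟨c - 1, by omega⟩
  have hinj : (varAct (K := K) (MvPolynomial (Fin n) K) x).ker = ⊥ := by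
    rw [AddMonoidHom.ker_eq_bot_iff]
    exact mul_right_injective₀ (X_ne_zero x)
  -- Division by x is applied to every coefficient; the bound `vs.length + 1` is chosen so that
  -- nothing is truncated.
  obtain ⟨y, hy, -, rfl⟩ := Kos.exists_lift
    (G := gradedPiece (homogeneousSubmodule (Fin n) K) B (c + 1)) (i := vs.length + 1)
    (g := varAct (K := K) (MvPolynomial (Fin n) K) x) (fun f hf => by
      obtain ⟨g, hg, rfl⟩ := (hA f).1 hf.1
      refine ⟨g, ⟨hg, ?_⟩, rfl⟩
      have := divVar_isHomogeneous (v := x) hf.2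
      rwa [divVar_X_mul] at this) hz (Kos.mem_small_of_length_lt (by omega) z)
  rw [← Kos.map_d (f := varAct (K := K) _) (fun v _ f => varAct_comm _ _ _)] at hd
  have hdy := Kos.mem_all_ker hd
  rw [hinj] at hdy
  obtain ⟨w, hw, hdw⟩ := hB c (by omega) y hy (Kos.eq_zero_of_mem_all_bot hdy)
  refine ⟨Kos.map (varAct (K := K) _ x) vs w, Kos.map_mem_all hw fun f hf =>
    ⟨(hA _).2 ⟨f, hf.1, rfl⟩, X_mul_isHomogeneous x hf.2⟩, ?_⟩
  rw [← Kos.map_d (f := varAct (K := K) _) (fun v _ f => varAct_comm _ _ _), hdw]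

/-! ### Ideals of polynomials with prescribed supports -/

/-- The indices of the variables dividing a monomial. -/
def varSet (m : Fin n →₀ ℕ) : Set ℕ := {i | ∃ h : i < n, m ⟨i, h⟩ ≠ 0}

theorem varSet_mono {m m' : Fin n →₀ ℕ} (h : m ≤ m') : varSet m ⊆ varSet m' := by
  rintro i ⟨hi, hm⟩
  exact ⟨hi, fun e => hm (Nat.le_zero.1 (e ▸ h ⟨i, hi⟩))⟩

theorem varSet_add_single (m : Fin n →₀ ℕ) (x : Fin n) :
    varSet (Finsupp.single x 1 + m) = insert (x : ℕ) (varSet m) := by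
  ext i
  simp only [varSet, Set.mem_ofPred_eq, Set.mem_insert_iff]
  constructor
  · rintro ⟨hi, h⟩
    by_cases hx : i = x
    · exact Or.inl hx
    · refine Or.inr ⟨hi, ?_⟩
      have : (x : Fin n) ≠ ⟨i, hi⟩ := fun e => hx (by rw [e])
      simpa [this] using h
  · rintro (rfl | ⟨hi, h⟩)
    · exact ⟨x.2, by simp⟩
    · exact ⟨hi, by simp [h]⟩

/-- The monomial ideal of the polynomials all of whose monomials have a set of variables containing
a set that satisfies `U`. -/
def varIdeal (n : ℕ) (K : Type*) [Field K] (U : Set ℕ → Prop) : Ideal (MvPolynomial (Fin n) K) where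
  carrier := {f | ∀ m ∈ f.support, ∃ ρ ⊆ varSet m, U ρ}
  zero_mem' := by simp
  add_mem' := by
    classical
    intro f g hf hg m hm
    rcases Finset.mem_union.1 (support_add hm) with h | h
    exacts [hf m h, hg m h]
  smul_mem' := by
    classical
    intro f g hg m hm
    obtain ⟨a, _, b, hb, rfl⟩ := Finset.mem_add.1 (support_mul f g hm)
    obtain ⟨ρ, h1, h2⟩ := hg b hb
    exact ⟨ρ, h1.trans (varSet_mono le_add_self), h2⟩

/-- The subset ρ in the carrier makes it an ideal for arbitrary `U`; for monotone `U` it can be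
taken to be the whole support. -/
theorem mem_varIdeal {U : Set ℕ → Prop} (hU : Monotone U) {f : MvPolynomial (Fin n) K} :
    f ∈ varIdeal n K U ↔ ∀ m ∈ f.support, U (varSet m) :=
  ⟨fun h m hm => by obtain ⟨ρ, h1, h2⟩ := h m hm; exact hU h1 h2,
    fun h m hm => ⟨_, le_rfl, h m hm⟩⟩

/-- Supports consist of indices below n, so predicates need to agree only there. This discards lists
with entries out of range. -/
theorem varIdeal_congr {U U' : Set ℕ → Prop} (h : ∀ ρ, (∀ i ∈ ρ, i < n) → (U ρ ↔ U' ρ)) :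
    varIdeal n K U = varIdeal n K U' := by
  have key : ∀ {U U' : Set ℕ → Prop}, (∀ ρ, (∀ i ∈ ρ, i < n) → (U ρ ↔ U' ρ)) →
      varIdeal n K U ≤ varIdeal n K U' := by
    intro U U' h f hf m hm
    obtain ⟨ρ, h1, h2⟩ := hf m hm
    exact ⟨ρ, h1, (h ρ fun i hi => (h1 hi).1).1 h2⟩
  exact le_antisymm (key h) (key fun ρ hρ => (h ρ hρ).symm)

/-- The ideal `varIdeal n K U` has Koszul homology concentrated on the linear strand starting in
degree `r`. -/
def VarLinear (K : Type*) [Field K] (vs : List (Fin n)) (r : ℕ) (U : Set ℕ → Prop) : Prop :=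
  KoszulLinear vs (homogeneousSubmodule (Fin n) K) r (varIdeal n K U)

theorem VarLinear.congr {vs : List (Fin n)} {r : ℕ} {U U' : Set ℕ → Prop}
    (h : VarLinear K vs r U) (hU : ∀ ρ, (∀ i ∈ ρ, i < n) → (U' ρ ↔ U ρ)) :
    VarLinear K vs r U' := by
  rw [VarLinear, varIdeal_congr hU]; exact h

theorem varLinear_false (vs : List (Fin n)) (r : ℕ) : VarLinear K vs r fun _ => False := by
  have : varIdeal n K (fun _ => False) = ⊥ := by
    rw [eq_bot_iff]
    intro f hf
    rw [Submodule.mem_bot, ← support_eq_empty, Finset.eq_empty_iff_forall_notMem]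
    intro m hm
    obtain ⟨_, _, h⟩ := hf m hm
    exact h
  rw [VarLinear, this]
  exact koszulLinear_bot _ _ _

theorem varLinear_true {vs : List (Fin n)} (hvs : vs.Nodup) (hvs' : ∀ v, v ∈ vs) :
    VarLinear K vs 0 fun _ => True := by
  have : varIdeal n K (fun _ => True) = ⊤ := by
    rw [eq_top_iff]
    exact fun f _ m _ => ⟨_, le_rfl, trivial⟩
  rw [VarLinear, this]
  exact koszulLinear_top hvs hvs'

/-- By `hBx` the ideal of B does not involve x. Hence being divisible by x and lying in that ideal
are independent conditions, and their conjunction is x times the ideal. -/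
theorem VarLinear.var_mul {vs : List (Fin n)} {r : ℕ} {B : Set ℕ → Prop} (hBm : Monotone B)
    {x : ℕ} (hx : x < n) (hBx : ∀ ρ, B (insert x ρ) → B ρ) (hB : VarLinear K vs r B) :
    VarLinear K vs (r + 1) fun ρ => x ∈ ρ ∧ B ρ := by
  have hm : Monotone fun ρ => x ∈ ρ ∧ B ρ := fun ρ ρ' h h' => ⟨h h'.1, hBm h h'.2⟩
  refine KoszulLinear.X_mul hB ⟨x, hx⟩ fun f => ?_
  rw [mem_varIdeal hm]
  constructor
  · intro h
    have hr : remVar K ⟨x, hx⟩ f = 0 := by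
      ext m
      rw [coeff_remVar, coeff_zero]
      split_ifs with h0
      · by_contra hne
        obtain ⟨_, h2⟩ := (h m (mem_support_iff.2 hne)).1
        exact h2 h0
      · rfl
    refine ⟨divVar K ⟨x, hx⟩ f, (mem_varIdeal hBm).2 fun m hm => ?_, ?_⟩
    · rw [mem_support_iff, coeff_divVar] at hm
      have := (h _ (mem_support_iff.2 hm)).2
      rw [varSet_add_single] at this
      exact hBx _ this
    · rw [remVar_apply, sub_eq_zero] at hr
      exact hr.symm
  · rintro ⟨g, hg, rfl⟩ m hm
    rw [mem_support_iff, coeff_X_mul'] at hm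
    split_ifs at hm with h0
    · refine ⟨⟨hx, Finsupp.mem_support_iff.1 h0⟩, hBm (varSet_mono tsub_le_self)
        ((mem_varIdeal hBm).1 hg _ (mem_support_iff.2 hm))⟩
    · exact absurd rfl hm

/-- Mayer–Vietoris for xB + A. Since A and B do not involve x, the intersection of xB and A is x(A ∩
B), and the factor x supplies the extra degree that `KoszulLinear.sup` asks of the intersection. -/
theorem VarLinear.split {vs : List (Fin n)} {r : ℕ} {A B : Set ℕ → Prop} (hAm : Monotone A)
    (hBm : Monotone B) {x : ℕ} (hx : x < n) (hAx : ∀ ρ, A (insert x ρ) → A ρ)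
    (hBx : ∀ ρ, B (insert x ρ) → B ρ) (hB : VarLinear K vs r B) (hA : VarLinear K vs (r + 1) A)
    (hAB : VarLinear K vs (r + 1) fun ρ => A ρ ∧ B ρ) :
    VarLinear K vs (r + 1) fun ρ => (x ∈ ρ ∧ B ρ) ∨ A ρ := by
  classical
  have hABm : Monotone fun ρ => A ρ ∧ B ρ := fun ρ ρ' h h' => ⟨hAm h h'.1, hBm h h'.2⟩
  have hm : Monotone fun ρ => x ∈ ρ ∧ B ρ := fun ρ ρ' h h' => ⟨h h'.1, hBm h h'.2⟩
  have hm' : Monotone fun ρ => (x ∈ ρ ∧ B ρ) ∨ A ρ := fun ρ ρ' h h' => h'.imp (hm h) (hAm h)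
  have hsplit : ∀ f ∈ varIdeal n K (fun ρ => (x ∈ ρ ∧ B ρ) ∨ A ρ), ∃ a b,
      a ∈ varIdeal n K (fun ρ => x ∈ ρ ∧ B ρ) ∧ b ∈ varIdeal n K A ∧ a + b = f ∧
      ∀ c, f.IsHomogeneous c → a.IsHomogeneous c ∧ b.IsHomogeneous c := by
    intro f hf
    rw [mem_varIdeal hm'] at hf
    have hc : ∀ (p : (Fin n →₀ ℕ) → Prop) [DecidablePred p] m,
        coeff m (∑ m ∈ f.support with p m, monomial m (coeff m f)) =
          if p m then coeff m f else 0 := by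
      intro p _ m
      simp only [coeff_sum, coeff_monomial, Finset.sum_ite_eq', Finset.mem_filter, mem_support_iff]
      by_cases h1 : coeff m f = 0 <;> simp [h1]
    have hh : ∀ (p : (Fin n →₀ ℕ) → Prop) [DecidablePred p] c, f.IsHomogeneous c →
        (∑ m ∈ f.support with p m, monomial m (coeff m f)).IsHomogeneous c := by
      intro p _ c h m hm
      rw [hc] at hm
      split_ifs at hm
      exacts [h hm, absurd rfl hm]
    -- The polynomial is divided monomial by monomial, with monomials of xB ∩ A going to the first
    -- part. This keeps homogeneous parts homogeneous.
    let p : (Fin n →₀ ℕ) → Prop := fun m => x ∈ varSet m ∧ B (varSet m)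
    refine ⟨∑ m ∈ f.support with p m, monomial m (coeff m f),
      ∑ m ∈ f.support with ¬p m, monomial m (coeff m f), (mem_varIdeal hm).2 fun m h => ?_,
      (mem_varIdeal hAm).2 fun m h => ?_, ?_, fun c h => ⟨hh p c h, hh (fun m => ¬p m) c h⟩⟩
    · rw [mem_support_iff, hc] at h
      split_ifs at h with h1
      exacts [h1, absurd rfl h]
    · rw [mem_support_iff, hc (fun m => ¬p m)] at h
      split_ifs at h with h1
      · exact absurd rfl h
      · exact (hf m (mem_support_iff.2 h)).resolve_left h1
    · rw [Finset.sum_filter_add_sum_filter_not, ← as_sum]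
  have hsup : varIdeal n K (fun ρ => (x ∈ ρ ∧ B ρ) ∨ A ρ) =
      varIdeal n K (fun ρ => x ∈ ρ ∧ B ρ) ⊔ varIdeal n K A := by
    refine le_antisymm (fun f hf => ?_) (sup_le ?_ ?_)
    · obtain ⟨a, b, ha, hb, hab, -⟩ := hsplit f hf
      exact Submodule.mem_sup.2 ⟨a, ha, b, hb, hab⟩
    · exact fun f hf => (mem_varIdeal hm').2 fun m h => Or.inl ((mem_varIdeal hm).1 hf m h)
    · exact fun f hf => (mem_varIdeal hm').2 fun m h => Or.inr ((mem_varIdeal hAm).1 hf m h)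
  have hinf : varIdeal n K (fun ρ => x ∈ ρ ∧ B ρ) ⊓ varIdeal n K A =
      varIdeal n K (fun ρ => x ∈ ρ ∧ (A ρ ∧ B ρ)) := by
    have hm2 : Monotone fun ρ => x ∈ ρ ∧ (A ρ ∧ B ρ) := fun ρ ρ' h h' => ⟨h h'.1, hABm h h'.2⟩
    ext f
    rw [Submodule.mem_inf, mem_varIdeal hm, mem_varIdeal hAm, mem_varIdeal hm2]
    exact ⟨fun h m hm => ⟨(h.1 m hm).1, h.2 m hm, (h.1 m hm).2⟩,
      fun h => ⟨fun m hm => ⟨(h m hm).1, (h m hm).2.2⟩, fun m hm => (h m hm).2.1⟩⟩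
  rw [VarLinear, hsup]
  refine KoszulLinear.sup varDegreeOne_homogeneousSubmodule (hB.var_mul hBm hx hBx) hA ?_ ?_
  · rw [hinf]
    exact hAB.var_mul hABm hx fun ρ h => ⟨hAx ρ h.1, hBx ρ h.2⟩
  · intro c f hf
    obtain ⟨a, b, ha, hb, hab, hh⟩ := hsplit f (hsup ▸ hf.1)
    exact ⟨a, ⟨ha, (hh c hf.2).1⟩, b, ⟨hb, (hh c hf.2).2⟩, hab⟩

end

/-! ### Linearity of lexsegments -/

/-- A list of indices is `t`-spread. -/
def Spread (t : ℕ) (l : List ℕ) : Prop := l.Pairwise fun a b => a + t ≤ b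

/-- Some list in the family `𝓕` consists of elements of `ρ`. -/
def Contains (𝓕 : List ℕ → Prop) (ρ : Set ℕ) : Prop := ∃ z, 𝓕 z ∧ ∀ i ∈ z, i ∈ ρ

/-- The `t`-spread lists of length `d` with entries `≥ a`. -/
def SpreadFrom (t d a : ℕ) (z : List ℕ) : Prop :=
  Spread t z ∧ z.length = d ∧ ∀ i ∈ z, a ≤ i

/-- The `t`-spread lists with entries `≥ a` that are lexicographically smaller than `w`. -/
def SpreadBelow (t : ℕ) (w : List ℕ) (a : ℕ) (z : List ℕ) : Prop :=
  Spread t z ∧ z.length = w.length ∧ (∀ i ∈ z, a ≤ i) ∧ z < w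

/-- The `t`-spread lists that are lexicographically at least `u`. -/
def SpreadAbove (t : ℕ) (u : List ℕ) (z : List ℕ) : Prop :=
  Spread t z ∧ z.length = u.length ∧ u ≤ z

/-- The `t`-spread lists in the lexicographic interval from `u` (included) to `w` (excluded). -/
def SpreadBetween (t : ℕ) (u w : List ℕ) (z : List ℕ) : Prop :=
  Spread t z ∧ z.length = u.length ∧ u ≤ z ∧ z < w

/-- For `u = [u₁, …, u_d]` and `w = [w₁, …, w_d]`, this says that `[u₂, …, u_d]` is
lexicographically at most `[w₁ + t, …, w_{d-1} + t]`. -/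
def ShiftLE (t : ℕ) : List ℕ → List ℕ → Prop
  | _ :: u₂ :: us, w₁ :: ws => u₂ < w₁ + t ∨ (u₂ = w₁ + t ∧ ShiftLE t (u₂ :: us) ws)
  | _, _ => True

theorem monotone_contains (𝓕 : List ℕ → Prop) : Monotone (Contains 𝓕) :=
  fun _ _ h ⟨z, hz, hρ⟩ => ⟨z, hz, fun i hi => h (hρ i hi)⟩

theorem contains_of_insert {𝓕 : List ℕ → Prop} {x : ℕ} (h : ∀ z, 𝓕 z → ∀ i ∈ z, x < i)
    (ρ : Set ℕ) : Contains 𝓕 (insert x ρ) → Contains 𝓕 ρ :=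
  fun ⟨z, hz, hρ⟩ => ⟨z, hz, fun i hi => (hρ i hi).resolve_left (h z hz i hi).ne'⟩

theorem cons_le_cons_iff' {a b : ℕ} {l l' : List ℕ} :
    a :: l ≤ b :: l' ↔ a < b ∨ a = b ∧ l ≤ l' := by
  simp only [le_iff_lt_or_eq, List.cons_lt_cons_iff, List.cons.injEq]
  tauto

theorem nil_le' (l : List ℕ) : [] ≤ l := by
  cases l with
  | nil => exact le_rfl
  | cons a l => exact (List.nil_lt_cons a l).le

theorem spread_cons {t a : ℕ} {l : List ℕ} :
    Spread t (a :: l) ↔ (∀ i ∈ l, a + t ≤ i) ∧ Spread t l := List.pairwise_cons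

theorem head_le_of_spread {t a : ℕ} {l : List ℕ} (h : Spread t (a :: l)) :
    ∀ i ∈ a :: l, a ≤ i := by
  intro i hi
  rcases List.mem_cons.1 hi with rfl | hi
  · exact le_rfl
  · have := (spread_cons.1 h).1 i hi; omega

theorem le_of_spreadAbove {t u₁ : ℕ} {us z : List ℕ} (hz : SpreadAbove t (u₁ :: us) z) :
    ∀ i ∈ z, u₁ ≤ i := by
  obtain ⟨h1, h2, h3⟩ := hz
  match z, h2 with
  | z₁ :: zs, _ =>
    have h4 := head_le_of_spread h1
    have : u₁ ≤ z₁ := by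
      rcases cons_le_cons_iff'.1 h3 with h | h
      exacts [h.le, h.1.le]
    exact fun i hi => this.trans (h4 i hi)

theorem spread_cons_of_spreadAbove {t x u₁ : ℕ} {us z : List ℕ} (hx : x + t ≤ u₁)
    (hz : SpreadAbove t (u₁ :: us) z) : Spread t (x :: z) :=
  spread_cons.2 ⟨fun i hi => hx.trans (le_of_spreadAbove hz i hi), hz.1⟩

/-- A constant list whose entry exceeds every index serves as an upper end that imposes no bound;
final segments thereby become intervals. -/
theorem shiftLE_replicate {t m : ℕ} (ht : 1 ≤ t) : ∀ {u : List ℕ} (_ : ∀ i ∈ u, i < m) (k : ℕ),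
    ShiftLE t u (List.replicate k m)
  | [], _, _ => trivial
  | [_], _, _ => by unfold ShiftLE; trivial
  | u₁ :: u₂ :: us, _, 0 => by simp [ShiftLE]
  | u₁ :: u₂ :: us, h, k + 1 => by
    rw [List.replicate_succ, ShiftLE]
    have := h u₂ (by simp)
    left; omega

/-- Since b is spread, (b_2, …, b_d) ≥ (b_1 + t, …, b_{d-1} + t). By w ≤ b the latter is at least
the shift of w, which is at least the tail of u. -/
theorem tail_le_tail_of_shiftLE {t : ℕ} : ∀ {u w b : List ℕ}, w.length = u.length →
    b.length = u.length → Spread t b → ShiftLE t u w → w ≤ b → u.tail ≤ b.tail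
  | [], _, _, _, _, _, _, _ => nil_le' _
  | [_], _, _, _, _, _, _, _ => nil_le' _
  | u₁ :: u₂ :: us, w₁ :: ws, b₁ :: b₂ :: bs, hw, hb, hs, h, hwb => by
    have h1 : b₁ + t ≤ b₂ := (spread_cons.1 hs).1 _ (by simp)
    have h2 : w₁ ≤ b₁ := by
      rcases cons_le_cons_iff'.1 hwb with h | h
      exacts [h.le, h.1.le]
    rw [List.tail_cons, List.tail_cons, cons_le_cons_iff']
    rw [ShiftLE] at h
    by_cases h3 : u₂ < b₂
    · exact Or.inl h3
    · have hu : u₂ = w₁ + t ∧ ShiftLE t (u₂ :: us) ws := h.resolve_left (by omega)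
      refine Or.inr ⟨by omega, ?_⟩
      refine tail_le_tail_of_shiftLE (u := u₂ :: us) (b := b₂ :: bs) (by simpa using hw)
        (by simpa using hb) (spread_cons.1 hs).2 hu.2 ?_
      rcases cons_le_cons_iff'.1 hwb with h | h
      · omega
      · exact h.2

/-- A list z below w and a list b above u, both inside ρ, are recombined. If neither lies in the
interval, then z starts with u_1 and b is at least w. For u_1 < w_1, the tail of b can be put behind
u_1; for u_1 = w_1 the argument recurses on the tails. -/
theorem contains_spreadBetween {t : ℕ} (ht : 1 ≤ t) {ρ : Set ℕ} : ∀ {u₁ : ℕ} {us w : List ℕ},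
    Spread t (u₁ :: us) → w.length = us.length + 1 → ShiftLE t (u₁ :: us) w →
    Contains (SpreadBelow t w u₁) ρ → Contains (SpreadAbove t (u₁ :: us)) ρ →
    Contains (SpreadBetween t (u₁ :: us) w) ρ
  | u₁, us, [], _, hw, _, _, _ => by simp at hw
  | u₁, us, w₁ :: ws, hu, hw, hsh, ⟨[], ⟨_, hzl, _⟩, _⟩, _ => by simp at hzl
  | u₁, us, w₁ :: ws, hu, hw, hsh, _, ⟨[], ⟨_, hzl, _⟩, _⟩ => by simp at hzl
  | u₁, us, w₁ :: ws, hu, hw, hsh, ⟨z₁ :: zs, ⟨hzs, hzl, hza, hzw⟩, hzρ⟩,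
      ⟨b₁ :: bs, ⟨hbs, hbl, hub⟩, hbρ⟩ => by
    have hwl : ws.length = us.length := by simpa using hw
    have hzl' : zs.length = ws.length := by simpa using hzl
    have hbl' : bs.length = us.length := by simpa using hbl
    by_cases huz : u₁ :: us ≤ z₁ :: zs
    · exact ⟨_, ⟨hzs, hzl.trans hw, huz, hzw⟩, hzρ⟩
    by_cases hbw : b₁ :: bs < w₁ :: ws
    · exact ⟨_, ⟨hbs, hbl, hub, hbw⟩, hbρ⟩
    rw [not_le] at huz
    rw [not_lt] at hbw
    have hz₁ : u₁ ≤ z₁ := hza _ (by simp)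
    obtain ⟨rfl, hzu⟩ : z₁ = u₁ ∧ zs < us := by
      rcases List.cons_lt_cons_iff.1 huz with h | h
      · omega
      · exact h
    match us, hu, hsh, hwl, hbl', hzu, hbl with
    | [], _, _, _, _, hzu, _ => simp at hzu
    | u₂ :: us, hu, hsh, hwl, hbl', hzu, hbl =>
      have hu₂ : z₁ + t ≤ u₂ := (spread_cons.1 hu).1 _ (by simp)
      have hb₁ : z₁ ≤ b₁ := by
        rcases cons_le_cons_iff'.1 hub with h | h
        exacts [h.le, h.1.le]
      rcases List.cons_lt_cons_iff.1 hzw with hlt | ⟨rfl, hzw'⟩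
      · have hbs' : u₂ :: us ≤ bs :=
          tail_le_tail_of_shiftLE (u := z₁ :: u₂ :: us) (b := b₁ :: bs) hw hbl hbs hsh hbw
        refine ⟨z₁ :: bs, ⟨spread_cons_of_spreadAbove hu₂
          ⟨(spread_cons.1 hbs).2, hbl', hbs'⟩, by simpa using hbl', ?_, ?_⟩, ?_⟩
        · exact cons_le_cons_iff'.2 (Or.inr ⟨rfl, hbs'⟩)
        · exact List.cons_lt_cons_iff.2 (Or.inl hlt)
        · intro i hi
          rcases List.mem_cons.1 hi with rfl | hi
          · exact hzρ _ (by simp)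
          · exact hbρ _ (List.mem_cons_of_mem _ hi)
      -- Here u_1 = w_1. Spreadness gives u_2 ≥ w_1 + t, which leaves only the equality branch of
      -- `ShiftLE`, and that branch passes to the tails.
      · rw [ShiftLE] at hsh
        obtain ⟨rfl, hsh'⟩ : u₂ = z₁ + t ∧ ShiftLE t (u₂ :: us) ws :=
          hsh.resolve_left (by omega)
        have hbs' : (z₁ + t) :: us ≤ bs := by
          rcases cons_le_cons_iff'.1 hub with h | h
          · match bs, hbl' with
            | b₂ :: bs, _ =>
              have : b₁ + t ≤ b₂ := (spread_cons.1 hbs).1 _ (by simp)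
              exact cons_le_cons_iff'.2 (Or.inl (by omega))
          · exact h.2
        obtain ⟨y, ⟨hy1, hy2, hy3, hy4⟩, hyρ⟩ := contains_spreadBetween ht (ρ := ρ)
          (spread_cons.1 hu).2 (by simpa using hwl) hsh'
          ⟨zs, ⟨(spread_cons.1 hzs).2, hzl', (spread_cons.1 hzs).1, hzw'⟩,
            fun i hi => hzρ i (List.mem_cons_of_mem _ hi)⟩
          ⟨bs, ⟨(spread_cons.1 hbs).2, hbl', hbs'⟩,
            fun i hi => hbρ i (List.mem_cons_of_mem _ hi)⟩
        refine ⟨z₁ :: y, ⟨spread_cons_of_spreadAbove le_rfl ⟨hy1, hy2, hy3⟩, by simpa using hy2,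
          cons_le_cons_iff'.2 (Or.inr ⟨rfl, hy3⟩),
          List.cons_lt_cons_iff.2 (Or.inr ⟨rfl, hy4⟩)⟩, ?_⟩
        intro i hi
        rcases List.mem_cons.1 hi with rfl | hi
        · exact hzρ _ (by simp)
        · exact hyρ _ hi

/-! ### Splitting off variables from spread ideals. -/

section

variable {n : ℕ} {K : Type*} [Field K] {vs : List (Fin n)}

/-- Splitting off a variable when the remaining ideal is contained in the colon ideal. -/
theorem VarLinear.split_of_le {r : ℕ} {A B : Set ℕ → Prop} (hAm : Monotone A)
    (hBm : Monotone B) {x : ℕ} (hx : x < n) (hAx : ∀ ρ, A (insert x ρ) → A ρ)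
    (hBx : ∀ ρ, B (insert x ρ) → B ρ) (hB : VarLinear K vs r B) (hA : VarLinear K vs (r + 1) A)
    (hAB : ∀ ρ, A ρ → B ρ) :
    VarLinear K vs (r + 1) fun ρ => (x ∈ ρ ∧ B ρ) ∨ A ρ :=
  hB.split hAm hBm hx hAx hBx hA (hA.congr fun ρ _ => ⟨fun h => h.1, fun h => ⟨h, hAB ρ h⟩⟩)

/-- Splitting off the variables with index in an interval. -/
theorem VarLinear.split_interval {r : ℕ} {A B : Set ℕ → Prop} (hAm : Monotone A)
    (hBm : Monotone B) {b : ℕ} (hb : b ≤ n) (hAx : ∀ x < b, ∀ ρ, A (insert x ρ) → A ρ)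
    (hBx : ∀ x < b, ∀ ρ, B (insert x ρ) → B ρ) (hB : VarLinear K vs r B)
    (hA : VarLinear K vs (r + 1) A) (hAB : ∀ ρ, A ρ → B ρ) (a : ℕ) :
    VarLinear K vs (r + 1) fun ρ => ((∃ x ∈ ρ, a ≤ x ∧ x < b) ∧ B ρ) ∨ A ρ := by
  obtain ⟨k, hk⟩ : ∃ k, b - a = k := ⟨_, rfl⟩
  induction k generalizing a with
  | zero =>
    refine hA.congr fun ρ _ => ⟨?_, Or.inr⟩
    rintro (⟨⟨x, -, h1, h2⟩, -⟩ | h)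
    · omega
    · exact h
  | succ k ih =>
    refine (hB.split_of_le (x := a) (A := fun ρ => ((∃ x ∈ ρ, a + 1 ≤ x ∧ x < b) ∧ B ρ) ∨ A ρ)
      ?_ hBm (by omega) ?_ (hBx a (by omega)) (ih (a + 1) (by omega)) ?_).congr ?_
    · rintro ρ ρ' h (⟨⟨x, hx, hx'⟩, h'⟩ | h')
      · exact Or.inl ⟨⟨x, h hx, hx'⟩, hBm h h'⟩
      · exact Or.inr (hAm h h')
    · rintro ρ (⟨⟨x, hx, hx'⟩, h'⟩ | h')
      · refine Or.inl ⟨⟨x, hx.resolve_left (by omega), hx'⟩, hBx a (by omega) ρ h'⟩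
      · exact Or.inr (hAx a (by omega) ρ h')
    · rintro ρ (h' | h')
      exacts [h'.2, hAB ρ h']
    · intro ρ _
      constructor
      · rintro (⟨⟨x, hx, h1, h2⟩, h'⟩ | h')
        · rcases eq_or_lt_of_le h1 with rfl | h1
          · exact Or.inl ⟨hx, h'⟩
          · exact Or.inr (Or.inl ⟨⟨x, hx, h1, h2⟩, h'⟩)
        · exact Or.inr (Or.inr h')
      · rintro (⟨hx, h'⟩ | ⟨⟨x, hx, h1, h2⟩, h'⟩ | h')
        · exact Or.inl ⟨⟨a, hx, le_rfl, by omega⟩, h'⟩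
        · exact Or.inl ⟨⟨x, hx, by omega, h2⟩, h'⟩
        · exact Or.inr h'

/-- The lists starting with a contribute x_a times the ideal of shorter lists from a + t. The others
start at a + 1 or later and lie in that shorter ideal after dropping their first entry, so the
splitting meets no new intersection. -/
theorem varLinear_spreadFrom (hvs : vs.Nodup) (hvs' : ∀ v, v ∈ vs) {t : ℕ} (ht : 1 ≤ t) (d : ℕ) :
    ∀ a, VarLinear K vs d (Contains (SpreadFrom t d a)) := by
  induction d with
  | zero =>
    exact fun a => (varLinear_true hvs hvs').congr fun ρ _ =>
      ⟨fun _ => trivial, fun _ => ⟨[], ⟨List.Pairwise.nil, rfl, by simp⟩, by simp⟩⟩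
  | succ d ihd =>
    intro a
    obtain ⟨k, hk⟩ : ∃ k, n - a = k := ⟨_, rfl⟩
    induction k generalizing a with
    | zero =>
      refine (varLinear_false vs _).congr fun ρ hρ => ⟨?_, False.elim⟩
      rintro ⟨z, ⟨-, hz, hza⟩, hzρ⟩
      match z, hz with
      | z₁ :: _, _ =>
        have h1 := hza z₁ (by simp)
        have h2 := hρ _ (hzρ z₁ (by simp))
        omega
    | succ k ih =>
      refine ((ihd (a + t)).split_of_le (x := a) (A := Contains (SpreadFrom t (d + 1) (a + 1)))
        (monotone_contains _) (monotone_contains _) (by omega) (contains_of_insert ?_)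
        (contains_of_insert ?_) (ih (a + 1) (by omega)) ?_).congr ?_
      · exact fun z hz i hi => hz.2.2 i hi
      · exact fun z hz i hi => lt_of_lt_of_le (by omega) (hz.2.2 i hi)
      · rintro ρ ⟨z, ⟨hs, hz, hza⟩, hzρ⟩
        match z, hz with
        | z₁ :: zs, hz =>
          have h1 := hza z₁ (by simp)
          exact ⟨zs, ⟨(spread_cons.1 hs).2, by simpa using hz,
            fun i hi => by have := (spread_cons.1 hs).1 i hi; omega⟩,
            fun i hi => hzρ i (List.mem_cons_of_mem _ hi)⟩
      · intro ρ _
        constructor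
        · rintro ⟨z, ⟨hs, hz, hza⟩, hzρ⟩
          match z, hz with
          | z₁ :: zs, hz =>
            have h1 := hza z₁ (by simp)
            rcases eq_or_lt_of_le h1 with rfl | h1
            · exact Or.inl ⟨hzρ _ (by simp), zs, ⟨(spread_cons.1 hs).2, by simpa using hz,
                (spread_cons.1 hs).1⟩, fun i hi => hzρ i (List.mem_cons_of_mem _ hi)⟩
            · exact Or.inr ⟨_, ⟨hs, hz, fun i hi => h1.trans_le (head_le_of_spread hs i hi)⟩, hzρ⟩
        · rintro (⟨ha, zs, ⟨hs, hz, hza⟩, hzρ⟩ | ⟨z, ⟨hs, hz, hza⟩, hzρ⟩)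
          · exact ⟨a :: zs, ⟨spread_cons.2 ⟨hza, hs⟩, by simpa using hz, fun i hi => by
              rcases List.mem_cons.1 hi with rfl | hi
              · exact le_rfl
              · have := hza i hi; omega⟩, by simpa using ⟨ha, hzρ⟩⟩
          · exact ⟨z, ⟨hs, hz, fun i hi => by have := hza i hi; omega⟩, hzρ⟩

/-- As long as a < w_1, a list starting with a is below w whatever follows, so its tail ranges over
all spread lists. At a = w_1 the bound moves to the tails, and beyond w_1 nothing is left. -/
theorem varLinear_spreadBelow (hvs : vs.Nodup) (hvs' : ∀ v, v ∈ vs) {t : ℕ} (ht : 1 ≤ t) :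
    ∀ (w : List ℕ) (a : ℕ), VarLinear K vs w.length (Contains (SpreadBelow t w a)) := by
  intro w
  induction w with
  | nil =>
    refine fun a => (varLinear_false vs _).congr fun ρ hρ => ⟨?_, False.elim⟩
    rintro ⟨z, ⟨-, -, -, hz⟩, -⟩
    simp at hz
  | cons w₁ ws ihw =>
    intro a
    obtain ⟨k, hk⟩ : ∃ k, n - a = k := ⟨_, rfl⟩
    induction k generalizing a with
    | zero =>
      refine (varLinear_false vs _).congr fun ρ hρ => ⟨?_, False.elim⟩
      rintro ⟨z, ⟨-, hz, hza, -⟩, hzρ⟩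
      match z, hz with
      | z₁ :: _, _ =>
        have h1 := hza z₁ (by simp)
        have h2 := hρ _ (hzρ z₁ (by simp))
        omega
    | succ k ih =>
      rcases lt_trichotomy w₁ a with hwa | rfl | hwa
      · refine (varLinear_false vs _).congr fun ρ hρ => ⟨?_, False.elim⟩
        rintro ⟨z, ⟨-, hz, hza, hlt⟩, hzρ⟩
        match z, hz with
        | z₁ :: _, _ =>
          have h1 := hza z₁ (by simp)
          rcases List.cons_lt_cons_iff.1 hlt with h | h <;> omega
      · refine ((ihw (w₁ + t)).var_mul (monotone_contains _) (x := w₁) (by omega)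
          (contains_of_insert fun z hz i hi =>
            lt_of_lt_of_le (by omega) (hz.2.2.1 i hi))).congr fun ρ _ => ⟨?_, ?_⟩
        · rintro ⟨z, ⟨hs, hz, hza, hlt⟩, hzρ⟩
          match z, hz with
          | z₁ :: zs, hz =>
            have h1 := hza z₁ (by simp)
            obtain ⟨rfl, hlt'⟩ := (List.cons_lt_cons_iff.1 hlt).resolve_left (by omega)
            exact ⟨hzρ _ (by simp), zs, ⟨(spread_cons.1 hs).2, by simpa using hz,
              (spread_cons.1 hs).1, hlt'⟩, fun i hi => hzρ i (List.mem_cons_of_mem _ hi)⟩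
        · rintro ⟨ha, zs, ⟨hs, hz, hza, hlt⟩, hzρ⟩
          exact ⟨w₁ :: zs, ⟨spread_cons.2 ⟨hza, hs⟩, by simpa using hz, fun i hi => by
              rcases List.mem_cons.1 hi with rfl | hi
              · exact le_rfl
              · have := hza i hi; omega, List.cons_lt_cons_iff.2 (Or.inr ⟨rfl, hlt⟩)⟩,
              by simpa using ⟨ha, hzρ⟩⟩
      · refine ((varLinear_spreadFrom hvs hvs' ht ws.length (a + t)).split_of_le (x := a)
          (A := Contains (SpreadBelow t (w₁ :: ws) (a + 1)))
          (monotone_contains _) (monotone_contains _) (by omega) (contains_of_insert ?_)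
          (contains_of_insert ?_) (ih (a + 1) (by omega)) ?_).congr ?_
        · exact fun z hz i hi => hz.2.2.1 i hi
        · exact fun z hz i hi => lt_of_lt_of_le (by omega) (hz.2.2 i hi)
        · rintro ρ ⟨z, ⟨hs, hz, hza, -⟩, hzρ⟩
          match z, hz with
          | z₁ :: zs, hz =>
            have h1 := hza z₁ (by simp)
            exact ⟨zs, ⟨(spread_cons.1 hs).2, by simpa using hz,
              fun i hi => by have := (spread_cons.1 hs).1 i hi; omega⟩,
              fun i hi => hzρ i (List.mem_cons_of_mem _ hi)⟩
        · intro ρ _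
          constructor
          · rintro ⟨z, ⟨hs, hz, hza, hlt⟩, hzρ⟩
            match z, hz with
            | z₁ :: zs, hz =>
              have h1 := hza z₁ (by simp)
              rcases eq_or_lt_of_le h1 with rfl | h1
              · exact Or.inl ⟨hzρ _ (by simp), zs, ⟨(spread_cons.1 hs).2, by simpa using hz,
                  (spread_cons.1 hs).1⟩, fun i hi => hzρ i (List.mem_cons_of_mem _ hi)⟩
              · exact Or.inr ⟨_, ⟨hs, hz, fun i hi => h1.trans_le (head_le_of_spread hs i hi),
                  hlt⟩, hzρ⟩
          · rintro (⟨ha, zs, ⟨hs, hz, hza⟩, hzρ⟩ | ⟨z, ⟨hs, hz, hza, hlt⟩, hzρ⟩)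
            · exact ⟨a :: zs, ⟨spread_cons.2 ⟨hza, hs⟩, by simpa using hz, fun i hi => by
                rcases List.mem_cons.1 hi with rfl | hi
                · exact le_rfl
                · have := hza i hi; omega, List.cons_lt_cons_iff.2 (Or.inl hwa)⟩,
                by simpa using ⟨ha, hzρ⟩⟩
            · exact ⟨z, ⟨hs, hz, fun i hi => by have := hza i hi; omega, hlt⟩, hzρ⟩

/-- A nonempty list of indices below n is lexicographically smaller than (n, …, n) already at its
first entry. -/
theorem VarLinear.spreadAbove {t : ℕ} {u : List ℕ}
    (h : VarLinear K vs u.length (Contains (SpreadBetween t u (List.replicate u.length n))))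
    (hu : u ≠ []) : VarLinear K vs u.length (Contains (SpreadAbove t u)) := by
  refine h.congr fun ρ hρ => ⟨?_, ?_⟩
  · rintro ⟨z, ⟨h1, h2, h3⟩, hz⟩
    refine ⟨z, ⟨h1, h2, h3, ?_⟩, hz⟩
    match u, z, hu, h2 with
    | _ :: us, z₁ :: zs, _, _ =>
      rw [List.length_cons, List.replicate_succ]
      exact List.cons_lt_cons_iff.2 (Or.inl (hρ _ (hz _ (by simp))))
  · rintro ⟨z, ⟨h1, h2, h3, -⟩, hz⟩
    exact ⟨z, ⟨h1, h2, h3⟩, hz⟩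

/-- Lists starting with u_1 are below w because u_1 < w_1, and lists starting later are above u. So
each part keeps just one of the two bounds. -/
theorem contains_spreadBetween_iff {t u₁ u₂ w₁ : ℕ} {us ws : List ℕ}
    (hw : ws.length = us.length + 1) (huw : u₁ < w₁) (hu₂ : u₁ + t ≤ u₂) (ρ : Set ℕ) :
    Contains (SpreadBetween t (u₁ :: u₂ :: us) (w₁ :: ws)) ρ ↔
      (u₁ ∈ ρ ∧ Contains (SpreadAbove t (u₂ :: us)) ρ) ∨
        Contains (SpreadBelow t (w₁ :: ws) (u₁ + 1)) ρ := by
  constructor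
  · rintro ⟨z, ⟨hs, hz, hu, hlt⟩, hzρ⟩
    match z, hz with
    | z₁ :: zs, hz =>
      rcases cons_le_cons_iff'.1 hu with h1 | ⟨rfl, h1⟩
      · exact Or.inr ⟨_, ⟨hs, by simpa [hw] using hz,
          fun i hi => h1.trans_le (head_le_of_spread hs i hi), hlt⟩, hzρ⟩
      · exact Or.inl ⟨hzρ _ (by simp), zs, ⟨(spread_cons.1 hs).2, by simpa using hz, h1⟩,
          fun i hi => hzρ i (List.mem_cons_of_mem _ hi)⟩
  · rintro (⟨hu, zs, hz, hzρ⟩ | ⟨z, ⟨hs, hz, hza, hlt⟩, hzρ⟩)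
    · exact ⟨u₁ :: zs, ⟨spread_cons_of_spreadAbove hu₂ hz, by simpa using hz.2.1,
        cons_le_cons_iff'.2 (Or.inr ⟨rfl, hz.2.2⟩), List.cons_lt_cons_iff.2 (Or.inl huw)⟩,
        by simpa using ⟨hu, hzρ⟩⟩
    · refine ⟨z, ⟨hs, by simpa [hw] using hz, ?_, hlt⟩, hzρ⟩
      match z, hz with
      | z₁ :: zs, hz => exact cons_le_cons_iff'.2 (Or.inl (hza z₁ (by simp)))

/-- The lexsegment from `u` (included) to `w` (excluded) has linear Koszul homology when `w`,
with its last entry removed and shifted by `t`, is at least the tail of `u`. -/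
theorem varLinear_spreadBetween (hvs : vs.Nodup) (hvs' : ∀ v, v ∈ vs) {t : ℕ} (ht : 1 ≤ t) :
    ∀ (u : List ℕ), Spread t u → (∀ i ∈ u, i < n) → ∀ w : List ℕ, w.length = u.length →
      ShiftLE t u w → VarLinear K vs u.length (Contains (SpreadBetween t u w)) := by
  intro u
  induction u with
  | nil =>
    intro _ _ w hw _
    refine (varLinear_false vs _).congr fun ρ hρ => ⟨?_, False.elim⟩
    rintro ⟨z, ⟨-, -, -, hz⟩, -⟩
    have : w = [] := by simpa using hw
    simp [this] at hz
  | cons u₁ us ihu =>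
    intro hu hun w hw hsh
    match w, hw with
    | w₁ :: ws, hw =>
    match us, ihu, hu, hun, hw, hsh with
    | [], _, _, _, hw, _ =>
      refine ((varLinear_spreadBelow hvs hvs' ht (w₁ :: ws) u₁).congr
        fun ρ _ => ⟨?_, ?_⟩ : VarLinear K vs (w₁ :: ws).length _) |> cast (by rw [hw])
      · rintro ⟨z, ⟨hs, hz, hu, hlt⟩, hzρ⟩
        exact ⟨z, ⟨hs, hz.trans hw.symm, le_of_spreadAbove ⟨hs, hz, hu⟩, hlt⟩, hzρ⟩
      · rintro ⟨z, ⟨hs, hz, hza, hlt⟩, hzρ⟩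
        refine ⟨z, ⟨hs, hz.trans hw, ?_, hlt⟩, hzρ⟩
        match z, hz with
        | z₁ :: zs, hz =>
          rcases eq_or_lt_of_le (hza z₁ (by simp)) with h | h
          · exact cons_le_cons_iff'.2 (Or.inr ⟨h, nil_le' _⟩)
          · exact cons_le_cons_iff'.2 (Or.inl h)
    | u₂ :: us, ihu, hu, hun, hw, hsh =>
      have hwl : ws.length = us.length + 1 := by simpa using hw
      have hu' := (spread_cons.1 hu).2
      have hun' : ∀ i ∈ u₂ :: us, i < n := fun i hi => hun i (List.mem_cons_of_mem _ hi)
      have hu₂ : u₁ + t ≤ u₂ := (spread_cons.1 hu).1 _ (by simp)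
      have hu₂n : u₂ < n := hun' _ (by simp)
      have hcmp : u₂ < w₁ + t ∨ (u₂ = w₁ + t ∧ ShiftLE t (u₂ :: us) ws) := by
        rwa [ShiftLE] at hsh
      rcases lt_trichotomy w₁ u₁ with hwu | rfl | hwu
      · refine (varLinear_false vs _).congr fun ρ hρ => ⟨?_, False.elim⟩
        rintro ⟨z, ⟨-, hz, hu, hlt⟩, hzρ⟩
        have := hu.trans_lt hlt
        rcases List.cons_lt_cons_iff.1 this with h | h <;> omega
      · obtain ⟨rfl, hsh'⟩ := hcmp.resolve_left (by omega)
        refine ((ihu hu' hun' ws hwl hsh').var_mul (monotone_contains _) (x := w₁) (by omega)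
          (contains_of_insert fun z hz i hi => lt_of_lt_of_le (by omega)
            (le_of_spreadAbove ⟨hz.1, hz.2.1, hz.2.2.1⟩ i hi))).congr fun ρ _ => ⟨?_, ?_⟩
        · rintro ⟨z, ⟨hs, hz, hu, hlt⟩, hzρ⟩
          match z, hz with
          | z₁ :: zs, hz =>
            have h1 : w₁ ≤ z₁ := by rcases cons_le_cons_iff'.1 hu with h | h <;> omega
            obtain ⟨rfl, hlt'⟩ := (List.cons_lt_cons_iff.1 hlt).resolve_left (by omega)
            have hu' := (cons_le_cons_iff'.1 hu).resolve_left (by omega)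
            exact ⟨hzρ _ (by simp), zs, ⟨(spread_cons.1 hs).2, by simpa using hz, hu'.2, hlt'⟩,
              fun i hi => hzρ i (List.mem_cons_of_mem _ hi)⟩
        · rintro ⟨ha, zs, ⟨hs, hz, hu, hlt⟩, hzρ⟩
          exact ⟨w₁ :: zs, ⟨spread_cons_of_spreadAbove le_rfl ⟨hs, hz, hu⟩, by simpa using hz,
            cons_le_cons_iff'.2 (Or.inr ⟨rfl, hu⟩),
            List.cons_lt_cons_iff.2 (Or.inr ⟨rfl, hlt⟩)⟩, by simpa using ⟨ha, hzρ⟩⟩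
      -- The main case, I = x_{u_1} B + A. Both A and B are known to be linear; what remains is A ∩
      -- B.
      · have hB : VarLinear K vs (us.length + 1) (Contains (SpreadAbove t (u₂ :: us))) :=
          (ihu hu' hun' _ (by simp) (shiftLE_replicate ht hun' _)).spreadAbove (by simp)
        have hA := varLinear_spreadBelow (K := K) hvs hvs' ht (w₁ :: ws) (u₁ + 1)
        have hlen : (w₁ :: ws).length = us.length + 1 + 1 := by simp [hwl]
        rw [hlen] at hA
        refine (hB.split (monotone_contains _) (monotone_contains _) (x := u₁) (by omega)
          (contains_of_insert fun z hz i hi => hz.2.2.1 i hi)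
          (contains_of_insert fun z hz i hi => lt_of_lt_of_le (by omega)
            (le_of_spreadAbove hz i hi)) hA ?_).congr
          fun ρ _ => contains_spreadBetween_iff hwl hwu hu₂ ρ
        by_cases hcase : u₂ < w₁ + t
        -- The index u_2 - t is the last x that can be put in front of every list of B, and it is
        -- less than w_1, so the result stays below w. From u_2 - t + 1 on, dropping the first entry
        -- lands in B. Hence A ∩ B = (x_{u_1+1}, …, x_{u_2-t}) B + A'.
        · have hA' := varLinear_spreadBelow (K := K) hvs hvs' ht (w₁ :: ws) (u₂ - t + 1)
          rw [hlen] at hA'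
          have hle : ∀ ρ, Contains (SpreadBelow t (w₁ :: ws) (u₂ - t + 1)) ρ →
              Contains (SpreadAbove t (u₂ :: us)) ρ := by
            rintro ρ ⟨z, ⟨hs, hz, hza, -⟩, hzρ⟩
            match z, hz with
            | z₁ :: zs, hz =>
              have hzl : zs.length = us.length + 1 := by simpa [hwl] using hz
              refine ⟨zs, ⟨(spread_cons.1 hs).2, by simpa using hzl, ?_⟩,
                fun i hi => hzρ i (List.mem_cons_of_mem _ hi)⟩
              match zs, hzl with
              | z₂ :: zs, _ =>
                have h1 := hza z₁ (by simp)
                have h2 := (spread_cons.1 hs).1 z₂ (by simp)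
                exact cons_le_cons_iff'.2 (Or.inl (by omega))
          refine (hB.split_interval (monotone_contains _) (monotone_contains _)
            (b := u₂ - t + 1) (by omega) ?_ ?_ hA' hle (u₁ + 1)).congr fun ρ _ => ⟨?_, ?_⟩
          · exact fun x hx => contains_of_insert fun z hz i hi => hx.trans_le (hz.2.2.1 i hi)
          · exact fun x hx => contains_of_insert fun z hz i hi => lt_of_lt_of_le (by omega)
              (le_of_spreadAbove hz i hi)
          · rintro ⟨⟨z, ⟨hs, hz, hza, hlt⟩, hzρ⟩, hb⟩
            match z, hz with
            | z₁ :: zs, hz =>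
              by_cases h1 : z₁ < u₂ - t + 1
              · exact Or.inl ⟨⟨z₁, hzρ _ (by simp), hza _ (by simp), h1⟩, hb⟩
              · exact Or.inr ⟨_, ⟨hs, hz, fun i hi =>
                  (not_lt.1 h1).trans (head_le_of_spread hs i hi), hlt⟩, hzρ⟩
          · rintro (⟨⟨x, hxρ, hx1, hx2⟩, b, hb, hbρ⟩ | h)
            · refine ⟨⟨x :: b, ⟨spread_cons_of_spreadAbove (by omega) hb,
                by simpa [hwl] using hb.2.1, fun i hi => ?_,
                List.cons_lt_cons_iff.2 (Or.inl (by omega))⟩, by simpa using ⟨hxρ, hbρ⟩⟩,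
                b, hb, hbρ⟩
              rcases List.mem_cons.1 hi with rfl | hi
              · exact hx1
              · have := le_of_spreadAbove hb i hi; omega
            · refine ⟨?_, hle ρ h⟩
              obtain ⟨z, ⟨hs, hz, hza, hlt⟩, hzρ⟩ := h
              exact ⟨z, ⟨hs, hz, fun i hi => by have := hza i hi; omega, hlt⟩, hzρ⟩
        -- Now u_2 = w_1 + t and A ∩ B = (x_{u_1+1}, …, x_{w_1-1}) B + x_{w_1} D, where D is the
        -- interval between the tails of u and w. The induction hypothesis applies to D.
        · obtain ⟨rfl, hsh'⟩ := hcmp.resolve_left hcase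
          have hD := ihu hu' hun' ws hwl hsh'
          have hx : ∀ x < w₁ + t, ∀ ρ, Contains (SpreadBetween t ((w₁ + t) :: us) ws)
              (insert x ρ) → Contains (SpreadBetween t ((w₁ + t) :: us) ws) ρ :=
            fun x hx => contains_of_insert fun z hz i hi => lt_of_lt_of_le hx
              (le_of_spreadAbove ⟨hz.1, hz.2.1, hz.2.2.1⟩ i hi)
          refine (hB.split_interval
            (A := fun ρ => w₁ ∈ ρ ∧ Contains (SpreadBetween t ((w₁ + t) :: us) ws) ρ) ?_
            (monotone_contains _) (b := w₁) (by omega) ?_ ?_ (hD.var_mul (monotone_contains _)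
              (by omega) (hx w₁ (by omega))) ?_ (u₁ + 1)).congr fun ρ _ => ⟨?_, ?_⟩
          · exact fun ρ ρ' h h' => ⟨h h'.1, monotone_contains _ h h'.2⟩
          · exact fun x hxw ρ h => ⟨h.1.resolve_left (by omega), hx x (by omega) ρ h.2⟩
          · exact fun x hx => contains_of_insert fun z hz i hi => lt_of_lt_of_le (by omega)
              (le_of_spreadAbove hz i hi)
          · rintro ρ ⟨-, z, hz, hzρ⟩
            exact ⟨z, ⟨hz.1, hz.2.1, hz.2.2.1⟩, hzρ⟩
          · rintro ⟨⟨z, ⟨hs, hz, hza, hlt⟩, hzρ⟩, hb⟩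
            match z, hz with
            | z₁ :: zs, hz =>
              rcases List.cons_lt_cons_iff.1 hlt with h1 | ⟨rfl, h1⟩
              · exact Or.inl ⟨⟨z₁, hzρ _ (by simp), hza _ (by simp), h1⟩, hb⟩
              -- The tail of a list starting with w_1 gives only the upper bound, and membership in
              -- B only the lower one; both are needed for D.
              · refine Or.inr ⟨hzρ _ (by simp), contains_spreadBetween ht hu' hwl hsh' ?_ hb⟩
                exact ⟨zs, ⟨(spread_cons.1 hs).2, by simpa using hz, (spread_cons.1 hs).1, h1⟩,
                  fun i hi => hzρ i (List.mem_cons_of_mem _ hi)⟩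
          · rintro (⟨⟨x, hxρ, hx1, hx2⟩, b, hb, hbρ⟩ | ⟨hwρ, z, hz, hzρ⟩)
            · refine ⟨⟨x :: b, ⟨spread_cons_of_spreadAbove (by omega) hb,
                by simpa [hwl] using hb.2.1, fun i hi => ?_,
                List.cons_lt_cons_iff.2 (Or.inl (by omega))⟩, by simpa using ⟨hxρ, hbρ⟩⟩,
                b, hb, hbρ⟩
              rcases List.mem_cons.1 hi with rfl | hi
              · exact hx1
              · have := le_of_spreadAbove hb i hi; omega
            · have hz' : SpreadAbove t ((w₁ + t) :: us) z := ⟨hz.1, hz.2.1, hz.2.2.1⟩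
              refine ⟨⟨w₁ :: z, ⟨spread_cons_of_spreadAbove le_rfl hz',
                by simpa [hwl] using hz.2.1, fun i hi => ?_,
                List.cons_lt_cons_iff.2 (Or.inr ⟨rfl, hz.2.2.2⟩)⟩, by simpa using ⟨hwρ, hzρ⟩⟩,
                z, hz', hzρ⟩
              rcases List.mem_cons.1 hi with rfl | hi
              · omega
              · have := le_of_spreadAbove hz' i hi; omega

/-- The lexsegment from `u` (included) to `w` (excluded) has linear Koszul homology when the
first two entries of `u` are as close as possible. -/
theorem varLinear_spreadBetween_of_eq (hvs : vs.Nodup) (hvs' : ∀ v, v ∈ vs) {t : ℕ} (ht : 1 ≤ t)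
    {u₁ w₁ : ℕ} {us ws : List ℕ} (hu : Spread t (u₁ :: (u₁ + t) :: us))
    (hun : ∀ i ∈ u₁ :: (u₁ + t) :: us, i < n) (hwl : ws.length = us.length + 1) (hwu : u₁ < w₁) :
    VarLinear K vs (us.length + 1 + 1)
      (Contains (SpreadBetween t (u₁ :: (u₁ + t) :: us) (w₁ :: ws))) := by
  have hun' : ∀ i ∈ (u₁ + t) :: us, i < n := fun i hi => hun i (List.mem_cons_of_mem _ hi)
  have hB : VarLinear K vs (us.length + 1) (Contains (SpreadAbove t ((u₁ + t) :: us))) :=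
    (varLinear_spreadBetween hvs hvs' ht _ (spread_cons.1 hu).2 hun' _ (by simp)
      (shiftLE_replicate ht hun' _)).spreadAbove (by simp)
  have hA := varLinear_spreadBelow (K := K) hvs hvs' ht (w₁ :: ws) (u₁ + 1)
  have hlen : (w₁ :: ws).length = us.length + 1 + 1 := by simp [hwl]
  rw [hlen] at hA
  refine (hB.split_of_le (monotone_contains _) (monotone_contains _) (x := u₁)
    (hun _ (by simp)) (contains_of_insert fun z hz i hi => hz.2.2.1 i hi)
    (contains_of_insert fun z hz i hi => lt_of_lt_of_le (by omega)
      (le_of_spreadAbove hz i hi)) hA ?_).congr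
    fun ρ _ => contains_spreadBetween_iff hwl hwu le_rfl ρ
  -- This is A ⊆ B: a first entry above u_1 forces the second entry above u_1 + t, the head of the
  -- lists bounding B.
  rintro ρ ⟨z, ⟨hs, hz, hza, -⟩, hzρ⟩
  match z, hz with
  | z₁ :: zs, hz =>
    have hzl : zs.length = us.length + 1 := by simpa [hwl] using hz
    refine ⟨zs, ⟨(spread_cons.1 hs).2, by simpa using hzl, ?_⟩,
      fun i hi => hzρ i (List.mem_cons_of_mem _ hi)⟩
    match zs, hzl with
    | z₂ :: zs, _ =>
      have h1 := hza z₁ (by simp)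
      have h2 := (spread_cons.1 hs).1 z₂ (by simp)
      exact cons_le_cons_iff'.2 (Or.inl (by omega))

end

/-! ### Koszul homology and linear resolutions -/

section

variable {n : ℕ} {K : Type*} [Field K]

/-- The conditions on the grading `H` of the ambient module that are used below. -/
structure IsGrading {N : Type*} [AddCommGroup N] [Module (MvPolynomial (Fin n) K) N] [Module K N]
    (H : ℕ → Submodule K N) : Prop where
  smul_mem : ∀ {c r : ℕ} {p : MvPolynomial (Fin n) K} {f : N}, p.IsHomogeneous c → f ∈ H r →
    p • f ∈ H (c + r)
  exists_proj : ∃ p : ℕ → N →+ N, (∀ c, ∀ f ∈ H c, p c f = f) ∧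
    ∀ c c', ∀ f ∈ H c', c' ≠ c → p c f = 0
  finite : ∀ c, FiniteDimensional K (H c)

/-- The component of degree `c` of a vector of polynomials. -/
noncomputable def vecComponent (K : Type*) [Field K] (n : ℕ) (κ : Type) (c : ℕ) :
    (κ → MvPolynomial (Fin n) K) →+ (κ → MvPolynomial (Fin n) K) :=
  (homogeneousComponent c : MvPolynomial (Fin n) K →ₗ[K] _).toAddMonoidHom.compLeft κ

theorem vecComponent_apply {κ : Type} {c : ℕ} (f : κ → MvPolynomial (Fin n) K) (k : κ) :
    vecComponent K n κ c f k = homogeneousComponent c (f k) := rfl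

theorem vecComponent_mem {κ : Type} {c : ℕ} (f : κ → MvPolynomial (Fin n) K) :
    vecComponent K n κ c f ∈ homogeneousVec K n κ c :=
  mem_homogeneousVec.2 fun k => homogeneousComponent_isHomogeneous c (f k)

theorem exists_sum_vecComponent {κ : Type} [Finite κ] (f : κ → MvPolynomial (Fin n) K) (c₀ : ℕ) :
    ∃ M, c₀ < M ∧ ∑ c ∈ Finset.range M, vecComponent K n κ c f = f := by
  obtain ⟨M, hM⟩ := (Set.finite_range fun k => (f k).totalDegree).bddAbove
  refine ⟨max M c₀ + 1, by omega, funext fun k => ?_⟩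
  rw [Finset.sum_apply]
  simp only [vecComponent_apply]
  conv_rhs => rw [← sum_homogeneousComponent (f k)]
  refine (Finset.sum_subset ?_ fun c _ hc => homogeneousComponent_eq_zero _ _ ?_).symm
  · have := hM ⟨k, rfl⟩
    exact Finset.range_subset_range.2 (by simp only at this; omega)
  · rw [Finset.mem_range] at hc; omega

theorem isGrading_homogeneousSubmodule :
    IsGrading (n := n) (homogeneousSubmodule (Fin n) K) where
  smul_mem hp hf := hp.mul hf
  exists_proj := ⟨fun c => (homogeneousComponent c : MvPolynomial (Fin n) K →ₗ[K] _).toAddMonoidHom,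
    fun _ _ hf => (homogeneousComponent_of_mem hf).trans (if_pos rfl),
    fun _ _ _ hf h => (homogeneousComponent_of_mem hf).trans (if_neg h.symm)⟩
  finite c := Module.Finite.iff_fg.2 (homogeneousSubmodule_fg _ _ c)

theorem isGrading_homogeneousVec (κ : Type) [Finite κ] :
    IsGrading (n := n) (homogeneousVec K n κ) where
  smul_mem hp hf := mem_homogeneousVec.2 fun k => hp.mul (mem_homogeneousVec.1 hf k)
  exists_proj := ⟨vecComponent K n κ,
    fun _ _ hf => _root_.funext fun k =>
      (homogeneousComponent_of_mem (mem_homogeneousVec.1 hf k)).trans (if_pos rfl),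
    fun _ _ _ hf h => _root_.funext fun k =>
      (homogeneousComponent_of_mem (mem_homogeneousVec.1 hf k)).trans (if_neg h.symm)⟩
  finite c := Module.Finite.iff_fg.2 (Submodule.fg_pi fun _ => homogeneousSubmodule_fg _ _ c)

variable {N : Type*} [AddCommGroup N] [Module (MvPolynomial (Fin n) K) N] [Module K N]
  {H : ℕ → Submodule K N} {κ : Type}

/-- A linear map from a free module raises degrees by `r`. -/
def RaisesDegree (H : ℕ → Submodule K N) (r : ℕ)
    (φ : (κ → MvPolynomial (Fin n) K) →ₗ[MvPolynomial (Fin n) K] N) : Prop :=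
  ∀ c, ∀ f ∈ homogeneousVec K n κ c, φ f ∈ H (c + r)

/-- The component of φ f in degree c + r sees only the component of f in degree c. So kernels are
graded and preimages can be chosen homogeneous. -/
theorem RaisesDegree.vecComponent_mem_ker [Finite κ] (hH : IsGrading (n := n) H) {r : ℕ}
    {φ : (κ → MvPolynomial (Fin n) K) →ₗ[MvPolynomial (Fin n) K] N} (hφ : RaisesDegree H r φ)
    {f : κ → MvPolynomial (Fin n) K} (c : ℕ) :
    (φ f = 0 → φ (vecComponent K n κ c f) = 0) ∧
      (φ f ∈ H (c + r) → φ (vecComponent K n κ c f) = φ f) := by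
  obtain ⟨p, hp, hp'⟩ := hH.exists_proj
  obtain ⟨M, hM, hf⟩ := exists_sum_vecComponent f c
  have key : p (c + r) (φ f) = φ (vecComponent K n κ c f) := by
    conv_lhs => rw [← hf]
    rw [map_sum, map_sum, Finset.sum_eq_single c]
    · exact hp _ _ (hφ c _ (vecComponent_mem f))
    · exact fun c' _ hc' => hp' _ _ _ (hφ c' _ (vecComponent_mem f)) (by omega)
    · exact fun h => absurd (Finset.mem_range.2 hM) h
  exact ⟨fun h => by rw [← key, h, map_zero], fun h => by rw [← key, hp _ _ h]⟩

theorem RaisesDegree.exists_preimage [Finite κ] (hH : IsGrading (n := n) H) {r : ℕ}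
    {φ : (κ → MvPolynomial (Fin n) K) →ₗ[MvPolynomial (Fin n) K] N} (hφ : RaisesDegree H r φ)
    (c : ℕ) : ∀ z ∈ gradedPiece H (LinearMap.range φ) (c + r),
      ∃ y ∈ gradedPiece (homogeneousVec K n κ) (⊤ : Submodule (MvPolynomial (Fin n) K) _) c, φ.toAddMonoidHom y = z := by
  rintro _ ⟨⟨f, rfl⟩, hf⟩
  exact ⟨vecComponent K n κ c f, ⟨Submodule.mem_top (R := MvPolynomial (Fin n) K),
    vecComponent_mem f⟩, (hφ.vecComponent_mem_ker hH c).2 hf⟩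

theorem RaisesDegree.map_mem {r : ℕ}
    {φ : (κ → MvPolynomial (Fin n) K) →ₗ[MvPolynomial (Fin n) K] N} (hφ : RaisesDegree H r φ)
    (c : ℕ) : ∀ y ∈ gradedPiece (homogeneousVec K n κ) (⊤ : Submodule (MvPolynomial (Fin n) K) _) c,
      φ.toAddMonoidHom y ∈ gradedPiece H (LinearMap.range φ) (c + r) :=
  fun y hy => ⟨⟨y, rfl⟩, hφ c y hy.2⟩

omit [Module K N] in
theorem map_linearMap_d {vs : List (Fin n)}
    (φ : (κ → MvPolynomial (Fin n) K) →ₗ[MvPolynomial (Fin n) K] N)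
    (y : Kos (κ → MvPolynomial (Fin n) K) vs) :
    Kos.map φ.toAddMonoidHom vs (Kos.d (varAct (K := K) _) vs y) =
      Kos.d (varAct (K := K) N) vs (Kos.map φ.toAddMonoidHom vs y) :=
  Kos.map_d (fun v _ f => φ.map_smul (X v) f) y

/-- The syzygies of a module with linear Koszul homology have linear Koszul homology. -/
theorem KoszulLinear.ker [Finite κ] {vs : List (Fin n)} (hvs : vs.Nodup) (hvs' : ∀ v, v ∈ vs)
    (hH : IsGrading (n := n) H) {r : ℕ}
    {φ : (κ → MvPolynomial (Fin n) K) →ₗ[MvPolynomial (Fin n) K] N} (hφ : RaisesDegree H r φ)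
    (h : KoszulLinear vs H r (LinearMap.range φ)) :
    KoszulLinear vs (homogeneousVec K n κ) 1 (LinearMap.ker φ) := by
  intro c hc z hz hdz
  obtain ⟨c, rfl⟩ : ∃ c', c = c' + 1 := ⟨c - 1, by omega⟩
  -- The cycle bounds a chain y of the free module. The image of y is a cycle in the range of φ;
  -- bounding it there and lifting gives `w'`, and y - d w' lies in the kernel with the same
  -- boundary.
  obtain ⟨y, hy, rfl⟩ := koszulLinear_free hvs hvs' κ (c + 1) (by omega) z
    (Kos.all_mono hz (gradedPiece_mono le_top _)) hdz
  have hφz := Kos.map_eq_zero_of_mem_all_ker (g := φ.toAddMonoidHom)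
    (Kos.all_mono hz fun f hf => hf.1)
  rw [map_linearMap_d] at hφz
  have hφy := Kos.map_mem_all hy (hφ.map_mem (c + 1))
  rw [add_right_comm] at hφy
  obtain ⟨w, hw, hdw⟩ := h (c + r) (by omega) _ hφy hφz
  obtain ⟨w', hw', -, rfl⟩ := Kos.exists_lift (hφ.exists_preimage hH c) hw
    (Kos.mem_small_of_length_lt (lt_add_one _) w)
  refine ⟨y - Kos.d (varAct (K := K) _) vs w', ?_, ?_⟩
  · refine Kos.all_mono (Kos.mem_all_inf (Kos.mem_all_ker (g := φ.toAddMonoidHom) ?_) (sub_mem hy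
      (Kos.d_mem_all (varAct_mem_gradedPiece (varDegreeOne_homogeneousVec κ)) hw')))
      fun f hf => ⟨hf.1, hf.2.2⟩
    rw [map_sub, map_linearMap_d, hdw, sub_self]
  · rw [map_sub, Kos.d_d varAct_comm, sub_zero]

/-- Linearity of the Koszul homology in homological degrees `< i`. -/
def KoszulLinearBelow (vs : List (Fin n)) (H : ℕ → Submodule K N) (r i : ℕ)
    (Z : Submodule (MvPolynomial (Fin n) K) N) : Prop :=
  ∀ c, r ≤ c → ∀ z ∈ Kos.All (gradedPiece H Z (c + 1)) vs, z ∈ Kos.Small N i vs →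
    Kos.d (varAct (K := K) N) vs z = 0 →
    ∃ y ∈ Kos.All (gradedPiece H Z c) vs, Kos.d (varAct (K := K) N) vs y = z

theorem KoszulLinearBelow.koszulLinear {vs : List (Fin n)} {r : ℕ}
    {Z : Submodule (MvPolynomial (Fin n) K) N}
    (h : KoszulLinearBelow vs H r (vs.length + 1) Z) : KoszulLinear vs H r Z :=
  fun c hc z hz hd => h c hc z hz (Kos.mem_small_of_length_lt (lt_add_one _) z) hd

theorem koszulLinearBelow_zero (vs : List (Fin n)) (H : ℕ → Submodule K N) (r : ℕ)
    (Z : Submodule (MvPolynomial (Fin n) K) N) : KoszulLinearBelow vs H r 0 Z :=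
  fun _ _ z _ hz _ => ⟨0, zero_mem _, by rw [Kos.eq_zero_of_mem_small_zero hz, map_zero]⟩

/-- The connecting homomorphism lowers the number of factors e_v by one. A cycle in the range lifts
to a chain of the free module whose boundary lies in the kernel; correcting the lift inside the
kernel makes it a cycle, hence a boundary. -/
theorem KoszulLinearBelow.range [Finite κ] {vs : List (Fin n)} (hvs : vs.Nodup)
    (hvs' : ∀ v, v ∈ vs) (hH : IsGrading (n := n) H) {r i : ℕ}
    {φ : (κ → MvPolynomial (Fin n) K) →ₗ[MvPolynomial (Fin n) K] N} (hφ : RaisesDegree H r φ)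
    (h : KoszulLinearBelow vs (homogeneousVec K n κ) 1 i (LinearMap.ker φ)) :
    KoszulLinearBelow vs H r (i + 1) (LinearMap.range φ) := by
  intro c hc z hz hzs hdz
  obtain ⟨c, rfl⟩ : ∃ c', c = c' + r := ⟨c - r, by omega⟩
  rw [add_right_comm] at hz
  obtain ⟨y, hy, hys, rfl⟩ := Kos.exists_lift (hφ.exists_preimage hH (c + 1)) hz hzs
  rw [← map_linearMap_d] at hdz
  obtain ⟨w, hw, hdw⟩ := h (c + 1) (by omega) (Kos.d (varAct (K := K) _) vs y)
    (Kos.all_mono (Kos.mem_all_inf (Kos.mem_all_ker hdz)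
      (Kos.d_mem_all (varAct_mem_gradedPiece (varDegreeOne_homogeneousVec κ)) hy))
      fun f hf => ⟨hf.1, hf.2.2⟩) (Kos.d_mem_small hys) (Kos.d_d varAct_comm _)
  obtain ⟨x, hx, hdx⟩ := koszulLinear_free hvs hvs' κ c (by omega) (y - w)
    (sub_mem hy (Kos.all_mono hw (gradedPiece_mono le_top _))) (by rw [map_sub, hdw, sub_self])
  refine ⟨Kos.map φ.toAddMonoidHom vs x, Kos.map_mem_all hx (hφ.map_mem c), ?_⟩
  rw [← map_linearMap_d, hdx, map_sub, sub_eq_self]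
  exact Kos.map_eq_zero_of_mem_all_ker (Kos.all_mono hw fun f hf => hf.1)

end

/-- The coefficient of a Koszul chain without any factor `e_v`. -/
def Kos.base {α N : Type*} : ∀ {vs : List α}, Kos N vs → N
  | [], c => c
  | _ :: _, c => Kos.base c.1

/-- The Koszul chain with a single coefficient without any factor `e_v`. -/
def Kos.ofBase {α N : Type*} [AddCommGroup N] (f : N) : ∀ vs : List α, Kos N vs
  | [] => f
  | _ :: vs => (Kos.ofBase f vs, 0)

section

variable {α N : Type*} [AddCommGroup N]

theorem Kos.base_ofBase (f : N) : ∀ vs : List α, Kos.base (Kos.ofBase f vs) = f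
  | [] => rfl
  | _ :: vs => Kos.base_ofBase f vs

theorem Kos.ofBase_mem_all {G : AddSubgroup N} {f : N} (hf : f ∈ G) : ∀ vs : List α,
    Kos.ofBase f vs ∈ Kos.All G vs
  | [] => hf
  | _ :: vs => Kos.mem_all_cons.2 ⟨Kos.ofBase_mem_all hf vs, zero_mem _⟩

theorem Kos.d_ofBase (a : α → N →+ N) (f : N) : ∀ vs : List α, Kos.d a vs (Kos.ofBase f vs) = 0
  | [] => rfl
  | v :: vs => by
    have h : Kos.d a vs (Kos.fst (v := v) (Kos.ofBase f (v :: vs))) = 0 := Kos.d_ofBase a f vs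
    have h' : Kos.snd (v := v) (Kos.ofBase f (v :: vs)) = 0 := rfl
    exact Kos.ext (by rw [Kos.fst_d, h, h', map_zero, add_zero, map_zero])
      (by rw [Kos.snd_d, h', map_zero, neg_zero, map_zero])

theorem Kos.base_mem {G : AddSubgroup N} : ∀ {vs : List α} {c : Kos N vs}, c ∈ Kos.All G vs →
    Kos.base c ∈ G
  | [], _, h => h
  | _ :: _, c, h => by
    change Kos.base (Kos.fst c) ∈ G
    exact Kos.base_mem (Kos.mem_all_cons.1 h).1

theorem Kos.base_add : ∀ {vs : List α} (c c' : Kos N vs),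
    Kos.base (c + c') = Kos.base c + Kos.base c'
  | [], _, _ => rfl
  | v :: _, c, c' => Kos.base_add (Kos.fst (v := v) c) (Kos.fst c')

theorem Kos.base_zero : ∀ (vs : List α), Kos.base (0 : Kos N vs) = 0
  | [] => rfl
  | _ :: vs => Kos.base_zero vs

theorem Kos.base_d_mem {G G' : AddSubgroup N} {f : α → N →+ N} (h : ∀ v, ∀ g ∈ G, f v g ∈ G') :
    ∀ {vs : List α} {c : Kos N vs}, c ∈ Kos.All G vs → Kos.base (Kos.d f vs c) ∈ G'
  | [], _, _ => zero_mem _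
  | v :: vs, c, hc => by
    have h1 : Kos.base (Kos.d f (v :: vs) c) =
      Kos.base (Kos.d f vs (Kos.fst c) + Kos.map (f v) vs (Kos.snd c)) := rfl
    rw [h1, Kos.base_add]
    exact add_mem (Kos.base_d_mem h (Kos.mem_all_cons.1 hc).1)
      (Kos.base_mem (Kos.map_mem_all (Kos.mem_all_cons.1 hc).2 (h v)))

end

/-! ### Building a minimal linear resolution and recovering linearity from one. -/

section

variable {n : ℕ} {K : Type*} [Field K]

section

variable {N : Type*} [AddCommGroup N] [Module (MvPolynomial (Fin n) K) N] [Module K N]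
  {H : ℕ → Submodule K N}

/-- A module with linear Koszul homology is generated by its piece of the lowest degree. -/
theorem KoszulLinear.mem_span {vs : List (Fin n)} {r : ℕ}
    {Z : Submodule (MvPolynomial (Fin n) K) N} (h : KoszulLinear vs H r Z) {c : ℕ} (hc : r ≤ c) :
    ∀ f ∈ gradedPiece H Z c,
      f ∈ Submodule.span (MvPolynomial (Fin n) K) (gradedPiece H Z r : Set N) := by
  induction c, hc using Nat.le_induction with
  | base => exact fun f hf => Submodule.subset_span hf
  | succ c hc ih =>
    intro f hf
    -- An element is a cycle without factors e_v. Being a boundary means that it is a combination of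
    -- variables times elements one degree lower.
    obtain ⟨y, hy, hdy⟩ := h c hc (Kos.ofBase f vs) (Kos.ofBase_mem_all hf vs) (Kos.d_ofBase _ f vs)
    rw [← Kos.base_ofBase f vs, ← hdy]
    exact Kos.base_d_mem (G' := (Submodule.span (MvPolynomial (Fin n) K)
      (gradedPiece H Z r : Set N)).toAddSubgroup)
      (fun v g hg => Submodule.smul_mem _ _ (ih g hg)) hy

/-- The minimal cover of the submodule generated by the piece of degree `r`. -/
theorem IsGrading.exists_cover [IsScalarTower K (MvPolynomial (Fin n) K) N]
    (hH : IsGrading (n := n) H) (r : ℕ) (Z : Submodule (MvPolynomial (Fin n) K) N) :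
    ∃ (m : ℕ) (φ : (Fin m → MvPolynomial (Fin n) K) →ₗ[MvPolynomial (Fin n) K] N),
      LinearMap.range φ =
        Submodule.span (MvPolynomial (Fin n) K) (gradedPiece H Z r : Set N) ∧
      RaisesDegree H r φ ∧ ∀ f ∈ homogeneousVec K n (Fin m) 0, φ f = 0 → f = 0 := by
  let W : Submodule K N := Z.restrictScalars K ⊓ H r
  have hW : FiniteDimensional K W := by
    have := hH.finite r
    exact Submodule.finiteDimensional_of_le inf_le_right
  -- A basis over the field, and not just generators, makes the cover injective on vectors of
  -- constants. This is what keeps constants out of the syzygies.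
  let b := Module.finBasis K W
  refine ⟨Module.finrank K W, Fintype.linearCombination (MvPolynomial (Fin n) K)
    fun k => (b k : N), ?_, ?_, ?_⟩
  · rw [Fintype.range_linearCombination]
    refine le_antisymm (Submodule.span_mono ?_) (Submodule.span_le.2 fun f hf => ?_)
    · rintro _ ⟨k, rfl⟩
      exact (b k).2
    · have h1 := b.sum_repr ⟨f, hf⟩
      have h2 : ∑ k, b.repr ⟨f, hf⟩ k • (b k : N) = f := by
        have h3 := congrArg W.subtype h1
        rwa [map_sum] at h3
      rw [SetLike.mem_coe, ← h2]
      refine Submodule.sum_mem _ fun k _ => ?_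
      rw [← algebraMap_smul (MvPolynomial (Fin n) K)]
      exact Submodule.smul_mem _ _ (Submodule.subset_span ⟨k, rfl⟩)
  · intro c f hf
    rw [Fintype.linearCombination_apply]
    exact Submodule.sum_mem _ fun k _ => hH.smul_mem (mem_homogeneousVec.1 hf k) (b k).2.2
  · intro f hf h0
    have hC : ∀ k, f k = algebraMap K _ (coeff 0 (f k)) := fun k =>
      totalDegree_eq_zero_iff_eq_C.1 (Nat.le_zero.1 (mem_homogeneousVec.1 hf k).totalDegree_le)
    rw [Fintype.linearCombination_apply] at h0
    have h1 : ∑ k, coeff 0 (f k) • b k = 0 := by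
      apply Subtype.ext
      simp only [Submodule.coe_sum, Submodule.coe_smul, Submodule.coe_zero]
      rw [← h0]
      refine Finset.sum_congr rfl fun k _ => ?_
      conv_rhs => rw [hC k]
      rw [algebraMap_smul]
    have h2 := Fintype.linearIndependent_iff.1 b.linearIndependent _ h1
    exact _root_.funext fun k => by rw [hC k, h2 k, map_zero]; rfl

end

theorem mem_homogeneousVec_iff {κ : Type} {r c : ℕ} {f : κ → MvPolynomial (Fin n) K} :
    f ∈ homogeneousVec K n κ c ↔ IsHomogeneousVec (fun _ => r) (c + r) f := by
  rw [mem_homogeneousVec]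
  refine forall_congr' fun k => ?_
  simp only [Nat.add_right_cancel_iff]
  refine forall_congr' fun m => ?_
  rw [mem_support_iff, Finsupp.degree_eq_weight_one]
  rfl

theorem RaisesDegree.constantCoeff_eq_zero {κ κ' : Type} [Finite κ]
    {φ : (κ → MvPolynomial (Fin n) K) →ₗ[MvPolynomial (Fin n) K] κ' → MvPolynomial (Fin n) K}
    (hφ : RaisesDegree (homogeneousVec K n κ') 1 φ) (f : κ → MvPolynomial (Fin n) K) (k : κ') :
    constantCoeff (φ f k) = 0 := by
  classical
  have := Fintype.ofFinite κ
  rw [LinearMap.pi_apply_eq_sum_univ φ f, Finset.sum_apply, map_sum]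
  refine Finset.sum_eq_zero fun l _ => ?_
  have h1 : (fun j => if l = j then 1 else 0) ∈ homogeneousVec K n κ 0 :=
    mem_homogeneousVec.2 fun j => by
      split_ifs
      · exact isHomogeneous_one _ _
      · exact isHomogeneous_zero _ _ _
  have h2 := mem_homogeneousVec.1 (hφ 0 _ h1) k
  rw [Pi.smul_apply, smul_eq_mul, map_mul]
  have h3 : constantCoeff (φ (fun j => if l = j then 1 else 0) k) = 0 := by
    rw [constantCoeff_eq]
    exact h2.coeff_eq_zero (by simp)
  rw [h3, mul_zero]

/-- A module of syzygies that can be resolved linearly. -/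
def IsLinearSyzygy {m : ℕ} (Z : Submodule (MvPolynomial (Fin n) K) (Fin m → MvPolynomial (Fin n) K)) :
    Prop :=
  KoszulLinear (List.finRange n) (homogeneousVec K n (Fin m)) 1 Z ∧
    (∀ f ∈ Z, ∀ c, vecComponent K n (Fin m) c f ∈ Z) ∧
    ∀ f ∈ homogeneousVec K n (Fin m) 0, f ∈ Z → f = 0

theorem isLinearSyzygy_ker {N : Type*} [AddCommGroup N] [Module (MvPolynomial (Fin n) K) N]
    [Module K N] {H : ℕ → Submodule K N} (hH : IsGrading (n := n) H) {r m : ℕ}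
    {φ : (Fin m → MvPolynomial (Fin n) K) →ₗ[MvPolynomial (Fin n) K] N} (hφ : RaisesDegree H r φ)
    (hφ0 : ∀ f ∈ homogeneousVec K n (Fin m) 0, φ f = 0 → f = 0)
    (h : KoszulLinear (List.finRange n) H r (LinearMap.range φ)) :
    IsLinearSyzygy (LinearMap.ker φ) :=
  ⟨h.ker (List.nodup_finRange n) List.mem_finRange hH hφ,
    fun _ hf c => (hφ.vecComponent_mem_ker hH c).1 hf, hφ0⟩

/-- The degree-zero component of a syzygy vanishes, and the components of higher degree come from
degree one by linearity of the Koszul homology. -/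
theorem IsLinearSyzygy.span_eq {m : ℕ}
    {Z : Submodule (MvPolynomial (Fin n) K) (Fin m → MvPolynomial (Fin n) K)}
    (hZ : IsLinearSyzygy Z) : Submodule.span (MvPolynomial (Fin n) K)
      (gradedPiece (homogeneousVec K n (Fin m)) Z 1 : Set (Fin m → MvPolynomial (Fin n) K)) = Z := by
  refine le_antisymm (Submodule.span_le.2 fun f hf => hf.1) fun f hf => ?_
  obtain ⟨M, -, hM⟩ := exists_sum_vecComponent f 0
  rw [← hM]
  refine Submodule.sum_mem _ fun c _ => ?_
  rcases c with _ | c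
  · rw [hZ.2.2 _ (vecComponent_mem f) (hZ.2.1 f hf 0)]
    exact zero_mem _
  · exact hZ.1.mem_span (by omega) _ ⟨hZ.2.1 f hf _, vecComponent_mem f⟩

theorem IsLinearSyzygy.exists_cover {m : ℕ}
    {Z : Submodule (MvPolynomial (Fin n) K) (Fin m → MvPolynomial (Fin n) K)}
    (hZ : IsLinearSyzygy Z) : ∃ (m' : ℕ) (φ : (Fin m' → MvPolynomial (Fin n) K)
      →ₗ[MvPolynomial (Fin n) K] Fin m → MvPolynomial (Fin n) K),
      LinearMap.range φ = Z ∧ RaisesDegree (homogeneousVec K n (Fin m)) 1 φ ∧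
      IsLinearSyzygy (LinearMap.ker φ) := by
  obtain ⟨m', φ, hr, hφ, hφ0⟩ := (isGrading_homogeneousVec (K := K) (n := n) (Fin m)).exists_cover 1 Z
  rw [hZ.span_eq] at hr
  exact ⟨m', φ, hr, hφ, isLinearSyzygy_ker (isGrading_homogeneousVec _) hφ hφ0 (hr ▸ hZ.1)⟩

theorem IsHomogeneousVec.map_const {κ κ' : Type} {r s : ℕ}
    {φ : (κ → MvPolynomial (Fin n) K) →ₗ[MvPolynomial (Fin n) K] κ' → MvPolynomial (Fin n) K}
    (hφ : RaisesDegree (homogeneousVec K n κ') r φ) (j : ℕ) (f : κ → MvPolynomial (Fin n) K)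
    (hf : IsHomogeneousVec (fun _ => s + r) j f) : IsHomogeneousVec (fun _ => s) j (φ f) := by
  by_cases h0 : f = 0
  · rw [h0, map_zero]
    intro k m hm
    simp at hm
  · have hj : s + r ≤ j := by
      by_contra hlt
      refine h0 (_root_.funext fun k => ?_)
      by_contra hk
      obtain ⟨m, hm⟩ := (support_nonempty (p := f k)).2 hk
      have : m.degree + (s + r) = j := hf k m hm
      omega
    obtain ⟨c, rfl⟩ : ∃ c, j = c + (s + r) := ⟨j - (s + r), by omega⟩
    have := mem_homogeneousVec_iff (r := s).1 (hφ c f (mem_homogeneousVec_iff.2 hf))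
    rwa [show c + (s + r) = c + r + s by omega]

/-- Linear Koszul homology implies a linear resolution. -/
theorem KoszulLinear.hasLinearResolution {I : Ideal (MvPolynomial (Fin n) K)} {e : ℕ}
    (h : KoszulLinear (List.finRange n) (homogeneousSubmodule (Fin n) K) e I)
    (hI : Ideal.span (gradedPiece (homogeneousSubmodule (Fin n) K) I e :
      Set (MvPolynomial (Fin n) K)) = I) : HasLinearResolutionOfDegree I e := by
  obtain ⟨m, aug, hr, haug, haug0⟩ :=
    (isGrading_homogeneousSubmodule (K := K) (n := n)).exists_cover e I
  have hr' : LinearMap.range aug = I := hr.trans hI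
  -- The state of the recursion is a rank together with a linear syzygy module in the free module of
  -- that rank.
  have step : ∀ s : (Σ m, {Z : Submodule (MvPolynomial (Fin n) K) (Fin m → MvPolynomial (Fin n) K) //
      IsLinearSyzygy Z}), ∃ s' : (Σ m, {Z : Submodule (MvPolynomial (Fin n) K)
        (Fin m → MvPolynomial (Fin n) K) // IsLinearSyzygy Z}),
      ∃ φ : (Fin s'.1 → MvPolynomial (Fin n) K) →ₗ[MvPolynomial (Fin n) K]
        Fin s.1 → MvPolynomial (Fin n) K,
      LinearMap.range φ = s.2.1 ∧ RaisesDegree (homogeneousVec K n (Fin s.1)) 1 φ ∧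
        LinearMap.ker φ = s'.2.1 := fun s => by
    obtain ⟨m', φ, h1, h2, h3⟩ := s.2.2.exists_cover
    exact ⟨⟨m', _, h3⟩, φ, h1, h2, rfl⟩
  choose next φ hφ using step
  let s₀ : (Σ m, {Z : Submodule (MvPolynomial (Fin n) K) (Fin m → MvPolynomial (Fin n) K) //
      IsLinearSyzygy Z}) :=
    ⟨m, LinearMap.ker aug, isLinearSyzygy_ker isGrading_homogeneousSubmodule haug haug0 (hr' ▸ h)⟩
  let s : ℕ → (Σ m, {Z : Submodule (MvPolynomial (Fin n) K) (Fin m → MvPolynomial (Fin n) K) //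
      IsLinearSyzygy Z}) := fun i => Nat.rec s₀ (fun _ => next) i
  refine ⟨{
    ι := fun i => Fin (s i).1
    finite_ι := fun i => inferInstance
    deg := fun i _ => e + i
    diff := fun i => φ (s i)
    aug := aug
    diff_homogeneous := fun i j f hf => IsHomogeneousVec.map_const (hφ (s i)).2.1 j f hf
    aug_homogeneous := fun j f hf => ?_
    range_aug := hr'
    exact_zero := LinearMap.exact_iff.2 (hφ s₀).1.symm
    exact_succ := fun i => LinearMap.exact_iff.2 ((hφ (s i)).2.2.trans (hφ (s (i + 1))).1.symm) },
    fun i f k => (hφ (s i)).2.1.constantCoeff_eq_zero f k, fun i j hj => ?_⟩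
  · by_cases h0 : f = 0
    · rw [h0, map_zero]; exact isHomogeneous_zero _ _ _
    · have hj : e ≤ j := by
        by_contra hlt
        refine h0 (_root_.funext fun k => ?_)
        by_contra hk
        obtain ⟨m, hm⟩ := (support_nonempty (p := f k)).2 hk
        have : m.degree + (e + 0) = j := hf k m hm
        omega
      obtain ⟨c, rfl⟩ : ∃ c, j = c + e := ⟨j - e, by omega⟩
      exact haug c f (mem_homogeneousVec_iff.2 hf)
  · have : IsEmpty {k : Fin (s i).1 // e + i = j} := ⟨fun k => hj k.2.symm⟩
    exact Nat.card_of_isEmpty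

/-- A linear resolution implies linear Koszul homology. -/
theorem HasLinearResolutionOfDegree.koszulLinear {I : Ideal (MvPolynomial (Fin n) K)} {e : ℕ}
    (h : HasLinearResolutionOfDegree I e) {vs : List (Fin n)} (hvs : vs.Nodup)
    (hvs' : ∀ v, v ∈ vs) : KoszulLinear vs (homogeneousSubmodule (Fin n) K) e I ∧
      ∀ c, ∀ f ∈ I, f.IsHomogeneous c → f ≠ 0 → e ≤ c := by
  obtain ⟨F, -, hF⟩ := h
  have hfin := F.finite_ι
  have hdeg : ∀ i, F.deg i = fun _ => e + i := fun i => _root_.funext fun k => by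
    by_contra hne
    have h1 := hF i _ hne
    rw [GradedFreeResolution.betti, Nat.card_eq_zero] at h1
    -- `Nat.card` also vanishes on infinite types, so finiteness of the rank has to be used.
    rcases h1 with h1 | h1
    · exact h1.elim ⟨k, rfl⟩
    · exact not_finite_iff_infinite.2 h1 inferInstance
  have haug : RaisesDegree (homogeneousSubmodule (Fin n) K) e F.aug := fun c f hf =>
    F.aug_homogeneous _ f (by rw [hdeg 0]; exact mem_homogeneousVec_iff.1 hf)
  have hdiff : ∀ i, RaisesDegree (homogeneousVec K n (F.ι i)) 1 (F.diff i) := fun i c f hf => by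
    have h1 := F.diff_homogeneous i (c + (e + (i + 1))) f
      (by rw [hdeg (i + 1)]; exact mem_homogeneousVec_iff.1 hf)
    rw [hdeg i, show c + (e + (i + 1)) = c + 1 + (e + i) by omega] at h1
    exact mem_homogeneousVec_iff.2 h1
  -- Each step in `i` moves one place up the resolution, hence all `l` at once. Once the truncation
  -- exceeds the number of variables it is vacuous, so the resolution need not be finite.
  have key : ∀ i l, KoszulLinearBelow vs (homogeneousVec K n (F.ι l)) 1 i
      (LinearMap.range (F.diff l)) := by
    intro i
    induction i with
    | zero => exact fun l => koszulLinearBelow_zero _ _ _ _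
    | succ i ih =>
      intro l
      refine KoszulLinearBelow.range hvs hvs' (isGrading_homogeneousVec _) (hdiff l) ?_
      rw [LinearMap.exact_iff.1 (F.exact_succ l)]
      exact ih (l + 1)
  refine ⟨?_, fun c f hf hfc hf0 => ?_⟩
  · refine KoszulLinearBelow.koszulLinear ?_
    rw [← F.range_aug]
    refine KoszulLinearBelow.range hvs hvs' isGrading_homogeneousSubmodule haug ?_
    rw [LinearMap.exact_iff.1 F.exact_zero]
    exact key _ 0
  · by_contra hlt
    rw [← F.range_aug] at hf
    obtain ⟨g, rfl⟩ := hf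
    obtain ⟨p, hp, hp'⟩ := (isGrading_homogeneousSubmodule (K := K) (n := n)).exists_proj
    obtain ⟨M, -, hM⟩ := exists_sum_vecComponent g 0
    apply hf0
    rw [← hp c _ hfc, ← hM, map_sum, map_sum]
    exact Finset.sum_eq_zero fun c' _ => hp' _ _ _ (haug c' _ (vecComponent_mem g)) (by omega)

end

/-! ### A nontrivial homology class in a scalar complex -/

/-- A scalar Koszul chain is supported on `U`: its coefficient at `e_τ` vanishes unless `U` holds
for the complement of `τ`. -/
def Kos.Supported {α : Type*} (K : Type*) [AddCommGroup K] :
    ∀ (_ : List α → Prop) (vs : List α), AddSubgroup (Kos K vs)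
  | U, [] => ({ carrier := {a : K | ¬ U [] → a = 0}
                zero_mem' := fun _ => rfl
                add_mem' := fun ha hb h => by rw [ha h, hb h, add_zero]
                neg_mem' := fun ha h => by rw [ha h, neg_zero] } : AddSubgroup K)
  | U, y :: vs => AddSubgroup.prod (Kos.Supported K (fun ρ => U (y :: ρ)) vs)
      (Kos.Supported K U vs)

section

variable {α : Type*} {K : Type*} [AddCommGroup K]

theorem Kos.mem_supported_cons {U : List α → Prop} {y : α} {vs : List α} {c : Kos K (y :: vs)} :
    c ∈ Kos.Supported K U (y :: vs) ↔
      Kos.fst c ∈ Kos.Supported K (fun ρ => U (y :: ρ)) vs ∧ Kos.snd c ∈ Kos.Supported K U vs :=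
  AddSubgroup.mem_prod

theorem Kos.supported_mono : ∀ {vs : List α} {U U' : List α → Prop}
    (_ : ∀ ρ, ρ.Sublist vs → U ρ → U' ρ) {c : Kos K vs}, c ∈ Kos.Supported K U vs →
    c ∈ Kos.Supported K U' vs
  | [], _, _, h, _, hc => fun h' => hc fun hU => h' (h [] (List.Sublist.refl _) hU)
  | y :: _, _, _, h, _, hc => Kos.mem_supported_cons.2
      ⟨Kos.supported_mono (fun ρ hρ => h (y :: ρ) (hρ.cons_cons y)) (Kos.mem_supported_cons.1 hc).1,
        Kos.supported_mono (fun ρ hρ => h ρ (hρ.cons y)) (Kos.mem_supported_cons.1 hc).2⟩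

theorem Kos.eq_zero_of_supported : ∀ {vs : List α} {U : List α → Prop}
    (_ : ∀ ρ, ρ.Sublist vs → ¬ U ρ) {c : Kos K vs}, c ∈ Kos.Supported K U vs → c = 0
  | [], _, h, _, hc => hc (h [] (List.Sublist.refl _))
  | y :: _, _, h, _, hc => Kos.ext
      (Kos.eq_zero_of_supported (fun ρ hρ => h (y :: ρ) (hρ.cons_cons y))
        (Kos.mem_supported_cons.1 hc).1)
      (Kos.eq_zero_of_supported (fun ρ hρ => h ρ (hρ.cons y)) (Kos.mem_supported_cons.1 hc).2)

theorem Kos.supported_inf : ∀ {vs : List α} {U U' : List α → Prop} {c : Kos K vs},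
    c ∈ Kos.Supported K U vs → c ∈ Kos.Supported K U' vs →
    c ∈ Kos.Supported K (fun ρ => U ρ ∧ U' ρ) vs
  | [], U, _, _, h, h' => fun hn => by
    by_cases hU : U []
    · exact h' fun hU' => hn ⟨hU, hU'⟩
    · exact h hU
  | _ :: _, _, _, _, h, h' => Kos.mem_supported_cons.2
      ⟨Kos.supported_inf (Kos.mem_supported_cons.1 h).1 (Kos.mem_supported_cons.1 h').1,
        Kos.supported_inf (Kos.mem_supported_cons.1 h).2 (Kos.mem_supported_cons.1 h').2⟩

theorem Kos.exists_add_of_supported : ∀ {vs : List α} {U U₁ U₂ : List α → Prop}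
    (_ : ∀ ρ, ρ.Sublist vs → U ρ → U₁ ρ ∨ U₂ ρ) {c : Kos K vs}, c ∈ Kos.Supported K U vs →
    ∃ a ∈ Kos.Supported K U₁ vs, ∃ b ∈ Kos.Supported K U₂ vs, a + b = c
  | [], U, U₁, U₂, h, c, hc => by
    by_cases h1 : U₁ []
    · exact ⟨c, fun h' => absurd h1 h', 0, zero_mem _, add_zero c⟩
    · exact ⟨0, zero_mem _, c, fun h' => hc fun hU => (h [] (List.Sublist.refl _) hU).elim h1 h',
        zero_add c⟩
  | y :: vs, U, U₁, U₂, h, c, hc => by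
    obtain ⟨a, ha, b, hb, hab⟩ := Kos.exists_add_of_supported
      (fun ρ hρ => h (y :: ρ) (hρ.cons_cons y)) (Kos.mem_supported_cons.1 hc).1
    obtain ⟨a', ha', b', hb', hab'⟩ := Kos.exists_add_of_supported
      (fun ρ hρ => h ρ (hρ.cons y)) (Kos.mem_supported_cons.1 hc).2
    exact ⟨Kos.mk y a a', Kos.mem_supported_cons.2 ⟨ha, ha'⟩, Kos.mk y b b',
      Kos.mem_supported_cons.2 ⟨hb, hb'⟩, Kos.ext hab hab'⟩

/-- The differential removes a factor e_v and so enlarges the complement, which an upward closed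
condition survives. -/
theorem Kos.d_mem_supported {vs : List α} {U : List α → Prop}
    (hU : ∀ ρ ρ', ρ.Sublist ρ' → U ρ → U ρ') {c : Kos K vs} (hc : c ∈ Kos.Supported K U vs) :
    Kos.d (fun _ => AddMonoidHom.id K) vs c ∈ Kos.Supported K U vs := by
  induction vs generalizing U with
  | nil => exact zero_mem _
  | cons y vs ih =>
    have h := Kos.mem_supported_cons.1 hc
    refine Kos.mem_supported_cons.2 ⟨add_mem (ih (fun ρ ρ' hρ => hU _ _ (hρ.cons_cons y)) h.1) ?_,
      neg_mem (ih hU h.2)⟩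
    change Kos.map (AddMonoidHom.id K) vs (Kos.snd c) ∈ _
    rw [Kos.map_id]
    exact Kos.supported_mono (fun ρ _ => hU _ _ (List.sublist_cons_self y ρ)) h.2

theorem Kos.ofBase_mem_supported (a : K) : ∀ {vs : List α} {U : List α → Prop} (_ : U vs),
    Kos.ofBase a vs ∈ Kos.Supported K U vs
  | [], _, h => fun h' => absurd h h'
  | _ :: _, _, h => Kos.mem_supported_cons.2 ⟨Kos.ofBase_mem_supported a h, zero_mem _⟩

/-- A chain supported on the full list is a cycle. -/
theorem Kos.d_eq_zero_of_supported : ∀ {vs : List α} {U : List α → Prop}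
    (_ : ∀ ρ, ρ.Sublist vs → U ρ → ρ = vs) {c : Kos K vs}, c ∈ Kos.Supported K U vs →
    Kos.d (fun _ => AddMonoidHom.id K) vs c = 0
  | [], _, _, _, _ => rfl
  | y :: vs, U, h, c, hc => by
    have h1 := Kos.mem_supported_cons.1 hc
    have h2 : Kos.snd c = 0 := Kos.eq_zero_of_supported (fun ρ hρ hU => by
      have h3 := congrArg List.length (h ρ (hρ.cons y) hU)
      have h4 := hρ.length_le
      simp at h3
      omega) h1.2
    refine Kos.ext ?_ ?_
    · rw [Kos.fst_d, h2, map_zero, add_zero, map_zero]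
      exact Kos.d_eq_zero_of_supported
        (fun ρ hρ hU => (List.cons.inj (h (y :: ρ) (hρ.cons_cons y) hU)).2) h1.1
    · rw [Kos.snd_d, h2, map_zero, neg_zero, map_zero]

end

/-- `L` is composed of blocks `p < q` and `p = q`; the lists `P` and `Q` consist of the smaller and
of the larger elements of the blocks. -/
inductive Blocks {α : Type*} [LinearOrder α] : List α → List α → List α → Prop
  | nil : Blocks [] [] []
  | one (p : α) {P Q L : List α} : Blocks P Q L → Blocks (p :: P) (p :: Q) (p :: L)
  | two {p q : α} {P Q L : List α} : p < q → Blocks P Q L →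
      Blocks (p :: P) (q :: Q) (p :: q :: L)

/-- `l` contains exactly one element of every block. -/
inductive Transversal {α : Type*} : List α → List α → List α → Prop
  | nil : Transversal [] [] []
  | left (p q : α) {P Q l : List α} : Transversal P Q l → Transversal (p :: P) (q :: Q) (p :: l)
  | right (p q : α) {P Q l : List α} : Transversal P Q l → Transversal (p :: P) (q :: Q) (q :: l)

section

variable {α : Type*} [LinearOrder α] {P Q L : List α}

theorem Blocks.length_eq (h : Blocks P Q L) : P.length = Q.length := by
  induction h with
  | nil => rfl
  | one _ _ ih => simp [ih]
  | two _ _ ih => simp [ih]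

theorem Blocks.eq_or_lt (h : Blocks P Q L) : P = Q ∨ P < Q := by
  induction h with
  | nil => exact Or.inl rfl
  | one p _ ih =>
    exact ih.imp (congrArg _) fun h => List.cons_lt_cons_iff.2 (Or.inr ⟨rfl, h⟩)
  | two hpq _ _ => exact Or.inr (List.cons_lt_cons_iff.2 (Or.inl hpq))

theorem Blocks.eq_of_eq (h : Blocks P Q L) (hPQ : P = Q) : L = P := by
  induction h with
  | nil => rfl
  | one p _ ih => rw [ih (List.cons.inj hPQ).2]
  | two hpq _ _ => exact absurd (List.cons.inj hPQ).1 hpq.ne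

theorem Blocks.transversal_left (h : Blocks P Q L) : Transversal P Q P := by
  induction h with
  | nil => exact .nil
  | one p _ ih => exact .left _ _ ih
  | two _ _ ih => exact .left _ _ ih

/-- `L` contains a list of the length of `Q` below `Q`. -/
def HasBelow (Q ρ : List α) : Prop := ∃ a, a.Sublist ρ ∧ a.length = Q.length ∧ a < Q

/-- `L` contains a list of the length of `P` above `P`. -/
def HasAbove (P ρ : List α) : Prop := ∃ b, b.Sublist ρ ∧ b.length = P.length ∧ P < b

theorem HasBelow.mono {ρ ρ' : List α} (h : ρ.Sublist ρ') : HasBelow Q ρ → HasBelow Q ρ' :=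
  fun ⟨a, ha, h'⟩ => ⟨a, ha.trans h, h'⟩

theorem HasAbove.mono {ρ ρ' : List α} (h : ρ.Sublist ρ') : HasAbove P ρ → HasAbove P ρ' :=
  fun ⟨a, ha, h'⟩ => ⟨a, ha.trans h, h'⟩

/-- `ρ` has one element more than a transversal, and contains transversals different from `P` and
from `Q`. -/
def HasTransversals (P Q ρ : List α) : Prop :=
  ρ.length = P.length + 1 ∧ (∃ l, l.Sublist ρ ∧ Transversal P Q l ∧ l ≠ P) ∧
    ∃ l, l.Sublist ρ ∧ Transversal P Q l ∧ l ≠ Q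

theorem hasBelow_or_hasAbove {ρ b : List α} (hPQ : P < Q) (hlen : P.length = Q.length)
    (hb : b.Sublist ρ) (hbl : b.length = P.length) : HasBelow Q ρ ∨ HasAbove P ρ := by
  by_cases h : b < Q
  · exact Or.inl ⟨b, hb, hbl.trans hlen, h⟩
  · exact Or.inr ⟨b, hb, hbl, lt_of_lt_of_le hPQ (not_lt.1 h)⟩

theorem not_hasBelow {q : α} {ρ : List α} (h : ∀ x ∈ ρ, q < x) : ¬ HasBelow (q :: Q) ρ := by
  rintro ⟨_ | ⟨x, a⟩, ha, hl, hlt⟩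
  · simp at hl
  · rcases List.cons_lt_cons_iff.1 hlt with h1 | ⟨h1, -⟩
    · exact absurd h1 (h x (ha.subset List.mem_cons_self)).not_gt
    · exact absurd (h x (ha.subset List.mem_cons_self)) (h1 ▸ lt_irrefl _)

/-- The head of P is the least element of L, and the head of b exceeds x, so the comparison is
decided at the first entry. -/
theorem Blocks.lt_tail (hB : Blocks P Q L) (hL : L.Pairwise (· < ·)) (hP : P ≠ []) {x : α}
    {b : List α} (hb : (x :: b).Sublist L) (hl : b.length = P.length) : P < b := by
  have hb' := hL.sublist hb
  rcases b with _ | ⟨y, b⟩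
  · exact absurd (List.length_eq_zero_iff.1 hl.symm) hP
  have hxy : x < y := (List.pairwise_cons.1 hb').1 y List.mem_cons_self
  have hx : x ∈ L := hb.subset List.mem_cons_self
  cases hB with
  | nil => exact absurd rfl hP
  | one p h =>
    refine List.cons_lt_cons_iff.2 (Or.inl (lt_of_le_of_lt ?_ hxy))
    rcases List.mem_cons.1 hx with rfl | hx
    · exact le_rfl
    · exact ((List.pairwise_cons.1 hL).1 x hx).le
  | two hpq h =>
    refine List.cons_lt_cons_iff.2 (Or.inl (lt_of_le_of_lt ?_ hxy))
    rcases List.mem_cons.1 hx with rfl | hx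
    · exact le_rfl
    · exact ((List.pairwise_cons.1 hL).1 x hx).le

/-- A list that avoids p has one entry to spare; without its first entry it is still above P by
`Blocks.lt_tail`. -/
theorem Blocks.hasAbove_of_cons (hB : Blocks P Q L) (hL : L.Pairwise (· < ·)) (hP : P ≠ [])
    {p : α} {ρ : List α} (hρ : ρ.Sublist L) (h : HasAbove (p :: P) (p :: ρ)) : HasAbove P ρ := by
  obtain ⟨b, hb, hl, hlt⟩ := h
  rcases List.sublist_cons_iff.1 hb with hb | ⟨b, rfl, hb'⟩
  · rcases b with _ | ⟨x, b⟩
    · simp at hl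
    · refine ⟨b, (List.sublist_cons_self x b).trans hb, by simpa using hl, ?_⟩
      exact hB.lt_tail hL hP (hb.trans hρ) (by simpa using hl)
  · rcases List.cons_lt_cons_iff.1 hlt with h1 | ⟨-, h1⟩
    · exact absurd h1 (lt_irrefl _)
    · exact ⟨b, hb', by simpa using hl, h1⟩

theorem hasBelow_of_cons {q : α} {ρ : List α} (h : ∀ x ∈ ρ, q < x)
    (hb : HasBelow (q :: Q) (q :: ρ)) : HasBelow Q ρ := by
  obtain ⟨b, hb, hl, hlt⟩ := hb
  rcases List.sublist_cons_iff.1 hb with hb | ⟨b, rfl, hb'⟩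
  · exact absurd ⟨b, hb, hl, hlt⟩ (not_hasBelow h)
  · rcases List.cons_lt_cons_iff.1 hlt with h1 | ⟨-, h1⟩
    · exact absurd h1 (lt_irrefl _)
    · exact ⟨b, hb', by simpa using hl, h1⟩

omit [LinearOrder α] in
theorem Transversal.length_eq {l : List α} (h : Transversal P Q l) : l.length = P.length := by
  induction h with
  | nil => rfl
  | left _ _ _ ih => simp [ih]
  | right _ _ _ ih => simp [ih]

omit [LinearOrder α] in
theorem HasTransversals.cons {ρ : List α} (h : HasTransversals P Q ρ) (p : α) :
    HasTransversals (p :: P) (p :: Q) (p :: ρ) := by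
  obtain ⟨h1, ⟨l, h2, h3, h4⟩, l', h5, h6, h7⟩ := h
  exact ⟨by simp [h1], ⟨p :: l, h2.cons_cons p, .left _ _ h3, by simp [h4]⟩,
    p :: l', h5.cons_cons p, .left _ _ h6, by simp [h7]⟩

theorem HasTransversals.cons_left {ρ : List α} (h : HasTransversals P Q ρ) {p q : α}
    (hpq : p < q) : HasTransversals (p :: P) (q :: Q) (p :: ρ) := by
  obtain ⟨h1, ⟨l, h2, h3, h4⟩, -⟩ := h
  exact ⟨by simp [h1], ⟨p :: l, h2.cons_cons p, .left _ _ h3, by simp [h4]⟩,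
    p :: l, h2.cons_cons p, .left _ _ h3, by simp [hpq.ne]⟩

theorem HasTransversals.cons_right {ρ : List α} (h : HasTransversals P Q ρ) {p q : α}
    (hpq : p < q) : HasTransversals (p :: P) (q :: Q) (q :: ρ) := by
  obtain ⟨h1, -, l', h5, h6, h7⟩ := h
  exact ⟨by simp [h1], ⟨q :: l', h5.cons_cons q, .right _ _ h6, by simp [hpq.ne']⟩,
    q :: l', h5.cons_cons q, .right _ _ h6, by simp [h7]⟩

/-- A cycle on `L` that is supported on unions of transversals but is not a boundary of a chain
supported on the sets containing lists below `Q` and above `P`. -/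
theorem Blocks.exists_cycle {K : Type*} [Field K] (hB : Blocks P Q L) (hL : L.Pairwise (· < ·))
    (hPQ : P ≠ Q) : ∃ c ∈ Kos.Supported K (HasTransversals P Q) L,
      Kos.d (fun _ => AddMonoidHom.id K) L c = 0 ∧
      ∀ y ∈ Kos.Supported K (fun ρ => HasBelow Q ρ ∧ HasAbove P ρ) L,
        Kos.d (fun _ => AddMonoidHom.id K) L y ≠ c := by
  induction hB with
  | nil => exact absurd rfl hPQ
  | @one p P Q L hB ih =>
    have hL' := List.pairwise_cons.1 hL
    have hPQ' : P ≠ Q := fun h => hPQ (by rw [h])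
    have hP : P ≠ [] := by
      rintro rfl
      exact hPQ' (List.length_eq_zero_iff.1 hB.length_eq.symm).symm
    obtain ⟨c, hc, hdc, hcy⟩ := ih hL'.2 hPQ'
    refine ⟨Kos.mk p c 0, Kos.mem_supported_cons.2 ⟨?_, zero_mem _⟩, Kos.ext ?_ ?_,
      fun y hy hdy => ?_⟩
    · exact Kos.supported_mono (fun ρ _ h => h.cons p) hc
    · simp [hdc]
    · simp
    · have h := Kos.mem_supported_cons.1 hy
      have h2 : Kos.snd y = 0 := Kos.eq_zero_of_supported
        (fun ρ hρ hU => not_hasBelow (fun x hx => hL'.1 x (hρ.subset hx)) hU.1) h.2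
      refine hcy (Kos.fst y) (Kos.supported_mono (fun ρ hρ hU =>
        ⟨hasBelow_of_cons (fun x hx => hL'.1 x (hρ.subset hx)) hU.1,
          hB.hasAbove_of_cons hL'.2 hP hρ hU.2⟩) h.1) ?_
      · have h3 := congrArg Kos.fst hdy
        rwa [Kos.fst_d, h2, map_zero, add_zero] at h3
  | @two p q P Q L hpq hB ih =>
    have hL1 := List.pairwise_cons.1 hL
    have hL2 := List.pairwise_cons.1 hL1.2
    have hq : ∀ {ρ : List α}, ρ.Sublist L → ∀ x ∈ ρ, q < x := fun hρ x hx =>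
      hL2.1 x (hρ.subset hx)
    by_cases hPQ' : P = Q
    · obtain rfl : L = P := hB.eq_of_eq hPQ'
      subst hPQ'
      -- This is the last two-element block. No proper sublist contains both a list below Q and a
      -- list above P, so an admissible y lives on the full list and has boundary zero.
      refine ⟨Kos.ofBase 1 _, Kos.ofBase_mem_supported _ ⟨by simp, ?_, ?_⟩, Kos.d_ofBase _ _ _,
        fun y hy hdy => ?_⟩
      · exact ⟨q :: L, List.sublist_cons_self _ _, .right _ _ hB.transversal_left, by
          simp [hpq.ne']⟩
      · exact ⟨p :: L, (List.sublist_cons_self q L).cons_cons p, .left _ _ hB.transversal_left, by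
          simp [hpq.ne]⟩
      · rw [Kos.d_eq_zero_of_supported ?_ hy] at hdy
        · have h1 := congrArg Kos.base hdy
          rw [Kos.base_ofBase, Kos.base_zero] at h1
          exact zero_ne_one h1
        · rintro ρ hρ ⟨h1, h2⟩
          rcases List.sublist_cons_iff.1 hρ with hρ | ⟨ρ, rfl, hρ₁⟩
          · rcases List.sublist_cons_iff.1 hρ with hρ | ⟨ρ, rfl, hρ'⟩
            · exact absurd h1 (not_hasBelow (hq hρ))
            · obtain ⟨a, ha, hl, hlt⟩ := hasBelow_of_cons (hq hρ') h1
              rw [(ha.trans hρ').eq_of_length hl] at hlt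
              exact absurd hlt (lt_irrefl _)
          · obtain ⟨b, hb, hl, hlt⟩ := h2
            rw [List.length_cons] at hl
            rcases List.sublist_cons_iff.1 hb with hb | ⟨b, rfl, hb₁⟩
            · rw [hρ₁.eq_of_length_le (by have := hb.length_le; simp at this ⊢; omega)]
            · rcases List.cons_lt_cons_iff.1 hlt with h1 | ⟨-, hlt⟩
              · exact absurd h1 (lt_irrefl _)
              rw [List.length_cons, Nat.add_right_cancel_iff] at hl
              rcases List.sublist_cons_iff.1 hρ₁ with hρ₂ | ⟨ρ, rfl, hρ₂⟩
              · rw [(hb₁.trans hρ₂).eq_of_length hl] at hlt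
                exact absurd hlt (lt_irrefl _)
              · rcases List.sublist_cons_iff.1 hb₁ with hb₂ | ⟨b, rfl, hb₂⟩
                · rw [(hb₂.trans hρ₂).eq_of_length hl] at hlt
                  exact absurd hlt (lt_irrefl _)
                · rcases L with _ | ⟨x, L⟩
                  · simp at hl
                  · have hqx : q < x := hL2.1 x List.mem_cons_self
                    rcases List.cons_lt_cons_iff.1 hlt with h1 | ⟨h1, -⟩
                    · exact absurd h1 hqx.not_gt
                    · exact absurd h1 hqx.ne'
    · have hlt : P < Q := hB.eq_or_lt.resolve_left hPQ'
      have hP : P ≠ [] := by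
        rintro rfl
        exact hPQ' (List.length_eq_zero_iff.1 hB.length_eq.symm).symm
      obtain ⟨c, hc, hdc, hcy⟩ := ih hL2.2 hPQ'
      -- The inductive cycle is multiplied by the Koszul relation x_p e_q - x_q e_p of the new
      -- block.
      refine ⟨Kos.mk p (Kos.mk q 0 c) (Kos.mk q (-c) 0), ?_, ?_, fun y hy hdy => ?_⟩
      · exact Kos.mem_supported_cons.2 ⟨Kos.mem_supported_cons.2 ⟨zero_mem _,
          Kos.supported_mono (fun ρ _ h => h.cons_left hpq) hc⟩, Kos.mem_supported_cons.2
          ⟨neg_mem (Kos.supported_mono (fun ρ _ h => h.cons_right hpq) hc), zero_mem _⟩⟩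
      · have hid : ∀ {vs : List α} (c : Kos K vs), Kos.map (AddMonoidHom.id K) vs c = c :=
          Kos.map_id
        refine Kos.ext (Kos.ext ?_ ?_) (Kos.ext ?_ ?_) <;> simp [hid, hdc]
      · obtain ⟨hy1, hy2⟩ := Kos.mem_supported_cons.1 hy
        obtain ⟨hy11, hy12⟩ := Kos.mem_supported_cons.1 hy1
        obtain ⟨hy21, hy22⟩ := Kos.mem_supported_cons.1 hy2
        have h22 : Kos.snd (Kos.snd y) = 0 := Kos.eq_zero_of_supported
          (fun ρ hρ hU => not_hasBelow (hq hρ) hU.1) hy22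
        have hid : ∀ {vs : List α} (c : Kos K vs), Kos.map (AddMonoidHom.id K) vs c = c :=
          Kos.map_id
        have e1 := congrArg (fun z => Kos.fst (Kos.fst z)) hdy
        have e2 := congrArg (fun z => Kos.fst (Kos.snd z)) hdy
        simp [hid, h22] at e1 e2
        have hb := Kos.supported_mono (U' := HasAbove P)
          (fun ρ hρ hU => hB.hasAbove_of_cons hL2.2 hP hρ hU.2) hy12
        have ha := Kos.supported_mono (U' := HasBelow Q)
          (fun ρ hρ hU => hasBelow_of_cons (hq hρ) hU.1) hy21
        have hor : ∀ ρ, ρ.Sublist L → HasBelow (q :: Q) (p :: q :: ρ) ∧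
            HasAbove (p :: P) (p :: q :: ρ) → HasBelow Q ρ ∨ HasAbove P ρ := by
          intro ρ hρ hU
          obtain ⟨b, hb, hl, hlt'⟩ := hU.2
          have hsub : ∀ {b : List α}, b.Sublist ρ → P.length ≤ b.length →
              HasBelow Q ρ ∨ HasAbove P ρ := fun {b} hb hl =>
            hasBelow_or_hasAbove hlt hB.length_eq ((List.take_sublist P.length b).trans hb)
              (by simp [hl])
          rw [List.length_cons] at hl
          rcases List.sublist_cons_iff.1 hb with hb | ⟨b, rfl, hb₁⟩
          · rcases List.sublist_cons_iff.1 hb with hb | ⟨b, rfl, hb₁⟩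
            · exact hsub hb (by omega)
            · exact hsub hb₁ (by simp at hl; omega)
          · rcases List.cons_lt_cons_iff.1 hlt' with h1 | ⟨-, hlt'⟩
            · exact absurd h1 (lt_irrefl _)
            rcases List.sublist_cons_iff.1 hb₁ with hb₂ | ⟨b, rfl, hb₂⟩
            · exact hsub hb₂ (by simp at hl; omega)
            · rcases P with _ | ⟨x, P⟩
              · exact absurd rfl hP
              · have hqx : q < x := by
                  refine hL2.1 x ?_
                  cases hB <;> exact List.mem_cons_self
                rcases List.cons_lt_cons_iff.1 hlt' with h1 | ⟨h1, -⟩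
                · exact absurd h1 hqx.not_gt
                · exact absurd h1 hqx.ne'
        obtain ⟨a, ha', b, hb', hab⟩ := Kos.exists_add_of_supported hor hy11
        -- Write y = y₁₁ + e_q y₁₂ + e_p y₂₁. Then y₂₁ has boundary c and is supported below Q, y₁₂
        -- is supported above P, and y₁₁ splits into parts a and b of either kind. Hence y₂₁ + d a =
        -- -(y₁₂ + d b) has both supports and boundary c, contradicting the induction hypothesis.
        have h3 : Kos.fst (Kos.snd y) + Kos.d (fun _ => AddMonoidHom.id K) L a =
            -(Kos.snd (Kos.fst y) + Kos.d (fun _ => AddMonoidHom.id K) L b) := by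
          rw [eq_neg_iff_add_eq_zero, ← e1, ← hab, map_add]
          abel
        refine hcy (Kos.fst (Kos.snd y) + Kos.d (fun _ => AddMonoidHom.id K) L a)
          (Kos.supported_inf ?_ ?_) ?_
        · exact add_mem ha (Kos.d_mem_supported (fun _ _ => HasBelow.mono) ha')
        · rw [h3]
          exact neg_mem (add_mem hb (Kos.d_mem_supported (fun _ _ => HasAbove.mono) hb'))
        · rw [map_add, Kos.d_d (fun _ _ _ => rfl), add_zero, e2]

end

/-! ### Scalar chains and Koszul chains of an ideal -/

/-- The exponent vector of the product of the variables in a list. -/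
noncomputable def listExp {n : ℕ} (l : List (Fin n)) : Fin n →₀ ℕ :=
  (l.map fun v => Finsupp.single v 1).sum

theorem listExp_cons {n : ℕ} (v : Fin n) (l : List (Fin n)) :
    listExp (v :: l) = Finsupp.single v 1 + listExp l := by
  simp [listExp]

theorem listExp_apply_eq_zero {n : ℕ} {v : Fin n} : ∀ {l : List (Fin n)} (_ : v ∉ l),
    listExp l v = 0
  | [], _ => rfl
  | w :: l, h => by
    rw [List.mem_cons, not_or] at h
    rw [listExp_cons, Finsupp.add_apply, listExp_apply_eq_zero h.2,
      Finsupp.single_eq_of_ne h.1]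

theorem listExp_apply_ne_zero {n : ℕ} {v : Fin n} : ∀ {l : List (Fin n)}, v ∈ l → listExp l v ≠ 0
  | w :: l, h => by
    rw [listExp_cons, Finsupp.add_apply]
    rcases List.mem_cons.1 h with rfl | h
    · simp
    · have := listExp_apply_ne_zero h
      omega

theorem degree_listExp {n : ℕ} (l : List (Fin n)) : (listExp l).degree = l.length := by
  induction l with
  | nil => simp [listExp]
  | cons v l ih => rw [listExp_cons, map_add, ih, Finsupp.degree_single, List.length_cons, add_comm]

section

variable {n : ℕ} {K : Type*} [Field K]

/-- The Koszul chain of the polynomial ring that is given by a scalar chain, in the multidegree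
`acc` plus the sum of all variables of the list. -/
noncomputable def Kos.lift (acc : Fin n →₀ ℕ) : ∀ vs : List (Fin n),
    Kos K vs →+ Kos (MvPolynomial (Fin n) K) vs
  | [] => (monomial acc : K →ₗ[K] MvPolynomial (Fin n) K).toAddMonoidHom
  | v :: vs => AddMonoidHom.prodMap (Kos.lift (acc + Finsupp.single v 1) vs) (Kos.lift acc vs)

/-- The component of a chain in the multidegree `acc` plus the sum of all variables of the list. -/
noncomputable def Kos.proj (acc : Fin n →₀ ℕ) : ∀ vs : List (Fin n),
    Kos (MvPolynomial (Fin n) K) vs →+ Kos K vs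
  | [] => (lcoeff K acc : MvPolynomial (Fin n) K →ₗ[K] K).toAddMonoidHom
  | v :: vs => AddMonoidHom.prodMap (Kos.proj (acc + Finsupp.single v 1) vs) (Kos.proj acc vs)

theorem Kos.fst_lift (acc : Fin n →₀ ℕ) {v : Fin n} {vs : List (Fin n)} (c : Kos K (v :: vs)) :
    Kos.fst (Kos.lift acc (v :: vs) c) = Kos.lift (acc + Finsupp.single v 1) vs (Kos.fst c) := rfl

theorem Kos.snd_lift (acc : Fin n →₀ ℕ) {v : Fin n} {vs : List (Fin n)} (c : Kos K (v :: vs)) :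
    Kos.snd (Kos.lift acc (v :: vs) c) = Kos.lift acc vs (Kos.snd c) := rfl

theorem Kos.fst_proj (acc : Fin n →₀ ℕ) {v : Fin n} {vs : List (Fin n)}
    (c : Kos (MvPolynomial (Fin n) K) (v :: vs)) :
    Kos.fst (Kos.proj acc (v :: vs) c) = Kos.proj (acc + Finsupp.single v 1) vs (Kos.fst c) := rfl

theorem Kos.snd_proj (acc : Fin n →₀ ℕ) {v : Fin n} {vs : List (Fin n)}
    (c : Kos (MvPolynomial (Fin n) K) (v :: vs)) :
    Kos.snd (Kos.proj acc (v :: vs) c) = Kos.proj acc vs (Kos.snd c) := rfl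

theorem Kos.map_varAct_lift (v : Fin n) : ∀ {vs : List (Fin n)} (acc : Fin n →₀ ℕ) (c : Kos K vs),
    Kos.map (varAct (K := K) (MvPolynomial (Fin n) K) v) vs (Kos.lift acc vs c) =
      Kos.lift (acc + Finsupp.single v 1) vs c
  | [], acc, c => by
    have h : ∀ a : K, X v • monomial acc a = monomial (acc + Finsupp.single v 1) a := fun a => by
      rw [smul_eq_mul, X, monomial_mul, one_mul, add_comm]
    exact h c
  | w :: vs, acc, c => Kos.ext
      (by rw [Kos.fst_map, Kos.fst_lift, Kos.fst_lift, Kos.map_varAct_lift v, add_right_comm])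
      (by rw [Kos.snd_map, Kos.snd_lift, Kos.snd_lift, Kos.map_varAct_lift v])

theorem Kos.d_lift : ∀ {vs : List (Fin n)} (acc : Fin n →₀ ℕ) (c : Kos K vs),
    Kos.d (varAct (K := K) (MvPolynomial (Fin n) K)) vs (Kos.lift acc vs c) =
      Kos.lift acc vs (Kos.d (fun _ => AddMonoidHom.id K) vs c)
  | [], acc, _ => (map_zero (Kos.lift acc [])).symm
  | v :: vs, acc, c => Kos.ext
      (by rw [Kos.fst_d, Kos.fst_lift, Kos.fst_lift, Kos.fst_d, Kos.snd_lift, map_add, Kos.map_id,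
        Kos.d_lift, Kos.map_varAct_lift])
      (by rw [Kos.snd_d, Kos.snd_lift, Kos.snd_lift, Kos.snd_d, map_neg, Kos.d_lift])

theorem Kos.proj_map_varAct (v : Fin n) : ∀ {vs : List (Fin n)} (acc : Fin n →₀ ℕ)
    (c : Kos (MvPolynomial (Fin n) K) vs),
    Kos.proj (acc + Finsupp.single v 1) vs
      (Kos.map (varAct (K := K) (MvPolynomial (Fin n) K) v) vs c) = Kos.proj acc vs c
  | [], acc, c => by
    have h : ∀ f : MvPolynomial (Fin n) K,
        coeff (acc + Finsupp.single v 1) (X v * f) = coeff acc f := fun f => by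
      rw [add_comm, coeff_X_mul]
    exact h c
  | w :: vs, acc, c => Kos.ext
      (by rw [Kos.fst_proj, Kos.fst_map, Kos.fst_proj, add_right_comm, Kos.proj_map_varAct v])
      (by rw [Kos.snd_proj, Kos.snd_map, Kos.snd_proj, Kos.proj_map_varAct v])

theorem Kos.proj_map_varAct_eq_zero {v : Fin n} : ∀ {vs : List (Fin n)} {acc : Fin n →₀ ℕ}
    (_ : acc v = 0) (_ : v ∉ vs) (c : Kos (MvPolynomial (Fin n) K) vs),
    Kos.proj acc vs (Kos.map (varAct (K := K) (MvPolynomial (Fin n) K) v) vs c) = 0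
  | [], acc, h, _, c => by
    have h' : ∀ f : MvPolynomial (Fin n) K, coeff acc (X v * f) = 0 := fun f => by
      rw [coeff_X_mul', if_neg (by simpa using h)]
    exact h' c
  | w :: vs, acc, h, hv, c => by
    rw [List.mem_cons, not_or] at hv
    refine Kos.ext ?_ ?_
    · rw [Kos.fst_proj, Kos.fst_map, Kos.proj_map_varAct_eq_zero _ hv.2, map_zero]
      rw [Finsupp.add_apply, h, Finsupp.single_eq_of_ne hv.1, add_zero]
    · rw [Kos.snd_proj, Kos.snd_map, Kos.proj_map_varAct_eq_zero h hv.2, map_zero]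

theorem Kos.proj_d : ∀ {vs : List (Fin n)} (acc : Fin n →₀ ℕ)
    (c : Kos (MvPolynomial (Fin n) K) vs),
    Kos.proj acc vs (Kos.d (varAct (K := K) (MvPolynomial (Fin n) K)) vs c) =
      Kos.d (fun _ => AddMonoidHom.id K) vs (Kos.proj acc vs c)
  | [], acc, _ => map_zero (Kos.proj acc [])
  | v :: vs, acc, c => Kos.ext
      (by rw [Kos.fst_d, Kos.fst_proj, Kos.fst_proj, Kos.fst_d, Kos.snd_proj, map_add, Kos.map_id,
        Kos.proj_d, Kos.proj_map_varAct])
      (by rw [Kos.snd_d, Kos.snd_proj, Kos.snd_proj, Kos.snd_d, map_neg, Kos.proj_d])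

theorem Kos.proj_lift : ∀ {vs : List (Fin n)} (acc : Fin n →₀ ℕ) (c : Kos K vs),
    Kos.proj acc vs (Kos.lift acc vs c) = c
  | [], acc, c => by
    have h : ∀ a : K, coeff acc (monomial acc a) = a := fun a => by rw [coeff_monomial, if_pos rfl]
    exact h c
  | v :: vs, acc, c => Kos.ext
      (by rw [Kos.fst_proj, Kos.fst_lift, Kos.proj_lift])
      (by rw [Kos.snd_proj, Kos.snd_lift, Kos.proj_lift])

theorem Kos.lift_mem_all {G : AddSubgroup (MvPolynomial (Fin n) K)} : ∀ {vs : List (Fin n)}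
    {U : List (Fin n) → Prop} {acc : Fin n →₀ ℕ}
    (_ : ∀ ρ, ρ.Sublist vs → U ρ → ∀ a, monomial (acc + listExp ρ) a ∈ G) {c : Kos K vs},
    c ∈ Kos.Supported K U vs → Kos.lift acc vs c ∈ Kos.All G vs
  | [], U, acc, h, c, hc => by
    by_cases hU : U []
    · have h' : ∀ a : K, monomial acc a ∈ G := fun a => by
        simpa [listExp] using h [] (List.Sublist.refl _) hU a
      exact h' c
    · have : c = 0 := hc hU
      rw [this, map_zero]
      exact zero_mem _
  | v :: vs, U, acc, h, c, hc => Kos.mem_all_cons.2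
      ⟨Kos.lift_mem_all (fun ρ hρ hU a => by
          rw [add_assoc, ← listExp_cons]; exact h (v :: ρ) (hρ.cons_cons v) hU a)
        (Kos.mem_supported_cons.1 hc).1,
      Kos.lift_mem_all (fun ρ hρ hU a => h ρ (hρ.cons v) hU a) (Kos.mem_supported_cons.1 hc).2⟩

theorem Kos.proj_mem_supported {G : AddSubgroup (MvPolynomial (Fin n) K)} :
    ∀ {vs : List (Fin n)} {U : List (Fin n) → Prop} {acc : Fin n →₀ ℕ}
    (_ : ∀ ρ, ρ.Sublist vs → ∀ f ∈ G, coeff (acc + listExp ρ) f ≠ 0 → U ρ)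
    {c : Kos (MvPolynomial (Fin n) K) vs}, c ∈ Kos.All G vs →
    Kos.proj acc vs c ∈ Kos.Supported K U vs
  | [], U, acc, h, c, hc => fun hU => by
    change coeff acc (c : MvPolynomial (Fin n) K) = 0
    by_contra hne
    exact hU (h [] (List.Sublist.refl _) c hc (by simpa [listExp] using hne))
  | v :: vs, U, acc, h, c, hc => Kos.mem_supported_cons.2
      ⟨Kos.proj_mem_supported (fun ρ hρ f hf hne => h (v :: ρ) (hρ.cons_cons v) f hf (by
          rwa [listExp_cons, ← add_assoc])) (Kos.mem_all_cons.1 hc).1,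
        Kos.proj_mem_supported (fun ρ hρ f hf hne => h ρ (hρ.cons v) f hf hne)
          (Kos.mem_all_cons.1 hc).2⟩

/-- A chain on `vs` as a chain on a longer list. -/
def Kos.extend {N : Type*} [AddCommGroup N] {α : Type*} {vs : List α} (c : Kos N vs) :
    ∀ os : List α, Kos N (os ++ vs)
  | [] => c
  | v :: os => Kos.mk v (Kos.extend c os) 0

/-- The part of a chain without the factors `e_v` for the first elements `v` of the list. -/
def Kos.restrict {N : Type*} [AddCommGroup N] {α : Type*} {vs : List α} :
    ∀ os : List α, Kos N (os ++ vs) →+ Kos N vs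
  | [] => AddMonoidHom.id _
  | v :: os => (Kos.restrict os).comp (Kos.fst (v := v))

section

variable {N : Type*} [AddCommGroup N] {α : Type*} {vs : List α}

theorem Kos.restrict_cons {v : α} {os : List α} (c : Kos N (v :: os ++ vs)) :
    Kos.restrict (v :: os) c = Kos.restrict os (Kos.fst (v := v) c) := rfl

theorem Kos.restrict_extend (c : Kos N vs) : ∀ os : List α, Kos.restrict os (Kos.extend c os) = c
  | [] => rfl
  | _ :: os => Kos.restrict_extend c os

theorem Kos.extend_mem_all {G : AddSubgroup N} {c : Kos N vs} (hc : c ∈ Kos.All G vs) :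
    ∀ os : List α, Kos.extend c os ∈ Kos.All G (os ++ vs)
  | [] => hc
  | _ :: os => Kos.mem_all_cons.2 ⟨Kos.extend_mem_all hc os, zero_mem _⟩

theorem Kos.restrict_mem_all {G : AddSubgroup N} : ∀ {os : List α} {c : Kos N (os ++ vs)},
    c ∈ Kos.All G (os ++ vs) → Kos.restrict os c ∈ Kos.All G vs
  | [], _, hc => hc
  | _ :: os, _, hc => Kos.restrict_mem_all (os := os) (Kos.mem_all_cons.1 hc).1

theorem Kos.d_extend {f : α → N →+ N} {c : Kos N vs} (hc : Kos.d f vs c = 0) : ∀ os : List α,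
    Kos.d f (os ++ vs) (Kos.extend c os) = 0
  | [] => hc
  | v :: os => by
    refine Kos.ext (v := v) (vs := os ++ vs) ?_ ?_
    · change Kos.d f (os ++ vs) (Kos.extend c os) + Kos.map (f v) (os ++ vs) 0 = 0
      rw [Kos.d_extend hc os, map_zero, add_zero]
    · change -Kos.d f (os ++ vs) 0 = 0
      rw [map_zero, neg_zero]

theorem Kos.restrict_map {f : N →+ N} : ∀ {os : List α} (c : Kos N (os ++ vs)),
    Kos.restrict os (Kos.map f (os ++ vs) c) = Kos.map f vs (Kos.restrict os c)
  | [], _ => rfl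
  | v :: os, c => Kos.restrict_map (os := os) (Kos.fst (v := v) c)

end

/-- The variables in front do not divide the multidegree of `vs`, so their terms in the differential
have no component there. -/
theorem Kos.proj_restrict_d {vs : List (Fin n)} : ∀ {os : List (Fin n)} (_ : ∀ v ∈ os, v ∉ vs)
    (c : Kos (MvPolynomial (Fin n) K) (os ++ vs)),
    Kos.proj 0 vs (Kos.restrict os (Kos.d (varAct (K := K) (MvPolynomial (Fin n) K)) (os ++ vs) c)) =
      Kos.d (fun _ => AddMonoidHom.id K) vs (Kos.proj 0 vs (Kos.restrict os c))
  | [], _, c => Kos.proj_d 0 c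
  | v :: os, h, c => by
    rw [Kos.restrict_cons, Kos.restrict_cons]
    change Kos.proj 0 vs (Kos.restrict os (Kos.d _ (os ++ vs) (Kos.fst (v := v) c) +
      Kos.map (varAct (K := K) (MvPolynomial (Fin n) K) v) (os ++ vs) (Kos.snd (v := v) c))) = _
    rw [map_add, map_add, Kos.proj_restrict_d (fun w hw => h w (List.mem_cons_of_mem _ hw)),
      Kos.restrict_map, Kos.proj_map_varAct_eq_zero rfl (h v List.mem_cons_self), add_zero]

/-- An ideal does not have linear Koszul homology if it contains the unions of transversals, but
no products of variables other than those that contain lists below `Q` and above `P`. -/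
theorem Blocks.not_koszulLinear {P Q L : List (Fin n)} (hB : Blocks P Q L)
    (hL : L.Pairwise (· < ·)) (hPQ : P ≠ Q) {I : Ideal (MvPolynomial (Fin n) K)} {e : ℕ}
    (he : e ≤ P.length)
    (h1 : ∀ ρ, ρ.Sublist L → HasTransversals P Q ρ → monomial (listExp ρ) (1 : K) ∈ I)
    (h2 : ∀ ρ, ρ.Sublist L → ∀ f ∈ I, coeff (listExp ρ) f ≠ 0 → HasBelow Q ρ ∧ HasAbove P ρ) :
    ∃ vs : List (Fin n), vs.Nodup ∧ (∀ v, v ∈ vs) ∧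
      ¬ KoszulLinear vs (homogeneousSubmodule (Fin n) K) e I := by
  have hos : ∀ v ∈ (List.finRange n).filter (· ∉ L), v ∉ L := fun v hv => by
    simpa using (List.mem_filter.1 hv).2
  -- Placing L last makes extension by zero and restriction to L compatible with the recursive form
  -- of chains.
  refine ⟨(List.finRange n).filter (· ∉ L) ++ L, ?_, ?_, fun h => ?_⟩
  · exact List.nodup_append'.2 ⟨(List.nodup_finRange n).filter _, hL.imp ne_of_lt, hos⟩
  · intro v
    by_cases hv : v ∈ L
    · exact List.mem_append_right _ hv
    · exact List.mem_append_left _ (List.mem_filter.2 ⟨List.mem_finRange v, by simpa using hv⟩)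
  · obtain ⟨c, hc, hdc, hcy⟩ := hB.exists_cycle (K := K) hL hPQ
    have hG : ∀ ρ, ρ.Sublist L → HasTransversals P Q ρ → ∀ a : K,
        monomial (0 + listExp ρ) a ∈
          gradedPiece (homogeneousSubmodule (Fin n) K) I (P.length + 1) := by
      intro ρ hρ hU a
      rw [zero_add]
      refine ⟨?_, isHomogeneous_monomial _ (by rw [degree_listExp, hU.1])⟩
      have := I.mul_mem_left (C a) (h1 ρ hρ hU)
      rwa [C_mul_monomial, mul_one] at this
    obtain ⟨y, hy, hdy⟩ := h P.length he (Kos.extend (Kos.lift 0 L c) _)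
      (Kos.extend_mem_all (Kos.lift_mem_all hG hc) _)
      (Kos.d_extend (by rw [Kos.d_lift, hdc, map_zero]) _)
    refine hcy _ (Kos.proj_mem_supported (G := gradedPiece _ I P.length) (acc := 0)
      (fun ρ hρ f hf hne => h2 ρ hρ f hf.1 (by rwa [zero_add] at hne))
      (Kos.restrict_mem_all hy)) ?_
    rw [← Kos.proj_restrict_d hos, hdy, Kos.restrict_extend, Kos.proj_lift]

end

/-! ### Necessity -/

theorem blocks_self {α : Type*} [LinearOrder α] : ∀ l : List α, Blocks l l l
  | [] => .nil
  | a :: l => .one a (blocks_self l)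

theorem Transversal.eq_self {α : Type*} {P l : List α} (h : Transversal P P l) : l = P := by
  induction P generalizing l with
  | nil => cases h; rfl
  | cons p P ih => cases h with
    | left _ _ h => rw [ih h]
    | right _ _ h => rw [ih h]

theorem Transversal.mem_of_mem {α : Type*} [LinearOrder α] {P Q L l : List α} (hB : Blocks P Q L)
    (h : Transversal P Q l) : ∀ x ∈ l, x ∈ L := by
  induction hB generalizing l with
  | nil => cases h; simp
  | one p _ ih =>
    cases h with
    | left _ _ h => exact List.forall_mem_cons.2 ⟨by simp, fun x hx => by simp [ih h x hx]⟩
    | right _ _ h => exact List.forall_mem_cons.2 ⟨by simp, fun x hx => by simp [ih h x hx]⟩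
  | two _ _ ih =>
    cases h with
    | left _ _ h => exact List.forall_mem_cons.2 ⟨by simp, fun x hx => by simp [ih h x hx]⟩
    | right _ _ h => exact List.forall_mem_cons.2 ⟨by simp, fun x hx => by simp [ih h x hx]⟩

theorem Spread.pairwise_lt {t : ℕ} (ht : 1 ≤ t) {l : List ℕ} (h : Spread t l) :
    l.Pairwise (· < ·) := List.Pairwise.imp (fun {a b} (h : a + t ≤ b) => by omega) h

theorem not_shiftLE_cons {t u₁ u₂ w₁ : ℕ} {us ws : List ℕ}
    (h : ¬ ShiftLE t (u₁ :: u₂ :: us) (w₁ :: ws)) :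
    w₁ + t < u₂ ∨ (u₂ = w₁ + t ∧ ¬ ShiftLE t (u₂ :: us) ws) := by
  rw [ShiftLE] at h
  push Not at h
  rcases h.1.lt_or_eq with h1 | h1
  · exact Or.inl h1
  · exact Or.inr ⟨h1.symm, h.2 h1.symm⟩

/-- The blocks obtained from the failure of `ShiftLE`. -/
theorem exists_blocks {n t : ℕ} (ht : 1 ≤ t) : ∀ (us ws : List ℕ) (u₁ w₁ : ℕ),
    ws.length = us.length → Spread t us → Spread t (w₁ :: ws) → (∀ i ∈ us, i < n) →
    (∀ i ∈ ws, i < n) → ¬ ShiftLE t (u₁ :: us) (w₁ :: ws) →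
    ∃ P Q L, Blocks P Q L ∧ P.length = us.length ∧ L.Pairwise (· < ·) ∧
      (∀ x ∈ L, w₁ + t ≤ x ∧ x < n) ∧ P < us ∧ ws ≤ Q ∧
      ∀ l, Transversal P Q l → Spread t l ∧ (l ≠ P → us ≤ l) ∧ (l ≠ Q → l < ws)
  | [], _, _, _, _, _, _, _, _, h => absurd (by unfold ShiftLE; trivial) h
  | _ :: _, [], _, _, hl, _, _, _, _, _ => by simp at hl
  | u₂ :: us, w₂ :: ws, u₁, w₁, hl, hu, hw, hun, hwn, h => by
    have hw' := spread_cons.1 hw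
    have hw2 : w₁ + t ≤ w₂ := hw'.1 _ List.mem_cons_self
    have hw3 : ∀ i ∈ ws, w₁ + t ≤ i := fun i hi => hw'.1 i (List.mem_cons_of_mem _ hi)
    have hu2n : u₂ < n := hun _ List.mem_cons_self
    have hw2n : w₂ < n := hwn _ List.mem_cons_self
    rcases not_shiftLE_cons h with h1 | ⟨h1, h2⟩
    · rcases hw2.lt_or_eq with h3 | h3
      -- Q is the larger of the two tails, hence at least both. Lowering its first entry to w_1 + t
      -- gives P, which is below both.
      · obtain ⟨x, xs, hx, hlen, hxn, hx1, hxu, hxw⟩ : ∃ x xs, Spread t (x :: xs) ∧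
            xs.length = us.length ∧ (∀ i ∈ x :: xs, i < n) ∧ w₁ + t < x ∧ u₂ :: us ≤ x :: xs ∧
            w₂ :: ws ≤ x :: xs := by
          rcases le_total (u₂ :: us) (w₂ :: ws) with h4 | h4
          · exact ⟨w₂, ws, hw'.2, by simpa using hl, hwn, h3, h4, le_rfl⟩
          · exact ⟨u₂, us, hu, rfl, hun, h1, le_rfl, h4⟩
        have hx' := spread_cons.1 hx
        have hsp : Spread t ((w₁ + t) :: xs) := spread_cons.2
          ⟨fun i hi => by have := hx'.1 i hi; omega, hx'.2⟩
        refine ⟨(w₁ + t) :: xs, x :: xs, (w₁ + t) :: x :: xs, .two hx1 (blocks_self xs),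
          by simp [hlen], ?_, ?_, List.cons_lt_cons_iff.2 (Or.inl h1), hxw, ?_⟩
        · refine List.pairwise_cons.2 ⟨fun i hi => ?_, hx.pairwise_lt ht⟩
          exact lt_of_lt_of_le hx1 (head_le_of_spread hx i hi)
        · refine List.forall_mem_cons.2 ⟨⟨le_rfl, by omega⟩, fun i hi => ⟨?_, hxn i hi⟩⟩
          have := head_le_of_spread hx i hi
          omega
        · intro l hlt
          cases hlt with
          | left _ _ hlt =>
            rw [hlt.eq_self]
            exact ⟨hsp, fun hne => absurd rfl hne,
              fun _ => List.cons_lt_cons_iff.2 (Or.inl h3)⟩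
          | right _ _ hlt =>
            rw [hlt.eq_self]
            exact ⟨hx, fun _ => hxu, fun hne => absurd rfl hne⟩
      -- Here w_2 = w_1 + t < u_2, so the tail of w is itself below that of u. Singleton blocks
      -- suffice; a two-element block {u_1, w_1} is added in `shiftLE_of_koszulLinear`.
      · refine ⟨w₂ :: ws, w₂ :: ws, w₂ :: ws, blocks_self _, hl, hw'.2.pairwise_lt ht,
          fun i hi => ⟨hw'.1 i hi, hwn i hi⟩, List.cons_lt_cons_iff.2 (Or.inl (by omega)), le_rfl,
          fun l hlt => ?_⟩
        rw [hlt.eq_self]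
        exact ⟨hw'.2, fun hne => absurd rfl hne, fun hne => absurd rfl hne⟩
    -- The first entries agree after the shift, so the failure sits further right. When u_2 < w_2, a
    -- transversal starting with u_2 is automatically below w's tail and one starting with w_2 above
    -- u's tail; if u_2 = w_2 the new block is a singleton.
    · obtain ⟨P, Q, L, hB, hlen, hL, hLn, hP, hQ, hT⟩ := exists_blocks ht us ws u₂ w₂
        (by simpa using hl) (spread_cons.1 hu).2 hw'.2 (fun i hi => hun i (List.mem_cons_of_mem _ hi))
        (fun i hi => hwn i (List.mem_cons_of_mem _ hi)) h2
      have hTw : ∀ l, Transversal P Q l → Spread t (w₂ :: l) := fun l hl => spread_cons.2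
        ⟨fun i hi => (hLn i (hl.mem_of_mem hB i hi)).1, (hT l hl).1⟩
      have hTu : ∀ l, Transversal P Q l → Spread t (u₂ :: l) := fun l hl => spread_cons.2
        ⟨fun i hi => by have := (hLn i (hl.mem_of_mem hB i hi)).1; omega, (hT l hl).1⟩
      have hP' : u₂ :: P < u₂ :: us := List.cons_lt_cons_iff.2 (Or.inr ⟨rfl, hP⟩)
      have hQ' : w₂ :: ws ≤ w₂ :: Q := cons_le_cons_iff'.2 (Or.inr ⟨rfl, hQ⟩)
      rcases (h1 ▸ hw2 : u₂ ≤ w₂).lt_or_eq with h3 | rfl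
      · refine ⟨u₂ :: P, w₂ :: Q, u₂ :: w₂ :: L, .two h3 hB, by simp [hlen], ?_, ?_, hP', hQ', ?_⟩
        · refine List.pairwise_cons.2 ⟨List.forall_mem_cons.2 ⟨h3, fun i hi => ?_⟩,
            List.pairwise_cons.2 ⟨fun i hi => ?_, hL⟩⟩
          · have := (hLn i hi).1; omega
          · have := (hLn i hi).1; omega
        · refine List.forall_mem_cons.2 ⟨⟨by omega, hu2n⟩, List.forall_mem_cons.2
            ⟨⟨by omega, hw2n⟩, fun i hi => ⟨?_, (hLn i hi).2⟩⟩⟩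
          have := (hLn i hi).1; omega
        · intro l hlt
          cases hlt with
          | left _ _ hlt =>
            refine ⟨hTu _ hlt, fun hne => cons_le_cons_iff'.2 (Or.inr ⟨rfl, (hT _ hlt).2.1 ?_⟩),
              fun _ => List.cons_lt_cons_iff.2 (Or.inl h3)⟩
            rintro rfl; exact hne rfl
          | right _ _ hlt =>
            refine ⟨hTw _ hlt, fun _ => cons_le_cons_iff'.2 (Or.inl h3),
              fun hne => List.cons_lt_cons_iff.2 (Or.inr ⟨rfl, (hT _ hlt).2.2 ?_⟩)⟩
            rintro rfl; exact hne rfl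
      · have hT' : ∀ l, Transversal P Q l → Spread t (u₂ :: l) ∧
            (u₂ :: l ≠ u₂ :: P → u₂ :: us ≤ u₂ :: l) ∧ (u₂ :: l ≠ u₂ :: Q → u₂ :: l < u₂ :: ws) :=
          fun l hl => ⟨hTu _ hl,
            fun hne => cons_le_cons_iff'.2 (Or.inr ⟨rfl, (hT _ hl).2.1 fun e => hne (e ▸ rfl)⟩),
            fun hne => List.cons_lt_cons_iff.2
              (Or.inr ⟨rfl, (hT _ hl).2.2 fun e => hne (e ▸ rfl)⟩)⟩
        refine ⟨u₂ :: P, u₂ :: Q, u₂ :: L, .one _ hB, by simp [hlen], ?_, ?_, hP', hQ', ?_⟩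
        · exact List.pairwise_cons.2 ⟨fun i hi => by have := (hLn i hi).1; omega, hL⟩
        · refine List.forall_mem_cons.2 ⟨⟨by omega, hu2n⟩, fun i hi => ⟨?_, (hLn i hi).2⟩⟩
          have := (hLn i hi).1; omega
        · intro l hlt
          cases hlt with
          | left _ _ hlt => exact hT' _ hlt
          | right _ _ hlt => exact hT' _ hlt

theorem map_val_lt_iff {n : ℕ} : ∀ {l l' : List (Fin n)},
    l.map Fin.val < l'.map Fin.val ↔ l < l'
  | [], [] => by simp
  | [], _ :: _ => by simp
  | _ :: _, [] => by simp
  | a :: l, b :: l' => by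
    rw [List.map_cons, List.map_cons, List.cons_lt_cons_iff, List.cons_lt_cons_iff,
      map_val_lt_iff, Fin.val_inj, Fin.lt_def]

theorem Blocks.exists_fin {n : ℕ} {P Q L : List ℕ} (h : Blocks P Q L) (hL : ∀ x ∈ L, x < n) :
    ∃ P' Q' L' : List (Fin n), P'.map Fin.val = P ∧ Q'.map Fin.val = Q ∧ L'.map Fin.val = L ∧
      Blocks P' Q' L' := by
  induction h with
  | nil => exact ⟨[], [], [], rfl, rfl, rfl, .nil⟩
  | one p _ ih =>
    obtain ⟨P', Q', L', rfl, rfl, rfl, h⟩ := ih fun x hx => hL x (List.mem_cons_of_mem _ hx)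
    have hp : p < n := hL p List.mem_cons_self
    exact ⟨⟨p, hp⟩ :: P', ⟨p, hp⟩ :: Q', ⟨p, hp⟩ :: L', rfl, rfl, rfl, .one _ h⟩
  | @two p q _ _ _ hpq _ ih =>
    obtain ⟨P', Q', L', rfl, rfl, rfl, h⟩ := ih fun x hx => hL x (by simp [hx])
    have hp : p < n := hL p (by simp)
    have hq : q < n := hL q (by simp)
    exact ⟨⟨p, hp⟩ :: P', ⟨q, hq⟩ :: Q', ⟨p, hp⟩ :: ⟨q, hq⟩ :: L', rfl, rfl, rfl, .two hpq h⟩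

theorem Transversal.map {α β : Type*} (f : α → β) {P Q l : List α} (h : Transversal P Q l) :
    Transversal (P.map f) (Q.map f) (l.map f) := by
  induction h with
  | nil => exact .nil
  | left _ _ _ ih => exact .left _ _ ih
  | right _ _ _ ih => exact .right _ _ ih

theorem mem_varSet_listExp {n : ℕ} {l : List (Fin n)} {i : ℕ} :
    i ∈ varSet (listExp l) ↔ i ∈ l.map Fin.val := by
  constructor
  · rintro ⟨hi, h⟩
    by_contra hne
    exact h (listExp_apply_eq_zero fun hmem => hne (List.mem_map.2 ⟨_, hmem, rfl⟩))
  · intro h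
    obtain ⟨v, hv, rfl⟩ := List.mem_map.1 h
    exact ⟨v.2, listExp_apply_ne_zero hv⟩

theorem sublist_of_forall_mem {l ρ : List ℕ} (hl : l.Pairwise (· < ·)) (hρ : ρ.Pairwise (· < ·))
    (h : ∀ i ∈ l, i ∈ ρ) : l.Sublist ρ :=
  List.sublist_of_subperm_of_sortedLE (List.subperm_of_subset (hl.imp ne_of_lt) h)
    (hl.imp le_of_lt).sortedLE (hρ.imp le_of_lt).sortedLE

/-- For completely lexsegment ideals, linear Koszul homology implies `ShiftLE`. -/
theorem shiftLE_of_koszulLinear {n t : ℕ} {K : Type*} [Field K] (ht : 1 ≤ t) {u₁ w₁ : ℕ}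
    {us ws : List ℕ} (hu : Spread t (u₁ :: us)) (hw : Spread t (w₁ :: ws))
    (hlen : ws.length = us.length) (hun : ∀ i ∈ u₁ :: us, i < n) (hwn : ∀ i ∈ w₁ :: ws, i < n)
    (h₁ : u₁ < w₁)
    (hI : ∀ ρ : Set ℕ, (∀ i ∈ ρ, i < n) → Contains (SpreadBelow t (w₁ :: ws) 0) ρ →
      Contains (SpreadAbove t (u₁ :: us)) ρ → Contains (SpreadBetween t (u₁ :: us) (w₁ :: ws)) ρ)
    {e : ℕ} (he : e ≤ us.length + 1) (hlin : ∀ vs : List (Fin n), vs.Nodup → (∀ v, v ∈ vs) →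
      VarLinear K vs e (Contains (SpreadBetween t (u₁ :: us) (w₁ :: ws)))) :
    ShiftLE t (u₁ :: us) (w₁ :: ws) := by
  by_contra hsh
  obtain ⟨P, Q, L, hB, hPl, hL, hLn, hP, hQ, hT⟩ := exists_blocks ht us ws u₁ w₁ hlen
    (spread_cons.1 hu).2 hw (fun i hi => hun i (List.mem_cons_of_mem _ hi))
    (fun i hi => hwn i (List.mem_cons_of_mem _ hi)) hsh
  obtain ⟨P', Q', L', hP', hQ', hL', hB'⟩ := (Blocks.two h₁ hB).exists_fin (n := n) (by
    refine List.forall_mem_cons.2 ⟨hun _ List.mem_cons_self, List.forall_mem_cons.2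
      ⟨hwn _ List.mem_cons_self, fun i hi => (hLn i hi).2⟩⟩)
  have hsorted : (u₁ :: w₁ :: L).Pairwise (· < ·) := by
    refine List.pairwise_cons.2 ⟨List.forall_mem_cons.2 ⟨h₁, fun i hi => ?_⟩,
      List.pairwise_cons.2 ⟨fun i hi => ?_, hL⟩⟩
    · have := (hLn i hi).1; omega
    · have := (hLn i hi).1; omega
  have hTw : ∀ l, Transversal P Q l → Spread t (w₁ :: l) := fun l hl => spread_cons.2
    ⟨fun i hi => (hLn i (hl.mem_of_mem hB i hi)).1, (hT l hl).1⟩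
  have hTu : ∀ l, Transversal P Q l → Spread t (u₁ :: l) := fun l hl => spread_cons.2
    ⟨fun i hi => by have := (hLn i (hl.mem_of_mem hB i hi)).1; omega, (hT l hl).1⟩
  have hT' : ∀ l, Transversal (u₁ :: P) (w₁ :: Q) l → Spread t l ∧ l.length = us.length + 1 ∧
      (l ≠ u₁ :: P → u₁ :: us ≤ l) ∧ (l ≠ w₁ :: Q → l < w₁ :: ws) := by
    intro l hlt
    refine and_left_comm.1 ⟨by rw [hlt.length_eq, List.length_cons, hPl], ?_⟩
    cases hlt with
    | left _ _ hlt =>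
      refine ⟨hTu _ hlt, fun hne => cons_le_cons_iff'.2 (Or.inr ⟨rfl, (hT _ hlt).2.1 ?_⟩),
        fun _ => List.cons_lt_cons_iff.2 (Or.inl h₁)⟩
      rintro rfl; exact hne rfl
    | right _ _ hlt =>
      refine ⟨hTw _ hlt, fun _ => cons_le_cons_iff'.2 (Or.inl h₁),
        fun hne => List.cons_lt_cons_iff.2 (Or.inr ⟨rfl, (hT _ hlt).2.2 ?_⟩)⟩
      rintro rfl; exact hne rfl
  have hL'' : L'.Pairwise (· < ·) := by
    rw [← hL', List.pairwise_map] at hsorted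
    exact hsorted
  have hmono := monotone_contains (SpreadBetween t (u₁ :: us) (w₁ :: ws))
  have hinj : Function.Injective (List.map (Fin.val (n := n))) :=
    List.map_injective_iff.2 Fin.val_injective
  obtain ⟨vs, hvs, hvs', hnot⟩ := hB'.not_koszulLinear (K := K) hL'' (e := e)
    (I := varIdeal n K (Contains (SpreadBetween t (u₁ :: us) (w₁ :: ws))))
    (fun h => by rw [h, hQ'] at hP'; exact h₁.ne' (List.cons.inj hP').1)
    (by rw [← List.length_map (f := Fin.val), hP']; simpa [hPl] using he)
    (fun ρ hρ hU => by
      obtain ⟨-, ⟨l, hl, hlT, hlne⟩, l', hl', hlT', hlne'⟩ := hU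
      have h1 := hlT.map Fin.val
      have h2 := hlT'.map Fin.val
      rw [hP', hQ'] at h1 h2
      rw [mem_varIdeal hmono]
      intro m hm
      rw [Finset.mem_singleton.1 (support_monomial_subset hm)]
      -- Completeness enters here: a transversal other than Q is below w, one other than P is at
      -- least u, and together they force a generator in the interval.
      refine hI _ (fun i hi => hi.1) ⟨l'.map Fin.val, ⟨(hT' _ h2).1, ?_, by simp, ?_⟩, ?_⟩
        ⟨l.map Fin.val, ⟨(hT' _ h1).1, (hT' _ h1).2.1, (hT' _ h1).2.2.1 ?_⟩, ?_⟩
      · rw [(hT' _ h2).2.1, List.length_cons, hlen]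
      · exact (hT' _ h2).2.2.2 fun h => hlne' (hinj (h.trans hQ'.symm))
      · exact fun i hi => mem_varSet_listExp.2 ((hl'.map _).subset hi)
      · exact fun h => hlne (hinj (h.trans hP'.symm))
      · exact fun i hi => mem_varSet_listExp.2 ((hl.map _).subset hi))
    (fun ρ hρ f hf hne => by
      obtain ⟨z, ⟨hz, hzl, huz, hzw⟩, hzρ⟩ := (mem_varIdeal hmono).1 hf _ (mem_support_iff.2 hne)
      have h1 : z.Sublist (ρ.map Fin.val) := by
        refine sublist_of_forall_mem (hz.pairwise_lt ht) ?_
          fun i hi => mem_varSet_listExp.1 (hzρ i hi)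
        rw [List.pairwise_map]
        exact hL''.sublist hρ
      obtain ⟨a, ha, rfl⟩ := List.sublist_map_iff.1 h1
      have hPl' : P'.length = us.length + 1 := by
        rw [← List.length_map (f := Fin.val), hP', List.length_cons, hPl]
      rw [List.length_map, List.length_cons] at hzl
      -- Because P < u and w ≤ Q, a generator of the lexsegment ideal serves both as the list above
      -- P and as the list below Q.
      refine ⟨⟨a, ha, by rw [hzl, ← hB'.length_eq, hPl'], map_val_lt_iff.1 ?_⟩,
        a, ha, by rw [hzl, hPl'], map_val_lt_iff.1 ?_⟩
      · rw [hQ']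
        exact lt_of_lt_of_le hzw (cons_le_cons_iff'.2 (Or.inr ⟨rfl, hQ⟩))
      · rw [hP']
        exact lt_of_lt_of_le (List.cons_lt_cons_iff.2 (Or.inr ⟨rfl, hP⟩)) huz)
  exact hnot (hlin vs hvs hvs')

/-! ### Translation to lists -/

section

variable {n d t : ℕ}

/-- The list of the indices of a sequence of variables. -/
def toList (a : Fin d → Fin n) : List ℕ := List.ofFn fun k => (a k : ℕ)

theorem toList_eq_map (a : Fin d → Fin n) : toList a = (List.ofFn a).map Fin.val := by
  rw [List.map_ofFn]; rfl

theorem length_toList (a : Fin d → Fin n) : (toList a).length = d := List.length_ofFn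

theorem lt_of_mem_toList {a : Fin d → Fin n} {i : ℕ} (h : i ∈ toList a) : i < n := by
  rw [toList_eq_map] at h
  obtain ⟨v, -, rfl⟩ := List.mem_map.1 h
  exact v.2

theorem toList_injective : Function.Injective (toList (n := n) (d := d)) := fun _ _ h =>
  funext fun k => Fin.ext (congrFun (List.ofFn_injective h) k)

theorem exists_toList_eq {z : List ℕ} (hl : z.length = d) (hz : ∀ i ∈ z, i < n) :
    ∃ a : Fin d → Fin n, toList a = z := by
  subst hl
  exact ⟨fun k => ⟨z.get k, hz _ (List.get_mem _ _)⟩, List.ofFn_get z⟩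

theorem mem_spreadMonomials_iff {a : Fin d → Fin n} :
    a ∈ spreadMonomials n d t ↔ Spread t (toList a) := by
  rw [Spread, toList, List.pairwise_ofFn]
  constructor
  · intro h
    have key : ∀ m i : ℕ, ∀ hi : i + 1 + m < d,
        (a ⟨i, by omega⟩ : ℕ) + t ≤ (a ⟨i + 1 + m, hi⟩ : ℕ) := by
      intro m
      induction m with
      | zero => exact fun i hi => h i hi
      | succ m ih =>
        intro i hi
        have h1 := ih i (by omega)
        have h2 := h (i + 1 + m) hi
        simp only [← add_assoc]
        omega
    intro i j hij
    have h1 := key ((j : ℕ) - (i + 1)) i (by omega)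
    have h2 : (⟨(i : ℕ) + 1 + ((j : ℕ) - (i + 1)), by omega⟩ : Fin d) = j :=
      Fin.ext (by simp only; omega)
    rwa [h2] at h1
  · exact fun h k hk => h (Fin.lt_def.2 (Nat.lt_succ_self k))

theorem toList_succ (a : Fin (d + 1) → Fin n) :
    toList a = (a 0 : ℕ) :: toList fun k => a k.succ := by
  rw [toList, List.ofFn_succ]; rfl

theorem toList_lt_iff : ∀ {d : ℕ} {a b : Fin d → Fin n}, toList a < toList b ↔ SlexGT a b
  | 0, a, b => by
    constructor
    · intro h
      exact absurd h (by simp [toList])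
    · rintro ⟨s, -⟩
      exact s.elim0
  | d + 1, a, b => by
    rw [toList_succ, toList_succ, List.cons_lt_cons_iff, toList_lt_iff]
    constructor
    · rintro (h | ⟨h, s, hs, hlt⟩)
      · exact ⟨0, fun r hr => absurd hr (Fin.not_lt_zero r), h⟩
      · refine ⟨s.succ, fun r hr => ?_, hlt⟩
        cases r using Fin.cases with
        | zero => exact Fin.ext h
        | succ r => exact hs r (Fin.succ_lt_succ_iff.1 hr)
    · rintro ⟨s, hs, hlt⟩
      cases s using Fin.cases with
      | zero => exact Or.inl hlt
      | succ s => exact Or.inr ⟨congrArg Fin.val (hs 0 (Fin.succ_pos s)), s,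
          fun r hr => hs r.succ (Fin.succ_lt_succ_iff.2 hr), hlt⟩

theorem toList_le_iff {a b : Fin d → Fin n} : toList a ≤ toList b ↔ SlexGE a b := by
  rw [le_iff_eq_or_lt, toList_lt_iff, toList_injective.eq_iff]; rfl

theorem expo_eq_listExp (a : Fin d → Fin n) : expo a = listExp (List.ofFn a) := by
  rw [listExp, List.map_ofFn, List.sum_ofFn]; rfl

theorem listExp_apply_le_one {l : List (Fin n)} (hl : l.Nodup) (v : Fin n) : listExp l v ≤ 1 := by
  induction l with
  | nil => simp [listExp]
  | cons w l ih =>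
    have h := List.nodup_cons.1 hl
    rw [listExp_cons, Finsupp.add_apply]
    by_cases hv : v = w
    · subst hv
      rw [listExp_apply_eq_zero h.1, Finsupp.single_eq_same]
    · rw [Finsupp.single_eq_of_ne hv, zero_add]
      exact ih h.2

/-- For t ≥ 1 the monomial is squarefree, so divisibility depends only on supports. -/
theorem expo_le_iff (ht : 1 ≤ t) {a : Fin d → Fin n} (ha : a ∈ spreadMonomials n d t)
    {m : Fin n →₀ ℕ} : expo a ≤ m ↔ ∀ i ∈ toList a, i ∈ varSet m := by
  rw [expo_eq_listExp, toList_eq_map]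
  constructor
  · exact fun h i hi => varSet_mono h (mem_varSet_listExp.2 hi)
  · intro h v
    by_cases hv : v ∈ List.ofFn a
    · have h1 : (List.ofFn a).Nodup := by
        refine List.Nodup.of_map Fin.val ?_
        rw [← toList_eq_map]
        exact ((mem_spreadMonomials_iff.1 ha).pairwise_lt ht).imp ne_of_lt
      obtain ⟨_, h2⟩ := h v (List.mem_map_of_mem hv)
      exact (listExp_apply_le_one h1 v).trans (Nat.one_le_iff_ne_zero.2 h2)
    · rw [listExp_apply_eq_zero hv]
      exact Nat.zero_le _

theorem idealOf_eq_varIdeal (K : Type*) [Field K] (ht : 1 ≤ t) {A : Set (Fin d → Fin n)}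
    (hA : A ⊆ spreadMonomials n d t) {𝓕 : List ℕ → Prop} (h𝓕 : ∀ z, 𝓕 z → z.length = d)
    (h : ∀ a, a ∈ A ↔ 𝓕 (toList a)) : idealOf K A = varIdeal n K (Contains 𝓕) := by
  ext f
  rw [idealOf, ← Set.image_image (fun s => monomial s (1 : K)) expo, mem_ideal_span_monomial_image,
    mem_varIdeal (monotone_contains 𝓕)]
  refine forall₂_congr fun m _ => ⟨?_, ?_⟩
  · rintro ⟨_, ⟨a, ha, rfl⟩, hm⟩
    exact ⟨toList a, (h a).1 ha, (expo_le_iff ht (hA ha)).1 hm⟩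
  · rintro ⟨z, hz, hzm⟩
    obtain ⟨a, rfl⟩ := exists_toList_eq (h𝓕 z hz) fun i hi => (hzm i hi).1
    have ha := (h a).2 hz
    exact ⟨_, ⟨a, ha, rfl⟩, (expo_le_iff ht (hA ha)).2 hzm⟩

theorem degree_expo (a : Fin d → Fin n) : (expo a).degree = d := by
  rw [expo_eq_listExp, degree_listExp, List.length_ofFn]

theorem span_gradedPiece_idealOf (K : Type*) [Field K] (A : Set (Fin d → Fin n)) :
    Ideal.span (gradedPiece (homogeneousSubmodule (Fin n) K) (idealOf K A) d :
      Set (MvPolynomial (Fin n) K)) = idealOf K A := by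
  refine le_antisymm (Ideal.span_le.2 fun f hf => hf.1) (Ideal.span_mono ?_)
  rintro _ ⟨a, ha, rfl⟩
  exact ⟨Ideal.subset_span ⟨a, ha, rfl⟩, isHomogeneous_monomial _ (degree_expo a)⟩

/-! ### The monomial order -/

/-- Common heads cancel. At the first difference the smaller index occurs in A but not in B, while
no smaller variable occurs in either; so the smaller list is the larger monomial. -/
theorem toSyn_listExp_lt : ∀ {A B : List (Fin n)}, A.length = B.length → A.Pairwise (· ≤ ·) →
    B.Pairwise (· ≤ ·) → A < B →
    MonomialOrder.lex.toSyn (listExp B) < MonomialOrder.lex.toSyn (listExp A)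
  | [], [], _, _, _, h => absurd h (lt_irrefl _)
  | a :: A, b :: B, hl, hA, hB, h => by
    rcases List.cons_lt_cons_iff.1 h with h | ⟨rfl, h'⟩
    · refine MonomialOrder.lex_lt_iff.2 (Finsupp.Lex.lt_iff.2 ⟨a, fun i hi => ?_, ?_⟩)
      · have h1 : i ∉ a :: A := fun hmem => by
          rcases List.mem_cons.1 hmem with rfl | hmem
          · exact lt_irrefl _ hi
          · exact absurd hi ((List.pairwise_cons.1 hA).1 i hmem).not_gt
        have h2 : i ∉ b :: B := fun hmem => by
          rcases List.mem_cons.1 hmem with rfl | hmem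
          · exact lt_asymm hi h
          · exact absurd (hi.trans h) ((List.pairwise_cons.1 hB).1 i hmem).not_gt
        exact (listExp_apply_eq_zero h2).trans (listExp_apply_eq_zero h1).symm
      · have h2 : a ∉ b :: B := fun hmem => by
          rcases List.mem_cons.1 hmem with rfl | hmem
          · exact lt_irrefl _ h
          · exact absurd h ((List.pairwise_cons.1 hB).1 a hmem).not_gt
        change listExp (b :: B) a < listExp (a :: A) a
        rw [listExp_apply_eq_zero h2]
        exact Nat.pos_of_ne_zero (listExp_apply_ne_zero List.mem_cons_self)
    · rw [listExp_cons, listExp_cons, map_add, map_add]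
      exact add_lt_add_right (toSyn_listExp_lt (by simpa using hl) (List.pairwise_cons.1 hA).2
        (List.pairwise_cons.1 hB).2 h') _

theorem toSyn_listExp_le_iff {A B : List (Fin n)} (hl : A.length = B.length)
    (hA : A.Pairwise (· ≤ ·)) (hB : B.Pairwise (· ≤ ·)) :
    MonomialOrder.lex.toSyn (listExp A) ≤ MonomialOrder.lex.toSyn (listExp B) ↔ B ≤ A := by
  constructor
  · intro h
    by_contra hlt
    exact absurd h (toSyn_listExp_lt hl hA hB (not_le.1 hlt)).not_ge
  · intro h
    rcases h.lt_or_eq with h | h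
    · exact (toSyn_listExp_lt hl.symm hB hA h).le
    · rw [h]

theorem map_sub_le_dropLast_iff : ∀ {us ws : List ℕ} (u₁ : ℕ) (_ : ∀ i ∈ us, t ≤ i)
    (_ : ws.length = us.length + 1),
    us.map (· - t) ≤ ws.dropLast ↔ ShiftLE t (u₁ :: us) ws
  | [], ws, u₁, _, hl => by
    unfold ShiftLE
    exact iff_of_true (nil_le' _) trivial
  | u₂ :: us, w₁ :: w₂ :: ws, u₁, hu, hl => by
    rw [List.dropLast_cons_cons, List.map_cons, cons_le_cons_iff', ShiftLE,
      map_sub_le_dropLast_iff u₂ (fun i hi => hu i (List.mem_cons_of_mem _ hi)) (by simpa using hl)]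
    have := hu u₂ List.mem_cons_self
    exact or_congr (by omega) (and_congr_left' (by omega))

/-- The common factor x_1 cancels, deleting the largest variable is `dropLast`, and passing to lists
reverses the order. Subtracting t truncates nothing, since all entries of u after the first are at
least t. -/
theorem toSyn_expoReplaceMax_le_iff {m : ℕ} (hn : 1 ≤ n) (ht : 1 ≤ t)
    {u w : Fin (m + 2) → Fin n} (hu : u ∈ spreadMonomials n (m + 2) t)
    (hw : w ∈ spreadMonomials n (m + 2) t) :
    MonomialOrder.lex.toSyn (expoReplaceMax hn (by omega) w) ≤
      MonomialOrder.lex.toSyn (expoShift hn t u) ↔ ShiftLE t (toList u) (toList w) := by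
  have h1 : expoReplaceMax hn (by omega) w = Finsupp.single ⟨0, hn⟩ 1 +
      listExp (List.ofFn fun k : Fin (m + 1) => w k.castSucc) := by
    rw [expoReplaceMax, expo, Fin.sum_univ_castSucc, ← expo_eq_listExp]
    congr 1
    exact add_tsub_cancel_right _ _
  have h2 : expoShift hn t u = Finsupp.single ⟨0, hn⟩ 1 + listExp (List.ofFn fun k : Fin (m + 1) =>
      (⟨(u k.succ : ℕ) - t, lt_of_le_of_lt (Nat.sub_le _ _) (u k.succ).isLt⟩ : Fin n)) := by
    rw [expoShift, Finset.sum_filter, Fin.sum_univ_succ, ← expo_eq_listExp, expo]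
    simp
  have hu' := mem_spreadMonomials_iff.1 hu
  rw [toList_succ] at hu'
  have hw' := (mem_spreadMonomials_iff.1 hw).pairwise_lt ht
  have hge : ∀ i ∈ toList (fun k : Fin (m + 1) => u k.succ), t ≤ i := fun i hi => by
    have := (spread_cons.1 hu').1 i hi
    omega
  rw [h1, h2, map_add, map_add, add_le_add_iff_left, toSyn_listExp_le_iff (by simp),
    ← not_lt, ← map_val_lt_iff, not_lt, toList_succ u,
    ← map_sub_le_dropLast_iff _ hge (by rw [length_toList, length_toList])]
  · have h3 : (List.ofFn fun k : Fin (m + 1) => (⟨(u k.succ : ℕ) - t,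
        lt_of_le_of_lt (Nat.sub_le _ _) (u k.succ).isLt⟩ : Fin n)).map Fin.val =
        (toList fun k : Fin (m + 1) => u k.succ).map (· - t) := by
      rw [toList, List.map_ofFn, List.map_ofFn]; rfl
    have h4 : (List.ofFn fun k : Fin (m + 1) => w k.castSucc).map Fin.val =
        (toList w).dropLast := by
      rw [toList, List.ofFn_succ' (fun k => (w k : ℕ)), List.concat_eq_append, List.dropLast_concat, List.map_ofFn]; rfl
    rw [h3, h4]
  · rw [toList, List.pairwise_ofFn] at hw'
    rw [List.pairwise_ofFn]
    exact fun i j hij => (hw' (Fin.castSucc_lt_castSucc_iff.2 hij)).le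
  · have h5 := (spread_cons.1 hu').2.pairwise_lt ht
    rw [toList, List.pairwise_ofFn] at h5
    rw [List.pairwise_ofFn]
    exact fun i j hij => Nat.sub_le_sub_right (h5 hij).le t

theorem exists_isLargestBelow {v : Fin d → Fin n}
    (h : ∃ z ∈ spreadMonomials n d t, SlexGT v z) : ∃ w, IsLargestBelow t w v := by
  obtain ⟨w, hw, hmin⟩ := Set.exists_min_image {z | z ∈ spreadMonomials n d t ∧ SlexGT v z} toList
    (Set.toFinite _) h
  exact ⟨w, hw, fun z hz => toList_le_iff.1 (hmin z hz)⟩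

end

/-! ### Lexsegment ideals in terms of supports. -/

section

variable {n m t : ℕ}

theorem koszulLinear_of_varLinear {K : Type*} [Field K] {d : ℕ} {A : Set (Fin d → Fin n)}
    {U : Set ℕ → Prop} (h : VarLinear K (List.finRange n) d U)
    (hA : idealOf K A = varIdeal n K U) : HasLinearResolution (idealOf K A) :=
  ⟨d, KoszulLinear.hasLinearResolution (by rw [hA]; exact h) (span_gradedPiece_idealOf K A)⟩

/-- The exponent vector of the product of the variables with indices in a set. -/
noncomputable def setExp (n : ℕ) (ρ : Set ℕ) : Fin n →₀ ℕ :=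
  open Classical in Finsupp.equivFunOnFinite.symm fun i => if (i : ℕ) ∈ ρ then 1 else 0

theorem varSet_setExp {ρ : Set ℕ} (hρ : ∀ i ∈ ρ, i < n) : varSet (setExp n ρ) = ρ := by
  ext i
  constructor
  · rintro ⟨hi, h⟩
    by_contra hne
    exact h (by simp [setExp, hne])
  · exact fun hi => ⟨hρ i hi, by simp [setExp, hi]⟩

/-- The inclusion of ideals is tested on the squarefree monomial with support ρ. -/
theorem contains_of_inf_le {K : Type*} [Field K] {A B C : Set ℕ → Prop} (hA : Monotone A)
    (hB : Monotone B) (hC : Monotone C)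
    (h : varIdeal n K A ⊓ varIdeal n K B ≤ varIdeal n K C) {ρ : Set ℕ} (hρ : ∀ i ∈ ρ, i < n)
    (hAρ : A ρ) (hBρ : B ρ) : C ρ := by
  have key : ∀ {D : Set ℕ → Prop} (_ : Monotone D),
      monomial (setExp n ρ) (1 : K) ∈ varIdeal n K D ↔ D ρ := by
    intro D hD
    rw [mem_varIdeal hD]
    classical
    simp [support_monomial, varSet_setExp hρ]
  exact (key hC).1 (h ⟨(key hA).2 hAρ, (key hB).2 hBρ⟩)

theorem mem_lexsegment_iff {d : ℕ} {u v w : Fin d → Fin n} (hw : IsLargestBelow t w v)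
    (a : Fin d → Fin n) :
    a ∈ lexsegment t u v ↔ SpreadBetween t (toList u) (toList w) (toList a) := by
  rw [lexsegment, Set.mem_ofPred_eq, SpreadBetween, mem_spreadMonomials_iff, ← toList_le_iff,
    ← toList_le_iff, length_toList, length_toList]
  constructor
  · rintro ⟨h1, h2, h3⟩
    exact ⟨h1, rfl, h2, lt_of_le_of_lt h3 (toList_lt_iff.2 hw.1.2)⟩
  · rintro ⟨h1, -, h2, h3⟩
    refine ⟨h1, h2, not_lt.1 fun h4 => ?_⟩
    exact absurd h3 (toList_le_iff.2
      (hw.2 a ⟨mem_spreadMonomials_iff.2 h1, toList_lt_iff.1 h4⟩)).not_gt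

theorem mem_initialLexsegment_iff {d : ℕ} {v w : Fin d → Fin n} (hw : IsLargestBelow t w v)
    (a : Fin d → Fin n) :
    a ∈ initialLexsegment t v ↔ SpreadBelow t (toList w) 0 (toList a) := by
  rw [initialLexsegment, Set.mem_ofPred_eq, SpreadBelow, mem_spreadMonomials_iff, ← toList_le_iff,
    length_toList, length_toList]
  constructor
  · rintro ⟨h1, h3⟩
    exact ⟨h1, rfl, fun _ _ => Nat.zero_le _, lt_of_le_of_lt h3 (toList_lt_iff.2 hw.1.2)⟩
  · rintro ⟨h1, -, -, h3⟩
    refine ⟨h1, not_lt.1 fun h4 => ?_⟩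
    exact absurd h3 (toList_le_iff.2
      (hw.2 a ⟨mem_spreadMonomials_iff.2 h1, toList_lt_iff.1 h4⟩)).not_gt

theorem mem_finalLexsegment_iff {d : ℕ} {u : Fin d → Fin n} (a : Fin d → Fin n) :
    a ∈ finalLexsegment t u ↔ SpreadAbove t (toList u) (toList a) := by
  rw [finalLexsegment, Set.mem_ofPred_eq, SpreadAbove, mem_spreadMonomials_iff, ← toList_le_iff,
    length_toList, length_toList]
  simp

theorem mem_lexsegment_iff_of_not_exists {d : ℕ} {u v : Fin d → Fin n}
    (hv : ¬ ∃ w, IsLargestBelow t w v) (a : Fin d → Fin n) :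
    a ∈ lexsegment t u v ↔ SpreadAbove t (toList u) (toList a) := by
  rw [← mem_finalLexsegment_iff]
  refine and_congr_right fun ha => and_iff_left ?_
  rw [← toList_le_iff]
  refine not_lt.1 fun h => hv (exists_isLargestBelow ⟨a, ha, toList_lt_iff.1 h⟩)

end

theorem mainTheorem2 {K : Type*} [Field K] (n d t : ℕ) (hd : 2 ≤ d) (ht : 1 ≤ t)
    (hn : 1 + (d - 1) * t ≤ n) (u v : Fin d → Fin n)
    (hu : u ∈ spreadMonomials n d t) (hv : v ∈ spreadMonomials n d t) (huv : SlexGE u v)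
    (hI : IsCompletelyLexsegment K t u v)
    (hmin_u : idx u 1 (by omega) = 1)
    (hmin_v : idx u 1 (by omega) < idx v 1 (by omega)) :
    HasLinearResolution (idealOf K (lexsegment t u v)) ↔
      (idx u 2 (by omega) = 1 + t ∨
        (1 + t < idx u 2 (by omega) ∧
          ∀ w, IsLargestBelow t w v →
            MonomialOrder.lex.toSyn (expoReplaceMax (by omega) (by omega) w) ≤
              MonomialOrder.lex.toSyn (expoShift (by omega) t u))) := by
  obtain ⟨m, rfl⟩ : ∃ m, d = m + 2 := ⟨d - 2, by omega⟩
  have hu0 : (u 0 : ℕ) = 0 := Nat.succ.inj hmin_u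
  have hv0 : (u 0 : ℕ) < v 0 := Nat.lt_of_succ_lt_succ hmin_v
  have hsub : lexsegment t u v ⊆ spreadMonomials n (m + 2) t := fun _ h => h.1
  obtain ⟨us, hU⟩ : ∃ us, toList u = 0 :: (u 1 : ℕ) :: us :=
    ⟨_, by rw [toList_succ, toList_succ, hu0]; rfl⟩
  have hus : us.length = m := by
    have := length_toList u
    rw [hU] at this
    simpa using this
  have hUs : Spread t (0 :: (u 1 : ℕ) :: us) := hU ▸ mem_spreadMonomials_iff.1 hu
  have hUn : ∀ i ∈ 0 :: (u 1 : ℕ) :: us, i < n := hU ▸ fun i => lt_of_mem_toList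
  have hu1 : t ≤ (u 1 : ℕ) := by
    have := (spread_cons.1 hUs).1 _ List.mem_cons_self
    omega
  have hidx : idx u 2 (by omega) = (u 1 : ℕ) + 1 := rfl
  have hvs := List.nodup_finRange n
  have hvs' := List.mem_finRange (n := n)
  have hcond : ∀ w, IsLargestBelow t w v →
      (MonomialOrder.lex.toSyn (expoReplaceMax (by omega) (by omega) w) ≤
        MonomialOrder.lex.toSyn (expoShift (by omega) t u) ↔
          ShiftLE t (0 :: (u 1 : ℕ) :: us) (toList w)) := fun w hw => by
    rw [← hU]
    exact toSyn_expoReplaceMax_le_iff (by omega) ht hu hw.1.1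
  have hW : ∀ w, IsLargestBelow t w v → ∃ w₁ ws, toList w = w₁ :: ws ∧ 0 < w₁ ∧
      ws.length = us.length + 1 := fun w hw => by
    -- As w is below v, its first index is at least that of v, which exceeds that of u.
    refine ⟨_, _, toList_succ w, ?_, by rw [length_toList, hus]⟩
    have h1 := toList_lt_iff.2 hw.1.2
    rw [toList_succ v, toList_succ w, List.cons_lt_cons_iff] at h1
    omega
  constructor
  · rintro ⟨e, he⟩
    rcases hu1.lt_or_eq with h1 | h1
    · refine Or.inr ⟨by omega, fun w hw => (hcond w hw).2 ?_⟩
      obtain ⟨w₁, ws, hw1, hw0, hws⟩ := hW w hw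
      have hId : idealOf K (lexsegment t u v) = _ := idealOf_eq_varIdeal K ht hsub
        (fun z hz => hz.2.1.trans (length_toList u)) (mem_lexsegment_iff hw)
      have hJ : idealOf K (initialLexsegment t v) = _ := idealOf_eq_varIdeal K ht
        (fun _ h => h.1) (fun z hz => hz.2.1.trans (length_toList w)) (mem_initialLexsegment_iff hw)
      have hT : idealOf K (finalLexsegment t u) = _ := idealOf_eq_varIdeal K ht
        (fun _ h => h.1) (fun z hz => hz.2.1.trans (length_toList u)) mem_finalLexsegment_iff
      have hWs := mem_spreadMonomials_iff.1 hw.1.1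
      have hWn : ∀ i ∈ toList w, i < n := fun i => lt_of_mem_toList
      rw [IsCompletelyLexsegment, hId, hJ, hT] at hI
      -- The degree e of the resolution is not known beforehand; the generator u bounds it, which is
      -- all that the obstruction needs.
      have hdeg : e ≤ m + 2 := by
        refine (he.koszulLinear hvs hvs').2 (m + 2) (monomial (expo u) 1)
          (Ideal.subset_span ⟨u, ⟨hu, Or.inl rfl, huv⟩, rfl⟩)
          (isHomogeneous_monomial _ (degree_expo u)) ?_
        rw [Ne, monomial_eq_zero]
        exact one_ne_zero
      rw [hId] at he
      rw [hw1, hU] at hI he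
      rw [hw1] at hWs hWn ⊢
      exact shiftLE_of_koszulLinear (K := K) ht hUs hWs (by simpa using hws) hUn hWn hw0
        (fun ρ hρ hA hB => contains_of_inf_le (monotone_contains _) (monotone_contains _)
          (monotone_contains _) hI.ge hρ hA hB) (e := e) (by simp [hus]; omega)
        fun vs hvs hvs' => (he.koszulLinear hvs hvs').1
    · exact Or.inl (by omega)
  · intro h
    by_cases hex : ∃ w, IsLargestBelow t w v
    · obtain ⟨w, hw⟩ := hex
      obtain ⟨w₁, ws, hw1, hw0, hws⟩ := hW w hw
      have hId : idealOf K (lexsegment t u v) = _ := idealOf_eq_varIdeal K ht hsub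
        (fun z hz => hz.2.1.trans (length_toList u)) (mem_lexsegment_iff hw)
      refine koszulLinear_of_varLinear ?_ hId
      rw [hU, hw1]
      rcases h with h | ⟨-, h⟩
      · have h1 : (u 1 : ℕ) = 0 + t := by omega
        rw [h1] at hUs hUn ⊢
        rw [← hus]
        exact varLinear_spreadBetween_of_eq hvs hvs' ht hUs hUn hws hw0
      · have h1 := varLinear_spreadBetween (K := K) hvs hvs' ht _ hUs hUn (w₁ :: ws) (by simp [hws])
          (hw1 ▸ (hcond w hw).1 (h w hw))
        rwa [List.length_cons, List.length_cons, hus] at h1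
    · have hId : idealOf K (lexsegment t u v) = _ := idealOf_eq_varIdeal K ht hsub
        (fun z hz => hz.2.1.trans (length_toList u)) (mem_lexsegment_iff_of_not_exists hex)
      refine koszulLinear_of_varLinear ?_ hId
      -- When nothing lies below v, the lexsegment is a final segment, and these are linear for
      -- every u.
      have h1 := VarLinear.spreadAbove (K := K) (varLinear_spreadBetween hvs hvs' ht (toList u)
        (mem_spreadMonomials_iff.1 hu) (fun i => lt_of_mem_toList) _ (by simp)
        (shiftLE_replicate ht (fun i => lt_of_mem_toList) _)) (by rw [hU]; simp)
      rwa [length_toList] at h1
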